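/- Let $\mathbb F$ be a non-archimedean local field of characteristic $0$ with ring of integers $\mathfrak o_{\mathbb F}$ and module (normalized absolute value) $|\cdot|_{\mathbb F}$, and let $\chi$ be a continuous unitary character of the additive group $\mathbb F$ with kernel $\mathfrak o_{\mathbb F}$. Let $W\neq 0$ be a finite dimensional $\mathbb F$-vector space with a non-degenerate symplectic form $\langle\cdot,\cdot\rangle$, with symplectic group $\mathrm{Sp}(W)$ and Lie algebra $\mathfrak{sp}(W)\subseteq \mathrm{End}(W)$. Let $\mathcal L\subseteq W$ be a lattice (a compact open $\mathfrak o_{\mathbb F}$-submodule) that is self-dual: $w\in\mathcal L$ if and only if $\langle w,w'\rangle\in\mathfrak o_{\mathbb F}$ for all $w'\in\mathcal L$. Normalize the Haar measures $dw$ on $W$ and $dx$ on $\mathfrak{sp}(W)$ so that $\mathcal L$ and $\{x\in\mathfrak{sp}(W): x\mathcal L\subseteq\mathcal L\}$ have volume $1$. Write $\mathcal S(E)$ for the space of locally constant, compactly supported complex functions on a finite dimensional $\mathbb F$-vector space $E$, $\mathcal S^*(E)$ for its linear dual (the distributions on $E$), and let $\tau:W\to\mathfrak{sp}^*(W)$,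 $\tau(w)(x)=\langle xw,w\rangle$, be the moment map. For $\psi\in\mathcal S(\mathfrak{sp}(W))$ set $$\mathrm{chc}(\psi)=\int_W\int_{\mathfrak{sp}(W)}\chi(\langle xw,w\rangle)\psi(x)\,dx\,dw .$$ (i) Each of the two consecutive integrals converges absolutely, and $\mathrm{chc}$ is a distribution, $\mathrm{chc}\in\mathcal S^*(\mathfrak{sp}(W))$. (ii) For all $\psi\in\mathcal S(\mathfrak{sp}(W))$, $$\mathrm{chc}(\psi)=\int_{\mathfrak{sp}(W)}\gamma_{\mathrm{Weil}}(x)\,|2|_{\mathbb F}^{-\frac12\dim W}\,|\det x|_{\mathbb F}^{-\frac12}\,\psi(x)\,dx ,$$ where the integral converges absolutely (the factor $|2|_{\mathbb F}^{-\frac12\dim W}$ is $1$ when the residue characteristic is odd). Here, for $\det x\ne0$, $\gamma_{\mathrm{Weil}}(x)$ is the Weil factor of the quadratic form $q(w)=\langle xw,w\rangle$ relative to $\chi$: the complex number of absolute value $1$ such that, for some $c>0$, $\int_W\int_W\Phi(v-w)\chi(q(w))\,dw\,dv=\gamma_{\mathrm{Weil}}(x)\,c\int_W\Phi(v)\,dv$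 for all $\Phi\in\mathcal S(W)$. It exists, and $\gamma_{\mathrm{Weil}}(x)^8=1$. (iii) The set $\tau(W\setminus\{0\})$ is a minimal nilpotent coadjoint orbit: it is the orbit of a non-zero nilpotent element, it has the smallest dimension among the orbits of non-zero nilpotent elements, and its closure contains no other such orbit. (An element of $\mathfrak{sp}^*(W)$ is nilpotent if it is $x\mapsto\mathrm{tr}(xy)$ for a nilpotent $y\in\mathfrak{sp}(W)$.) There is a non-zero positive $\mathrm{Sp}(W)$-invariant Borel measure $m$ on $\mathfrak{sp}^*(W)$, finite on compact sets and concentrated on this orbit, of which $\mathrm{chc}$ is the Fourier transform: for all $\psi\in\mathcal S(\mathfrak{sp}(W))$, $$\mathrm{chc}(\psi)=\int_{\mathfrak{sp}^*(W)}\Big(\int_{\mathfrak{sp}(W)}\chi(\xi(x))\psi(x)\,dx\Big)\,dm(\xi),$$ with absolute convergence of the outer integral. Finally, let $\Lambda\subseteq\mathbb F^\times$ be a subgroup of finite index, and let $\mathrm{WF}_\Lambda$ be the wave front set with respect to $\Lambda$: for a distribution $u$ on $E$, $\mathrm{WF}_\Lambda(u)$ is the set of $(x,\xi)\in E\times(E^*\setminus0)$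 such that for every $\varphi\in\mathcal S(E)$ with $\varphi(x)\ne0$, every open $\Lambda$-stable subset of $E^*\setminus 0$ containing $\xi$ meets the support of $\eta\mapsto u(\varphi\,\chi(-\eta(\cdot)))$ in an unbounded set. Then $$\mathrm{WF}_\Lambda(\mathrm{chc})=\{(x,t\,\tau(w));\ t\in\Lambda,\ \tau(w)\neq0,\ x(w)=0\}.$$ In particular, if $\Lambda$ consists of squares, then $$\mathrm{WF}_\Lambda(\mathrm{chc})=\{(x,\tau(w));\ \tau(w)\neq0,\ x(w)=0\}.$$ -/

import Mathlib

open MeasureTheory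

namespace ChcDist

noncomputable section

/-! ### Schwartz–Bruhat functions, characters, the module of the field -/

/-- The Schwartz–Bruhat space of `E`: locally constant complex functions with compact support. -/
def SchwartzBruhat (E : Type*) [TopologicalSpace E] : Submodule ℂ (E → ℂ) where
  carrier := {φ | IsLocallyConstant φ ∧ HasCompactSupport φ}
  add_mem' := fun ha hb => ⟨ha.1.add hb.1, ha.2.add hb.2⟩
  zero_mem' := ⟨IsLocallyConstant.const 0, HasCompactSupport.zero⟩
  smul_mem' := fun c _ ha => ⟨ha.1.comp (fun z => c • z), ha.2.smul_left (f := fun _ => c)⟩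

/-- The space of distributions `𝒮*(E)`: all linear functionals on the Schwartz–Bruhat space. -/
abbrev Distribution (E : Type*) [TopologicalSpace E] := SchwartzBruhat E →ₗ[ℂ] ℂ

section Field

variable {F : Type*} [NontriviallyNormedField F]

/-- The ring of integers of a non-archimedean field. -/
def integerRing (F : Type*) [NontriviallyNormedField F] [IsUltrametricDist F] : Subring F where
  carrier := {a | ‖a‖ ≤ 1}
  mul_mem' := fun {a b} ha hb => by
    simp only [Set.mem_ofPred_eq] at *
    rw [norm_mul]
    exact mul_le_one₀ ha (norm_nonneg b) hb
  one_mem' := by simp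
  add_mem' := fun {a b} ha hb => (IsUltrametricDist.norm_add_le_max a b).trans (max_le ha hb)
  zero_mem' := by simp
  neg_mem' := fun {a} ha => by simpa using ha

/-- The module `|a|_F` of an element `a` of a locally compact field: the factor by which
multiplication by `a` multiplies Haar measures, read off on the closed unit ball. -/
def haarModule [ProperSpace F] (a : F) : ℝ :=
  letI : MeasurableSpace F := borel F
  haveI : BorelSpace F := ⟨rfl⟩
  ((Measure.addHaar : Measure F) ((fun b => a * b) '' Metric.closedBall (0 : F) 1)).toReal /
    ((Measure.addHaar : Measure F) (Metric.closedBall (0 : F) 1)).toReal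

variable {E : Type*} [NormedAddCommGroup E] [NormedSpace F E]

/-- The function `x ↦ φ(x) χ(-ξ(x))` is again a Schwartz–Bruhat function. -/
def modulate {χ : AddChar F Circle} (hχ : ∀ a, χ a = 1 ↔ ‖a‖ ≤ 1)
    (φ : SchwartzBruhat E) (ξ : E →L[F] F) : SchwartzBruhat E :=
  ⟨fun x => (φ : E → ℂ) x * ((χ (-(ξ x)) : Circle) : ℂ), by
    refine ⟨φ.2.1.mul ?_, φ.2.2.mul_right⟩
    refine (IsLocallyConstant.iff_eventually_eq _).2 fun x => ?_
    have h1 : ∀ᶠ y in nhds x, ‖ξ x - ξ y‖ < 1 := by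
      have hc : Continuous fun y => ‖ξ x - ξ y‖ := by fun_prop
      exact hc.continuousAt.eventually_lt continuousAt_const (by simp)
    filter_upwards [h1] with y hy
    have h2 : χ (ξ x - ξ y) = 1 := (hχ _).2 hy.le
    have h3 : -(ξ y) = (ξ x - ξ y) + -(ξ x) := by ring
    rw [h3, AddChar.map_add_eq_mul, h2, one_mul]⟩

/-! ### The wave front set -/

/-- The Fourier transform `ξ ↦ (φu)(χ(-ξ(·)))` of the compactly supported distribution `φu`. -/
def fourierLocal {χ : AddChar F Circle} (hχ : ∀ a, χ a = 1 ↔ ‖a‖ ≤ 1)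
    (u : Distribution E) (φ : SchwartzBruhat E) (ξ : E →L[F] F) : ℂ :=
  u (modulate hχ φ ξ)

/-- A cone, relative to a subgroup `Λ` of the multiplicative group of the field. -/
def IsCone (Λ : Subgroup Fˣ) (V : Set E) : Prop :=
  (0 : E) ∉ V ∧ ∀ t ∈ Λ, ∀ v ∈ V, (t : F) • v ∈ V

/-- The asymptotic cone of `A`: the complement, in the set of non-zero vectors, of the union of
the open cones that meet `A` in a bounded set. -/
def asymptoticCone (Λ : Subgroup Fˣ) (A : Set E) : Set E :=
  {v | v ≠ 0 ∧ ∀ V : Set E, IsOpen V → IsCone Λ V → v ∈ V → ¬ Bornology.IsBounded (V ∩ A)}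

/-- The wave front set of `u`, a subset of the cotangent bundle `E × E*` without its zero
section: `ξ` lies in the fibre over `x` when, for every `φ` with `φ(x) ≠ 0`, it lies in the
asymptotic cone of the support of the Fourier transform of `φu`. -/
def waveFrontSet {χ : AddChar F Circle} (hχ : ∀ a, χ a = 1 ↔ ‖a‖ ≤ 1) (Λ : Subgroup Fˣ)
    (u : Distribution E) : Set (E × (E →L[F] F)) :=
  {p | ∀ φ : SchwartzBruhat E, (φ : E → ℂ) p.1 ≠ 0 →
    p.2 ∈ asymptoticCone Λ (closure (Function.support (fourierLocal hχ u φ)))}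

/-! ### The Weil factor of a quadratic form -/

/-- `γ` is the Weil factor of `q` relative to `χ`: it has absolute value one and, up to a positive
constant, it is the Fourier transform at the origin of the character of second degree `χ ∘ q`, in
the sense that `∫ (Φ * (χ ∘ q)) = γ c ∫ Φ` for all Schwartz–Bruhat functions `Φ`. -/
def IsWeilFactor [MeasurableSpace E] (χ : AddChar F Circle) (μ : Measure E)
    (q : QuadraticForm F E) (γ : ℂ) : Prop :=
  ‖γ‖ = 1 ∧ ∃ c : ℝ, 0 < c ∧ ∀ Φ ∈ SchwartzBruhat E,
    ∫ v, (∫ w, Φ (v - w) * ((χ (q w) : Circle) : ℂ) ∂μ) ∂μ = γ * c * ∫ v, Φ v ∂μ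

open Classical in
/-- The Weil factor of a quadratic form; the value for a form without one (a degenerate form)
is `0`. -/
def weilFactor [MeasurableSpace E] (χ : AddChar F Circle) (μ : Measure E)
    (q : QuadraticForm F E) : ℂ :=
  if h : ∃ γ, IsWeilFactor χ μ q γ then h.choose else 0

end Field

/-! ### The symplectic group, its Lie algebra and the coadjoint action -/

section Symplectic

variable {F : Type*} [NontriviallyNormedField F]
  {W : Type*} [NormedAddCommGroup W] [NormedSpace F W]

/-- The symplectic group of the form `B`. -/
def Sp (B : LinearMap.BilinForm F W) : Subgroup (W ≃L[F] W) where
  carrier := {g | ∀ u v, B (g u) (g v) = B u v}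
  mul_mem' := fun {a b} ha hb u v => by
    simp only [Set.mem_ofPred_eq] at ha hb
    exact (ha (b u) (b v)).trans (hb u v)
  one_mem' := fun u v => rfl
  inv_mem' := fun {a} ha u v => by
    simp only [Set.mem_ofPred_eq] at ha
    have h : ∀ w, a (a⁻¹ w) = w := fun w => a.apply_symm_apply w
    rw [← ha, h, h]

/-- The symplectic Lie algebra of the form `B`, as a space of endomorphisms. -/
def sp (B : LinearMap.BilinForm F W) : Submodule F (W →L[F] W) where
  carrier := {x | ∀ u v, B (x u) v + B u (x v) = 0}
  add_mem' := fun {a b} ha hb u v => by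
    simp only [Set.mem_ofPred_eq] at ha hb
    simp only [add_apply, map_add, LinearMap.add_apply]
    linear_combination ha u v + hb u v
  zero_mem' := fun u v => by simp
  smul_mem' := fun c a ha u v => by
    simp only [Set.mem_ofPred_eq] at ha
    simp only [smul_apply, map_smul, LinearMap.smul_apply, smul_eq_mul]
    linear_combination c * ha u v

/-- The bracket `xy - yx` of the symplectic Lie algebra. -/
def spBracket (B : LinearMap.BilinForm F W) (x y : sp B) : sp B :=
  ⟨x.1.comp y.1 - y.1.comp x.1, fun u v => by
    have hx : ∀ u v, B (x.1 u) v + B u (x.1 v) = 0 := x.2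
    have hy : ∀ u v, B (y.1 u) v + B u (y.1 v) = 0 := y.2
    simp only [sub_apply, ContinuousLinearMap.comp_apply, map_sub,
      LinearMap.sub_apply]
    linear_combination hx (y.1 u) v - hy (x.1 u) v + hx u (y.1 v) - hy u (x.1 v)⟩

/-- The adjoint action `x ↦ g x g⁻¹` of the symplectic group on its Lie algebra. -/
def adjoint (B : LinearMap.BilinForm F W) (g : Sp B) : sp B →L[F] sp B where
  toFun x := ⟨((g : W ≃L[F] W) : W →L[F] W).comp
      (x.1.comp (((g⁻¹ : Sp B) : W ≃L[F] W) : W →L[F] W)), fun u v => by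
    have hx : ∀ u v, B (x.1 u) v + B u (x.1 v) = 0 := x.2
    have hg : ∀ u v, B (g.1 u) (g.1 v) = B u v := g.2
    have hi : ∀ w, g.1 (g⁻¹.1 w) = w := fun w => g.1.apply_symm_apply w
    have h := hx (g⁻¹.1 u) (g⁻¹.1 v)
    rw [← hg, ← hg (g⁻¹.1 u), hi, hi] at h
    exact h⟩
  map_add' x y := by ext; simp
  map_smul' c x := by ext; simp
  cont := by
    refine Continuous.subtype_mk ?_ _
    exact continuous_const.clm_comp (continuous_subtype_val.clm_comp continuous_const)

/-- The coadjoint action `(g · ξ)(x) = ξ(g⁻¹ x g)` on the dual of the Lie algebra. -/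
def coadjoint (B : LinearMap.BilinForm F W) (g : Sp B) (ξ : sp B →L[F] F) : sp B →L[F] F :=
  ξ.comp (adjoint B g⁻¹)

/-- The coadjoint orbit of `ξ`. -/
def coadjointOrbit (B : LinearMap.BilinForm F W) (ξ : sp B →L[F] F) : Set (sp B →L[F] F) :=
  Set.range fun g : Sp B => coadjoint B g ξ

/-- An element of the dual is nilpotent when it is `x ↦ tr(x y)` for a nilpotent `y` in the
Lie algebra. -/
def IsNilpotentFunctional (B : LinearMap.BilinForm F W) (ξ : sp B →L[F] F) : Prop :=
  ∃ y : sp B, IsNilpotent y.1 ∧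
    ∀ x : sp B, ξ x = LinearMap.trace F W ((x.1.comp y.1 : W →L[F] W) : W →ₗ[F] W)

/-- The Lie algebra of the stabilizer of `ξ`. -/
def stabilizerAlgebra (B : LinearMap.BilinForm F W) (ξ : sp B →L[F] F) :
    Submodule F (sp B) where
  carrier := {x | ∀ y, ξ (spBracket B x y) = 0}
  add_mem' := fun {a b} ha hb y => by
    have h : spBracket B (a + b) y = spBracket B a y + spBracket B b y := by
      ext; simp [spBracket]; abel
    rw [h, map_add, ha y, hb y, add_zero]
  zero_mem' := fun y => by
    have h : spBracket B 0 y = 0 := by ext; simp [spBracket]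
    rw [h, map_zero]
  smul_mem' := fun c a ha y => by
    have h : spBracket B (c • a) y = c • spBracket B a y := by
      ext; simp [spBracket, smul_sub]
    rw [h, map_smul, ha y, smul_zero]

/-- The dimension of the coadjoint orbit of `ξ`. -/
def orbitDim (B : LinearMap.BilinForm F W) (ξ : sp B →L[F] F) : ℕ :=
  Module.finrank F (sp B) - Module.finrank F (stabilizerAlgebra B ξ)

/-- `O` is a minimal nilpotent coadjoint orbit: the orbit of a non-zero nilpotent element, of the
smallest dimension among such orbits, whose closure contains no other such orbit. -/
def IsMinimalNilpotentOrbit (B : LinearMap.BilinForm F W) (O : Set (sp B →L[F] F)) : Prop :=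
  ∃ ξ : sp B →L[F] F, ξ ≠ 0 ∧ IsNilpotentFunctional B ξ ∧ O = coadjointOrbit B ξ ∧
    ∀ η : sp B →L[F] F, η ≠ 0 → IsNilpotentFunctional B η →
      orbitDim B ξ ≤ orbitDim B η ∧
      (coadjointOrbit B η ⊆ closure O → coadjointOrbit B η = O)

/-- The quadratic form `w ↦ ⟨xw, w⟩` on `W`. -/
def spQuadraticForm (B : LinearMap.BilinForm F W) (x : sp B) : QuadraticForm F W :=
  (B.compLeft (x.1 : W →ₗ[F] W)).toQuadraticMap

theorem spQuadraticForm_apply (B : LinearMap.BilinForm F W) (x : sp B) (w : W) :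
    spQuadraticForm B x w = B (x.1 w) w := rfl

variable [CompleteSpace F] [FiniteDimensional F W]

/-- The unnormalized moment map `τ(w)(x) = ⟨xw, w⟩`. -/
def moment (B : LinearMap.BilinForm F W) (w : W) : sp B →L[F] F :=
  ((LinearMap.toContinuousLinearMap (B.flip w)).comp
    (ContinuousLinearMap.apply F W w)).comp (sp B).subtypeL

theorem moment_apply (B : LinearMap.BilinForm F W) (w : W) (x : sp B) :
    moment B w x = B (x.1 w) w := rfl

end Symplectic

end

end ChcDist

open ChcDist

open ChcDist

/-!
The proof rests on two elementary facts about a lattice `M` (a compact open subgroup). The integral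
over `M` of the character `χ` composed with an additive map is the volume of `M` or zero, according
to whether the map is integral on `M`; and a function that is multiplied by a constant `c ≠ 1` under
some translation has integral zero. The first makes Fourier transforms of Schwartz-Bruhat functions
compactly supported. As the moment map `τ` is proper, `chc` is therefore an absolutely convergent
iterated integral, the integral over `W` of the Fourier transform along `τ`.

**The function representing `chc`.** For a quadratic function `Q` with non-degenerate polar form,
the integrals of `χ ∘ Q` over large lattices stabilize (`exists_gauss`). Squaring the absolute value
of such an integral gives the volume of the lattice times the volume of its polar, up to the values
of `Q` on the polar (`normSq_setIntegral`); for `Q w = ⟨x w, w⟩` and multiples of the self-dual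
lattice this is `detWeight x ^ 2`, as an upper bound always and as an equality in the limit. Hence
the stable value is the Weil factor times `detWeight x`, and the formula for `chc` follows by
dominated convergence (`chc_eq_integral`) once `|det x| ^ (-1/2)` is known to be locally integrable.
The latter is proved by induction over symmetric matrices, with a Schur complement; the bound has to
be uniform over translates for the induction to close (`exists_lintegral_det_le`). The eighth power
of the Weil factor is one because `-1` is a sum of four squares in the field: multiplication by a
quaternion of norm `-1` turns four copies of `Q` into four copies of `-Q`, so the fourth power of
the Weil factor is real (`conj_gauss_pow_four`).

**The orbit.** Transvections act transitively on the non-zero vectors, so `τ (W ∖ {0})` is one orbit,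
of dimension at most `dim W`. If `η = tr (· y)` with `y ≠ 0` nilpotent, choose `u` with `y u ≠ 0`;
then `u` and `y u` are independent, and the elements `w ↦ ⟨w, u⟩ v + ⟨w, v⟩ u`, for `v ∈ W`, form a
complement of dimension `dim W` to part of the stabilizer (`finrank_le_orbitDim`). The image of `τ`
is closed, since `τ` is proper, so the closure of the orbit only adds the origin. The invariant
measure is the image under `τ` of the Haar measure of `W`.

**The wave front set.** The localized Fourier transform of `chc` at `ξ` is the integral over `w` of
the Fourier transform of `φ` at `τ w - ξ`.
* Outside the closed cone `Λ τ(W)` it vanishes for large `ξ`, because `τ w - ξ` leaves every compact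
  set (`notMem_waveFrontSet_of_notMem_coneOver`).
* If `x w ≠ 0`, the phase has no stationary point near the covector: translating `w` by a lattice of
  size comparable to `1 / ‖w‖` moves `τ w` by a bounded amount, and multiplies the integrand by a
  non-trivial character (`notMem_waveFrontSet_of_cosandwich_ne_zero`). The condition `x w ≠ 0` is
  read off from `ξ = t τ w` through the linear map `cosandwich x`, which sends `τ w` to `τ (x w)`.
* If `x w = 0`, consider the indicator function of a small coset of `x`. Since
  `τ w - τ v` factors as the polarization of `τ` at `(w - v, w + v)`, the vectors contributing to the
  Fourier transform at `τ v`, for `v` a large multiple of `w`, are close to `± v`, where the phase is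
  trivial; so the transform does not vanish (`fourierLocal_cosetIndicator_moment_ne_zero`). A general
  `φ` is reduced to this case by averaging its Fourier transform over a lattice in the dual space,
  which localizes `φ` to a small coset (`fourierLocal_cosetIndicator_eq_zero`).
-/

set_option linter.unusedSectionVars false

namespace ChcDist


/-! ### The module of the field and Haar measures -/

section HaarModule

open Matrix Measure

variable {F : Type*} [NontriviallyNormedField F] [ProperSpace F]

theorem haarModule_zero : haarModule (0 : F) = 0 := by
  let _ : MeasurableSpace F := borel F
  have : BorelSpace F := ⟨rfl⟩
  have h : (fun b : F => (0 : F) * b) '' Metric.closedBall (0 : F) 1 ⊆ {0} := by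
    rintro _ ⟨b, -, rfl⟩
    simp
  have h0 : (addHaar : Measure F) ((fun b : F => (0 : F) * b) '' Metric.closedBall (0 : F) 1) = 0 :=
    measure_mono_null h (measure_singleton 0)
  simp only [haarModule, h0]
  simp

/-- Multiplication by `a` scales every Haar measure, not only the one used in the definition of the
module. -/
theorem map_mul_left_addHaar [MeasurableSpace F] [BorelSpace F] (μ : Measure F)
    [μ.IsAddHaarMeasure] {a : F} (ha : a ≠ 0) :
    ENNReal.ofReal (haarModule a) • μ.map (fun b => a * b) = μ := by
  have hm : ‹MeasurableSpace F› = borel F := BorelSpace.measurable_eq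
  let φ : F ≃ₜ+ F :=
    { Equiv.mulLeft₀ a ha with
      map_add' := mul_add a
      continuous_toFun := continuous_const_mul a
      continuous_invFun := continuous_const_mul a⁻¹ }
  have hφ : ∀ s, φ '' s = (fun b => a * b) '' s := fun s => rfl
  have h1 : haarModule a = addEquivAddHaarChar φ := by
    subst hm
    let _ : MeasurableSpace F := borel F
    have h := addEquivAddHaarChar_smul_preimage (addHaar : Measure F)
      (X := φ '' Metric.closedBall (0 : F) 1) φ
    rw [Set.preimage_image_eq _ φ.injective, hφ] at h
    have hc : (addHaar : Measure F) (Metric.closedBall 0 1) ≠ ⊤ :=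
      (isCompact_closedBall 0 1).measure_lt_top.ne
    have hp : (addHaar : Measure F) (Metric.closedBall 0 1) ≠ 0 :=
      (Metric.measure_closedBall_pos _ 0 one_pos).ne'
    simp only [haarModule]
    rw [← h, ENNReal.smul_def, smul_eq_mul, ENNReal.toReal_mul, mul_div_assoc,
      div_self (ENNReal.toReal_ne_zero.2 ⟨hp, hc⟩), mul_one]
    rfl
  rw [h1, ENNReal.ofReal_coe_nnreal]
  exact addEquivAddHaarChar_smul_map μ φ

theorem haarModule_pos {a : F} (ha : a ≠ 0) : 0 < haarModule a := by
  let _ : MeasurableSpace F := borel F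
  have : BorelSpace F := ⟨rfl⟩
  by_contra h
  have h1 := map_mul_left_addHaar (addHaar : Measure F) ha
  rw [ENNReal.ofReal_of_nonpos (not_lt.1 h), zero_smul] at h1
  have h2 := Metric.measure_closedBall_pos (addHaar : Measure F) 0 one_pos
  rw [← h1] at h2
  simp at h2

/-- The composition of two multiplications scales Haar measures by the product of the modules;
evaluating on the unit ball isolates the scalar. -/
theorem haarModule_mul (a b : F) : haarModule (a * b) = haarModule a * haarModule b := by
  rcases eq_or_ne a 0 with rfl | ha
  · simp [haarModule_zero]
  rcases eq_or_ne b 0 with rfl | hb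
  · simp [haarModule_zero]
  let _ : MeasurableSpace F := borel F
  have : BorelSpace F := ⟨rfl⟩
  set μ := (addHaar : Measure F)
  have hab := map_mul_left_addHaar μ (mul_ne_zero ha hb)
  have hA := map_mul_left_addHaar μ ha
  have hB := map_mul_left_addHaar μ hb
  have key : ENNReal.ofReal (haarModule a * haarModule b) • μ.map (fun x => a * b * x) = μ := by
    have : (fun x => a * b * x) = (fun x => a * x) ∘ (fun x => b * x) := by
      ext x; simp [mul_assoc]
    rw [this, ← Measure.map_map (by fun_prop) (by fun_prop),
      ENNReal.ofReal_mul (haarModule_pos ha).le, mul_smul, ← Measure.map_smul, hB, hA]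
  set m := μ.map (fun x => a * b * x) (Metric.closedBall 0 1) with hm
  have h1 : ENNReal.ofReal (haarModule (a * b)) * m = μ (Metric.closedBall 0 1) := by
    conv_rhs => rw [← hab]
    simp [hm]
  have h2 : ENNReal.ofReal (haarModule a * haarModule b) * m = μ (Metric.closedBall 0 1) := by
    conv_rhs => rw [← key]
    simp [hm]
  have hct : μ (Metric.closedBall 0 1) ≠ ⊤ := (isCompact_closedBall 0 1).measure_lt_top.ne
  have hcp : μ (Metric.closedBall 0 1) ≠ 0 := (Metric.measure_closedBall_pos _ 0 one_pos).ne'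
  have hm0 : m ≠ 0 := by
    rintro h0
    rw [h0, mul_zero] at h1
    exact hcp h1.symm
  have hmt : m ≠ ⊤ := by
    rintro h0
    rw [h0, ENNReal.mul_top (by simpa using haarModule_pos (mul_ne_zero ha hb))] at h1
    exact hct h1.symm
  have h3 := (ENNReal.mul_left_inj hm0 hmt).1 (h1.trans h2.symm)
  exact (ENNReal.ofReal_eq_ofReal_iff (haarModule_pos (mul_ne_zero ha hb)).le
    (mul_pos (haarModule_pos ha) (haarModule_pos hb)).le).1 h3

theorem haarModule_one : haarModule (1 : F) = 1 := by
  have h := haarModule_mul (1 : F) 1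
  rw [mul_one] at h
  have h0 := haarModule_pos (one_ne_zero (α := F))
  exact (mul_eq_left₀ h0.ne').1 h.symm

/-- The module as a multiplicative homomorphism. -/
noncomputable def haarModuleHom (F : Type*) [NontriviallyNormedField F] [ProperSpace F] :
    F →*₀ ℝ where
  toFun := haarModule
  map_zero' := haarModule_zero
  map_one' := haarModule_one
  map_mul' := haarModule_mul

theorem haarModule_pow (a : F) (n : ℕ) : haarModule (a ^ n) = haarModule a ^ n :=
  map_pow (haarModuleHom F) a n

theorem haarModule_inv (a : F) : haarModule a⁻¹ = (haarModule a)⁻¹ :=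
  map_inv₀ (haarModuleHom F) a

theorem haarModule_nonneg (a : F) : 0 ≤ haarModule a := by
  rcases eq_or_ne a 0 with rfl | ha
  · exact haarModule_zero.ge
  · exact (haarModule_pos ha).le

section Pi

variable {ι : Type*} [Fintype ι] [DecidableEq ι] [MeasurableSpace F] [BorelSpace F]

theorem map_diagonal_pi_addHaar {D : ι → F} (h : det (diagonal D) ≠ 0) :
    ENNReal.ofReal (haarModule (det (diagonal D))) •
      (Measure.pi fun _ : ι => (addHaar : Measure F)).map (toLin' (diagonal D)) =
        Measure.pi fun _ : ι => (addHaar : Measure F) := by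
  refine (Measure.pi_eq fun s hs => ?_).symm
  simp only [det_diagonal, Measure.coe_smul, smul_eq_mul, Pi.smul_apply]
  rw [Measure.map_apply _ (MeasurableSet.univ_pi hs)]
  swap; · exact Continuous.measurable (LinearMap.continuous_on_pi _)
  have h1 : (Matrix.toLin' (diagonal D) ⁻¹' Set.pi Set.univ fun i : ι => s i) =
      Set.pi Set.univ fun i : ι => (D i * ·) ⁻¹' s i := by
    ext f
    simp only [LinearMap.coe_proj, smul_eq_mul, LinearMap.smul_apply, Set.mem_univ_pi,
      Set.mem_preimage, LinearMap.pi_apply, diagonal_toLin']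
  have h2 : ∀ i, ENNReal.ofReal (haarModule (D i)) *
      (addHaar : Measure F) ((D i * ·) ⁻¹' s i) = (addHaar : Measure F) (s i) := by
    intro i
    have hi : D i ≠ 0 := by
      simp only [det_diagonal, Ne] at h
      exact Finset.prod_ne_zero_iff.1 h i (Finset.mem_univ i)
    conv_rhs => rw [← map_mul_left_addHaar (addHaar : Measure F) hi]
    rw [Measure.smul_apply, Measure.map_apply (by fun_prop) (hs i), smul_eq_mul]
  have h3 : haarModule (∏ i, D i) = ∏ i, haarModule (D i) := map_prod (haarModuleHom F) D _
  rw [h1, Measure.pi_pi, h3, ENNReal.ofReal_prod_of_nonneg fun i _ => haarModule_nonneg (D i),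
    ← Finset.prod_mul_distrib]
  simp only [h2]

/-- A transvection is, in one coordinate, a translation depending on the others. -/
theorem map_transvection_pi_addHaar (t : TransvectionStruct ι F) :
    (Measure.pi fun _ : ι => (addHaar : Measure F)).map (toLin' t.toMatrix) =
      Measure.pi fun _ : ι => (addHaar : Measure F) := by
  have ht : Measurable (toLin' t.toMatrix) :=
    (toLin' t.toMatrix).continuous_of_finiteDimensional.measurable
  refine (Measure.pi_eq fun s hs => ?_).symm
  have h2s : MeasurableSet (Set.univ.pi s) := .pi Set.countable_univ fun i _ => hs i
  simp_rw [← Measure.pi_pi, ← lintegral_indicator_one h2s]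
  rw [lintegral_map (measurable_one.indicator h2s) ht]
  refine lintegral_eq_of_lmarginal_eq {t.i} ((measurable_one.indicator h2s).comp ht)
    (measurable_one.indicator h2s) ?_
  simp_rw [lmarginal_singleton]
  ext x
  cases t with | mk t_i t_j t_hij t_c =>
  simp [transvection, single_mulVec, t_hij.symm, ← Function.update_add,
    lintegral_add_right_eq_self fun y => Set.indicator (Set.univ.pi s) 1 (Function.update x t_i y)]

theorem map_matrix_pi_addHaar {M : Matrix ι ι F} (hM : det M ≠ 0) :
    ENNReal.ofReal (haarModule (det M)) •
      (Measure.pi fun _ : ι => (addHaar : Measure F)).map (toLin' M) =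
        Measure.pi fun _ : ι => (addHaar : Measure F) := by
  apply diagonal_transvection_induction_of_det_ne_zero _ M hM
  · intro D hD
    exact map_diagonal_pi_addHaar hD
  · intro t
    rw [TransvectionStruct.det, haarModule_one, ENNReal.ofReal_one, one_smul,
      map_transvection_pi_addHaar]
  · intro A B _ _ hA hB
    rw [toLin'_mul, det_mul, LinearMap.coe_comp, ← Measure.map_map, haarModule_mul,
      ENNReal.ofReal_mul (haarModule_nonneg _), mul_smul, ← Measure.map_smul, hB, hA]
    · exact (LinearMap.continuous_on_pi _).measurable
    · exact (LinearMap.continuous_on_pi _).measurable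

end Pi

variable {E : Type*} [NormedAddCommGroup E] [NormedSpace F E] [FiniteDimensional F E]
  [MeasurableSpace E] [BorelSpace E]

/-- A linear automorphism scales Haar measures by the module of its determinant. -/
theorem map_linearMap_addHaar (μ : Measure E) [μ.IsAddHaarMeasure] {T : E →ₗ[F] E}
    (hT : LinearMap.det T ≠ 0) :
    ENNReal.ofReal (haarModule (LinearMap.det T)) • μ.map T = μ := by
  let _ : MeasurableSpace F := borel F
  have : BorelSpace F := ⟨rfl⟩
  have : ProperSpace E := FiniteDimensional.proper F E
  let b := Module.finBasis F E
  let e : E ≃L[F] (Fin (Module.finrank F E) → F) := b.equivFun.toContinuousLinearEquiv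
  set π : Measure (Fin (Module.finrank F E) → F) :=
    Measure.pi fun _ => (addHaar : Measure F) with hπ
  have hme : Measurable e := e.continuous.measurable
  have hme' : Measurable e.symm := e.symm.continuous.measurable
  have : (π.map e.symm).IsAddHaarMeasure := e.symm.isAddHaarMeasure_map π
  have h1 : μ = addHaarScalarFactor μ (π.map e.symm) • π.map e.symm :=
    isAddLeftInvariant_eq_smul μ _
  set A := LinearMap.toMatrix b b T with hA
  have hdet : det A = LinearMap.det T := LinearMap.det_toMatrix b T
  have h2 := map_matrix_pi_addHaar (M := A) (hdet ▸ hT)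
  have hTm : Measurable T := T.continuous_of_finiteDimensional.measurable
  have hAm : Measurable (toLin' A) := (LinearMap.continuous_on_pi _).measurable
  have hcomp : T ∘ e.symm = e.symm ∘ toLin' A := by
    ext x
    have h3 := LinearMap.toMatrix_mulVec_repr b b T (e.symm x)
    have h4 : ⇑(b.repr (e.symm x)) = x := e.apply_symm_apply x
    rw [h4] at h3
    have h5 : e (T (e.symm x)) = toLin' A x := by
      rw [toLin'_apply, ← hA] at *
      exact h3.symm
    simp only [Function.comp_apply]
    rw [← h5, e.symm_apply_apply]
  have h3 : ENNReal.ofReal (haarModule (LinearMap.det T)) • (π.map e.symm).map T =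
      π.map e.symm := by
    rw [Measure.map_map hTm hme', hcomp, ← Measure.map_map hme' hAm, ← Measure.map_smul, ← hdet,
      h2]
  rw [h1, Measure.map_smul, smul_comm, h3]

theorem measure_preimage_linearMap (μ : Measure E) [μ.IsAddHaarMeasure] {T : E →ₗ[F] E}
    (hT : LinearMap.det T ≠ 0) {s : Set E} (hs : MeasurableSet s) :
    ENNReal.ofReal (haarModule (LinearMap.det T)) * μ (T ⁻¹' s) = μ s := by
  conv_rhs => rw [← map_linearMap_addHaar μ hT]
  rw [Measure.smul_apply, Measure.map_apply T.continuous_of_finiteDimensional.measurable hs,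
    smul_eq_mul]

end HaarModule


/-! ### Compact open subgroups and uniform local constancy -/

section Lattice

open Topology Measure

/-- A lattice, in the weak sense of a compact open additive subgroup. -/
structure IsLattice {E : Type*} [AddGroup E] [TopologicalSpace E] (M : AddSubgroup E) : Prop where
  isOpen : IsOpen (M : Set E)
  isCompact : IsCompact (M : Set E)

namespace IsLattice

variable {E : Type*} [NormedAddCommGroup E] {M : AddSubgroup E}

theorem mem_nhds (hM : IsLattice M) : (M : Set E) ∈ 𝓝 (0 : E) :=
  hM.isOpen.mem_nhds M.zero_mem

theorem isClosed (hM : IsLattice M) : IsClosed (M : Set E) := hM.isCompact.isClosed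

theorem isBounded (hM : IsLattice M) : Bornology.IsBounded (M : Set E) := hM.isCompact.isBounded

theorem pi {ι : Type*} [Finite ι] {M : ι → AddSubgroup E} (hM : ∀ i, IsLattice (M i)) :
    IsLattice (AddSubgroup.pi Set.univ M) :=
  ⟨isOpen_set_pi Set.finite_univ fun i _ => (hM i).isOpen,
    isCompact_univ_pi fun i => (hM i).isCompact⟩

theorem comap {E' : Type*} [NormedAddCommGroup E'] (hM : IsLattice M) (e : E' ≃ₜ+ E) :
    IsLattice (M.comap (e : E' →+ E)) :=
  ⟨hM.isOpen.preimage e.continuous, by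
    have h : ((M.comap (e : E' →+ E) : AddSubgroup E') : Set E') = e.symm '' (M : Set E) := by
      ext x
      constructor
      · intro hx
        exact ⟨e x, hx, e.symm_apply_apply x⟩
      · rintro ⟨y, hy, rfl⟩
        change e (e.symm y) ∈ M
        rwa [e.apply_symm_apply]
    rw [h]
    exact hM.isCompact.image e.symm.continuous⟩

variable [MeasurableSpace E] (μ : Measure E) [μ.IsAddHaarMeasure]

theorem measurableSet [BorelSpace E] (hM : IsLattice M) : MeasurableSet (M : Set E) :=
  hM.isOpen.measurableSet

theorem measure_ne_zero (hM : IsLattice M) : μ (M : Set E) ≠ 0 :=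
  hM.isOpen.measure_ne_zero μ ⟨0, M.zero_mem⟩

theorem measure_ne_top (hM : IsLattice M) : μ (M : Set E) ≠ ⊤ := hM.isCompact.measure_lt_top.ne

theorem measureReal_pos (hM : IsLattice M) : 0 < μ.real (M : Set E) :=
  ENNReal.toReal_pos (hM.measure_ne_zero μ) (hM.measure_ne_top μ)

end IsLattice

theorem isLattice_pi_ball {F : Type*} [NontriviallyNormedField F] [IsUltrametricDist F]
    [ProperSpace F] {ι : Type*} [Fintype ι] {r : ℝ} (hr : 0 < r) :
    ∃ M : AddSubgroup (ι → F), IsLattice M ∧ (M : Set (ι → F)) = Metric.closedBall 0 r := by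
  let M : AddSubgroup (ι → F) :=
    { carrier := Metric.closedBall 0 r
      zero_mem' := by simp [hr.le]
      add_mem' := by
        intro a b ha hb
        rw [mem_closedBall_zero_iff, pi_norm_le_iff_of_nonneg hr.le] at *
        exact fun i => (IsUltrametricDist.norm_add_le_max _ _).trans (max_le (ha i) (hb i))
      neg_mem' := by
        intro a ha
        rw [mem_closedBall_zero_iff] at *
        rwa [norm_neg] }
  refine ⟨M, ⟨?_, isCompact_closedBall 0 r⟩, rfl⟩
  exact AddSubgroup.isOpen_of_mem_nhds M (g := 0) (Metric.closedBall_mem_nhds 0 hr)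

/-- Lattices form a basis of neighbourhoods of the origin. -/
theorem exists_isLattice_subset (F : Type*) [NontriviallyNormedField F] [IsUltrametricDist F]
    [ProperSpace F] {E : Type*} [NormedAddCommGroup E] [NormedSpace F E] [FiniteDimensional F E]
    {U : Set E} (hU : U ∈ 𝓝 (0 : E)) :
    ∃ M : AddSubgroup E, IsLattice M ∧ (M : Set E) ⊆ U := by
  let e : E ≃L[F] (Fin (Module.finrank F E) → F) :=
    (Module.finBasis F E).equivFun.toContinuousLinearEquiv
  have h1 : e.symm ⁻¹' U ∈ 𝓝 (0 : Fin (Module.finrank F E) → F) := by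
    apply e.symm.continuous.continuousAt.preimage_mem_nhds
    simpa using hU
  obtain ⟨r, hr, hrU⟩ := Metric.nhds_basis_closedBall.mem_iff.1 h1
  obtain ⟨M, hM, hMr⟩ := isLattice_pi_ball (F := F) (ι := Fin (Module.finrank F E)) hr
  refine ⟨_, hM.comap e.toContinuousAddEquiv, fun x hx => ?_⟩
  have h2 : e x ∈ Metric.closedBall (0 : Fin (Module.finrank F E) → F) r := by
    rw [← hMr]; exact hx
  have h3 := hrU h2
  simpa using h3

/-- Every bounded set is contained in a lattice. -/
theorem exists_isLattice_superset (F : Type*) [NontriviallyNormedField F] [IsUltrametricDist F]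
    [ProperSpace F] {E : Type*} [NormedAddCommGroup E] [NormedSpace F E] [FiniteDimensional F E]
    {S : Set E} (hS : Bornology.IsBounded S) :
    ∃ M : AddSubgroup E, IsLattice M ∧ S ⊆ M := by
  let e : E ≃L[F] (Fin (Module.finrank F E) → F) :=
    (Module.finBasis F E).equivFun.toContinuousLinearEquiv
  have h1 : Bornology.IsBounded (e '' S) := e.lipschitz.isBounded_image hS
  obtain ⟨r, hr, hrU⟩ := h1.subset_closedBall_lt 0 0
  obtain ⟨M, hM, hMr⟩ := isLattice_pi_ball (F := F) (ι := Fin (Module.finrank F E)) hr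
  refine ⟨_, hM.comap e.toContinuousAddEquiv, fun x hx => ?_⟩
  have h2 : e x ∈ (M : Set _) := hMr ▸ hrU ⟨x, hx, rfl⟩
  exact h2

/-- A locally constant function with compact support is invariant under some lattice. -/
theorem exists_isLattice_invariant (F : Type*) [NontriviallyNormedField F] [IsUltrametricDist F]
    [ProperSpace F] {E : Type*} [NormedAddCommGroup E] [NormedSpace F E] [FiniteDimensional F E]
    {ψ : E → ℂ} (hψ : ψ ∈ SchwartzBruhat E) :
    ∃ M : AddSubgroup E, IsLattice M ∧ ∀ x, ∀ h ∈ M, ψ (x + h) = ψ x := by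
  obtain ⟨hc, hs⟩ := hψ
  have h1 : ∃ U ∈ 𝓝 (0 : E), ∀ x ∈ tsupport ψ, ∀ h ∈ U, ψ (x + h) = ψ x := by
    refine hs.isCompact.induction_on (p := fun S => ∃ U ∈ 𝓝 (0 : E), ∀ x ∈ S, ∀ h ∈ U,
      ψ (x + h) = ψ x) ⟨Set.univ, Filter.univ_mem, by simp⟩ ?_ ?_ ?_
    · rintro s t hst ⟨U, hU, h⟩
      exact ⟨U, hU, fun x hx => h x (hst hx)⟩
    · rintro s t ⟨U, hU, h⟩ ⟨U', hU', h'⟩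
      refine ⟨U ∩ U', Filter.inter_mem hU hU', ?_⟩
      rintro x (hx | hx) k ⟨hk, hk'⟩
      · exact h x hx k hk
      · exact h' x hx k hk'
    · intro x _
      have hx : {h : E | ψ (x + h) = ψ x} ∈ 𝓝 (0 : E) := by
        have h2 := (IsLocallyConstant.iff_eventually_eq ψ).1 hc x
        have h3 : Filter.Tendsto (fun h : E => x + h) (𝓝 0) (𝓝 x) := by
          have : Continuous fun h : E => x + h := by fun_prop
          simpa using this.tendsto 0
        exact h3 h2
      obtain ⟨M, hM, hMU⟩ := exists_isLattice_subset F hx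
      refine ⟨(fun y => y - x) ⁻¹' (M : Set E), mem_nhdsWithin_of_mem_nhds ?_, M, hM.mem_nhds, ?_⟩
      · have : Continuous fun y : E => y - x := by fun_prop
        apply this.continuousAt.preimage_mem_nhds
        simpa using hM.mem_nhds
      · intro y hy h hh
        have h4 : ψ (x + (y - x)) = ψ x := hMU hy
        have h5 : ψ (x + (y - x + h)) = ψ x := hMU (M.add_mem hy hh)
        rw [add_sub_cancel] at h4
        rw [← add_assoc, add_sub_cancel] at h5
        rw [h4, h5]
  obtain ⟨U, hU, h⟩ := h1
  obtain ⟨M, hM, hMU⟩ := exists_isLattice_subset F hU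
  refine ⟨M, hM, fun x k hk => ?_⟩
  by_cases hx : x ∈ tsupport ψ
  · exact h x hx k (hMU hk)
  by_cases hxk : x + k ∈ tsupport ψ
  · have h2 := h (x + k) hxk (-k) (hMU (M.neg_mem hk))
    rw [add_neg_cancel_right] at h2
    exact h2.symm
  · rw [image_eq_zero_of_notMem_tsupport hx, image_eq_zero_of_notMem_tsupport hxk]

theorem SchwartzBruhat.continuous {E : Type*} [TopologicalSpace E] {ψ : E → ℂ}
    (hψ : ψ ∈ SchwartzBruhat E) : Continuous ψ :=
  hψ.1.continuous

theorem SchwartzBruhat.integrable {E : Type*} [TopologicalSpace E] [MeasurableSpace E]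
    [BorelSpace E] {μ : Measure E}
    [IsFiniteMeasureOnCompacts μ] {ψ : E → ℂ} (hψ : ψ ∈ SchwartzBruhat E) :
    Integrable ψ μ :=
  (SchwartzBruhat.continuous hψ).integrable_of_hasCompactSupport hψ.2

theorem IsLattice.indicator_translate_mem {E : Type*} [NormedAddCommGroup E] {M : AddSubgroup E}
    (hM : IsLattice M) (x₀ : E) (c : ℂ) :
    (fun x => Set.indicator (M : Set E) (fun _ => c) (x - x₀)) ∈ SchwartzBruhat E := by
  constructor
  · have h : IsLocallyConstant (Set.indicator (M : Set E) fun _ => c) := by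
      refine (IsLocallyConstant.iff_eventually_eq _).2 fun x => ?_
      by_cases hx : x ∈ (M : Set E)
      · filter_upwards [hM.isOpen.mem_nhds hx] with y hy
        rw [Set.indicator_of_mem hy, Set.indicator_of_mem hx]
      · filter_upwards [hM.isClosed.isOpen_compl.mem_nhds hx] with y hy
        rw [Set.indicator_of_notMem hy, Set.indicator_of_notMem hx]
    exact h.comp_continuous (by fun_prop : Continuous fun x : E => x - x₀)
  · refine HasCompactSupport.intro
      (hM.isCompact.image (by fun_prop : Continuous fun x => x + x₀)) ?_
    intro x hx
    refine Set.indicator_of_notMem (fun h => hx ⟨x - x₀, h, by simp⟩) _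

theorem IsLattice.indicator_mem {E : Type*} [NormedAddCommGroup E] {M : AddSubgroup E}
    (hM : IsLattice M) (c : ℂ) :
    (Set.indicator (M : Set E) fun _ => c) ∈ SchwartzBruhat E := by
  simpa using hM.indicator_translate_mem 0 c

variable {F : Type*} [NontriviallyNormedField F]
  {E : Type*} [NormedAddCommGroup E] [NormedSpace F E]

/-- A continuous functional that is integral on a fixed lattice has bounded norm. -/
theorem IsLattice.exists_bound {M : AddSubgroup E} (hM : IsLattice M) :
    ∃ C : ℝ, 0 < C ∧ ∀ ξ : E →L[F] F, (∀ h ∈ M, ‖ξ h‖ ≤ 1) → ‖ξ‖ ≤ C := by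
  obtain ⟨ε, hε, hεM⟩ := Metric.mem_nhds_iff.1 hM.mem_nhds
  obtain ⟨c, hc⟩ := NormedField.exists_one_lt_norm F
  have hc0 : 0 < ‖c‖ := one_pos.trans hc
  refine ⟨‖c‖ / ε, div_pos hc0 hε, fun ξ hξ => ?_⟩
  refine ContinuousLinearMap.opNorm_le_of_shell hε (div_pos hc0 hε).le hc fun x h1 h2 => ?_
  calc ‖ξ x‖ ≤ 1 := hξ x (hεM (by simpa using h2))
    _ = ‖c‖ / ε * (ε / ‖c‖) := by field_simp
    _ ≤ ‖c‖ / ε * ‖x‖ := by gcongr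

theorem IsLattice.exists_bound_of_injective [ProperSpace F] [FiniteDimensional F E]
    {E' : Type*} [NormedAddCommGroup E'] [NormedSpace F E']
    [FiniteDimensional F E'] {M : AddSubgroup E} (hM : IsLattice M)
    {β : E' →ₗ[F] (E →L[F] F)} (hβ : Function.Injective β) :
    ∃ C : ℝ, 0 < C ∧ ∀ v : E', (∀ h ∈ M, ‖β v h‖ ≤ 1) → ‖v‖ ≤ C := by
  obtain ⟨C, hC, h⟩ := hM.exists_bound (F := F)
  obtain ⟨K, hK, hK'⟩ := LinearMap.exists_antilipschitzWith β (LinearMap.ker_eq_bot.2 hβ)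
  refine ⟨K * C, mul_pos (by exact_mod_cast hK) hC, fun v hv => ?_⟩
  have h1 := hK'.le_mul_dist v 0
  rw [map_zero, dist_zero_right, dist_zero_right] at h1
  exact h1.trans (by gcongr; exact h _ hv)

end Lattice

/-! ### Integrals of characters and the Fourier transform -/

section Characters

open Topology Measure

variable {E : Type*} [NormedAddCommGroup E] [MeasurableSpace E] [BorelSpace E]

/-- A function that is multiplied by a constant other than one under some translation
has integral zero. -/
theorem integral_eq_zero_of_translate {μ : Measure E} [μ.IsAddHaarMeasure] {f : E → ℂ} {h : E}
    {c : ℂ} (hc : c ≠ 1) (hf : ∀ x, f (x + h) = c * f x) : ∫ x, f x ∂μ = 0 := by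
  have h1 : ∫ x, f (x + h) ∂μ = ∫ x, f x ∂μ := integral_add_right_eq_self f h
  simp_rw [hf, integral_const_mul] at h1
  have h2 : (c - 1) * ∫ x, f x ∂μ = 0 := by rw [sub_mul, h1]; ring
  exact (mul_eq_zero.1 h2).resolve_left (sub_ne_zero.2 hc)

theorem setIntegral_eq_zero_of_translate {μ : Measure E} [μ.IsAddHaarMeasure] {M : AddSubgroup E}
    (hM : IsLattice M) {f : E → ℂ} {h : E} (hh : h ∈ M)
    {c : ℂ} (hc : c ≠ 1) (hf : ∀ x ∈ M, f (x + h) = c * f x) : ∫ x in (M : Set E), f x ∂μ = 0 := by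
  rw [← integral_indicator hM.measurableSet]
  refine integral_eq_zero_of_translate hc (h := h) fun x => ?_
  by_cases hx : x ∈ M
  · rw [Set.indicator_of_mem (show x ∈ (M : Set E) from hx),
      Set.indicator_of_mem (show x + h ∈ (M : Set E) from M.add_mem hx hh), hf x hx]
  · rw [Set.indicator_of_notMem (show x ∉ (M : Set E) from hx), Set.indicator_of_notMem, mul_zero]
    exact fun h' => hx ((AddSubgroup.add_mem_cancel_right M hh).1 h')

variable {F : Type*} [NontriviallyNormedField F] {χ : AddChar F Circle}

theorem coe_addChar_add (a b : F) :
    ((χ (a + b) : Circle) : ℂ) = ((χ a : Circle) : ℂ) * ((χ b : Circle) : ℂ) := by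
  rw [AddChar.map_add_eq_mul, Circle.coe_mul]

theorem coe_addChar_neg (a : F) :
    ((χ (-a) : Circle) : ℂ) = (starRingEnd ℂ) ((χ a : Circle) : ℂ) := by
  rw [AddChar.map_neg_eq_inv, Circle.coe_inv_eq_conj]

theorem continuous_coe_addChar (hχcont : Continuous χ) :
    Continuous fun a : F => ((χ a : Circle) : ℂ) :=
  continuous_subtype_val.comp hχcont

variable (hχ : ∀ a : F, χ a = 1 ↔ ‖a‖ ≤ 1)
include hχ

theorem coe_addChar_eq_one_iff (a : F) : ((χ a : Circle) : ℂ) = 1 ↔ ‖a‖ ≤ 1 := by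
  rw [← hχ, Circle.coe_eq_one]

theorem setIntegral_addChar_of_le {μ : Measure E} [μ.IsAddHaarMeasure] {M : AddSubgroup E}
    (hM : IsLattice M) {f : E → F} (hf : ∀ h ∈ M, ‖f h‖ ≤ 1) :
    ∫ x in (M : Set E), ((χ (f x) : Circle) : ℂ) ∂μ = μ.real (M : Set E) := by
  rw [setIntegral_congr_fun hM.measurableSet (g := fun _ => (1 : ℂ))]
  · simp
  · intro x hx
    exact (coe_addChar_eq_one_iff hχ _).2 (hf x hx)

theorem setIntegral_addChar_of_not_le {μ : Measure E} [μ.IsAddHaarMeasure] {M : AddSubgroup E}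
    (hM : IsLattice M) {f : E → F} (hadd : ∀ x y, f (x + y) = f x + f y)
    (hf : ¬ ∀ h ∈ M, ‖f h‖ ≤ 1) :
    ∫ x in (M : Set E), ((χ (f x) : Circle) : ℂ) ∂μ = 0 := by
  push Not at hf
  obtain ⟨h, hh, h1⟩ := hf
  refine setIntegral_eq_zero_of_translate hM hh (c := ((χ (f h) : Circle) : ℂ)) ?_ fun x _ => ?_
  · rw [Ne, coe_addChar_eq_one_iff hχ]
    exact not_le.2 h1
  · rw [hadd, coe_addChar_add, mul_comm]

variable [NormedSpace F E]

/-- The Fourier transform of a function invariant under `M` is supported on the functionals that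
are integral on `M`. -/
theorem fourier_eq_zero {μ : Measure E} [μ.IsAddHaarMeasure] {M : AddSubgroup E} {ψ : E → ℂ}
    (hψ : ∀ x, ∀ h ∈ M, ψ (x + h) = ψ x) {ξ : E →L[F] F} (hξ : ¬ ∀ h ∈ M, ‖ξ h‖ ≤ 1) :
    ∫ x, ((χ (ξ x) : Circle) : ℂ) * ψ x ∂μ = 0 := by
  push Not at hξ
  obtain ⟨h, hh, h1⟩ := hξ
  refine integral_eq_zero_of_translate (h := h) (c := ((χ (ξ h) : Circle) : ℂ)) ?_ fun x => ?_
  · rw [Ne, coe_addChar_eq_one_iff hχ]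
    exact not_le.2 h1
  · rw [hψ x h hh, map_add, coe_addChar_add]
    ring

omit hχ in
theorem continuous_fourier [ProperSpace F] [FiniteDimensional F E] (hχcont : Continuous χ)
    {μ : Measure E} [IsFiniteMeasureOnCompacts μ] {ψ : E → ℂ} (hψ : ψ ∈ SchwartzBruhat E) :
    Continuous fun ξ : E →L[F] F => ∫ x, ((χ (ξ x) : Circle) : ℂ) * ψ x ∂μ := by
  have : ProperSpace E := FiniteDimensional.proper F E
  refine continuous_of_dominated (bound := fun x => ‖ψ x‖) ?_ ?_ ?_ ?_
  · intro ξ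
    exact (((continuous_coe_addChar hχcont).comp ξ.continuous).mul
      (SchwartzBruhat.continuous hψ)).aestronglyMeasurable
  · intro ξ
    refine Filter.Eventually.of_forall fun x => ?_
    rw [norm_mul, Circle.norm_coe, one_mul]
  · exact (SchwartzBruhat.integrable hψ).norm
  · refine Filter.Eventually.of_forall fun x => ?_
    exact ((continuous_coe_addChar hχcont).comp
      (ContinuousLinearMap.apply F F x).continuous).mul continuous_const

theorem hasCompactSupport_fourier [IsUltrametricDist F] [ProperSpace F] [FiniteDimensional F E]
    {μ : Measure E} [μ.IsAddHaarMeasure] {ψ : E → ℂ} (hψ : ψ ∈ SchwartzBruhat E) :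
    HasCompactSupport fun ξ : E →L[F] F => ∫ x, ((χ (ξ x) : Circle) : ℂ) * ψ x ∂μ := by
  have : ProperSpace (E →L[F] F) := FiniteDimensional.proper F _
  obtain ⟨M, hM, h⟩ := exists_isLattice_invariant F hψ
  obtain ⟨C, hC, hb⟩ := hM.exists_bound (F := F)
  refine HasCompactSupport.intro (isCompact_closedBall (0 : E →L[F] F) C) fun ξ hξ => ?_
  refine fourier_eq_zero hχ h fun h' => hξ ?_
  rw [mem_closedBall_zero_iff]
  exact hb ξ h'

end Characters


/-! ### Oscillatory integrals of non-degenerate quadratic functions -/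

section Gauss

open Topology Measure

variable {F : Type*} [NontriviallyNormedField F]
  {E : Type*} [NormedAddCommGroup E] [NormedSpace F E]

/-- A continuous function `Q` such that `Q (u + v) - Q u - Q v` is a non-degenerate bilinear
form `β u v`. -/
structure IsNondegQuadratic (Q : E → F) (β : E →ₗ[F] (E →L[F] F)) : Prop where
  continuous : Continuous Q
  map_add : ∀ u v, Q (u + v) = Q u + Q v + β u v
  injective : Function.Injective β

theorem isLocallyConstant_addChar_comp {χ : AddChar F Circle} (hχ : ∀ a : F, χ a = 1 ↔ ‖a‖ ≤ 1)
    {E : Type*} [TopologicalSpace E] {f : E → F} (hf : Continuous f) :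
    IsLocallyConstant fun x => ((χ (f x) : Circle) : ℂ) := by
  refine (IsLocallyConstant.iff_eventually_eq _).2 fun x => ?_
  have h1 : ∀ᶠ y in 𝓝 x, ‖f y - f x‖ < 1 := by
    have hc : Continuous fun y => ‖f y - f x‖ := by fun_prop
    exact hc.continuousAt.eventually_lt continuousAt_const (by simp)
  filter_upwards [h1] with y hy
  have h2 := (coe_addChar_eq_one_iff hχ _).2 hy.le
  rw [← sub_add_cancel (f y) (f x), coe_addChar_add, h2, one_mul]

theorem SchwartzBruhat.mul_addChar {χ : AddChar F Circle} (hχ : ∀ a : F, χ a = 1 ↔ ‖a‖ ≤ 1)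
    {E : Type*} [TopologicalSpace E] {ψ : E → ℂ} (hψ : ψ ∈ SchwartzBruhat E) {f : E → F}
    (hf : Continuous f) : (fun x => ψ x * ((χ (f x) : Circle) : ℂ)) ∈ SchwartzBruhat E :=
  ⟨hψ.1.mul (isLocallyConstant_addChar_comp hχ hf), hψ.2.mul_right⟩

theorem IsLattice.setIntegral_add_right [MeasurableSpace E] [BorelSpace E] (μ : Measure E)
    [μ.IsAddHaarMeasure] {M : AddSubgroup E} (hM : IsLattice M) (f : E → ℂ) {u : E} (hu : u ∈ M) :
    ∫ v in (M : Set E), f (v + u) ∂μ = ∫ v in (M : Set E), f v ∂μ := by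
  rw [← integral_indicator hM.measurableSet, ← integral_indicator hM.measurableSet,
    ← integral_add_right_eq_self ((M : Set E).indicator f) u]
  congr 1
  ext v
  by_cases hv : v ∈ M
  · rw [Set.indicator_of_mem (show v ∈ (M : Set E) from hv),
      Set.indicator_of_mem (show v + u ∈ (M : Set E) from M.add_mem hv hu)]
  · rw [Set.indicator_of_notMem (show v ∉ (M : Set E) from hv), Set.indicator_of_notMem]
    exact fun h' => hv ((AddSubgroup.add_mem_cancel_right M hu).1 h')

theorem isClosed_polar (β : E →ₗ[F] (E →L[F] F)) (hβ : Continuous β) (M : AddSubgroup E) :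
    IsClosed {v : E | ∀ h ∈ M, ‖β v h‖ ≤ 1} := by
  simp only [Set.ofPred_forall]
  refine isClosed_iInter fun h => isClosed_iInter fun _ => ?_
  exact isClosed_le (((ContinuousLinearMap.apply F F h).continuous.comp hβ).norm)
    continuous_const

variable [IsUltrametricDist F] [ProperSpace F] [FiniteDimensional F E]
  [MeasurableSpace E] [BorelSpace E]
  {χ : AddChar F Circle} (hχcont : Continuous χ) (hχ : ∀ a : F, χ a = 1 ↔ ‖a‖ ≤ 1)
  (μ : Measure E) [μ.IsAddHaarMeasure]
  {Q : E → F} {β : E →ₗ[F] (E →L[F] F)} (hQ : IsNondegQuadratic Q β)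

include hχ hQ in
/-- After expanding `Q (v - u)` by the polar form, the convolution at `v` is a Fourier transform at
the functional `β (-v)`. -/
theorem convolution_eq_zero_of_large {Φ : E → ℂ} (hΦ : Φ ∈ SchwartzBruhat E) :
    ∃ R : ℝ, ∀ v, R < ‖v‖ → ∫ w, Φ (v - w) * ((χ (Q w) : Circle) : ℂ) ∂μ = 0 := by
  have : ProperSpace E := FiniteDimensional.proper F E
  have h1 : (fun u => Φ u * ((χ (Q (-u)) : Circle) : ℂ)) ∈ SchwartzBruhat E :=
    SchwartzBruhat.mul_addChar hχ hΦ (hQ.continuous.comp continuous_neg)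
  obtain ⟨M, hM, hinv⟩ := exists_isLattice_invariant F h1
  obtain ⟨C, hC, hb⟩ := hM.exists_bound_of_injective hQ.injective
  refine ⟨C, fun v hv => ?_⟩
  have h2 : ∫ w, Φ (v - w) * ((χ (Q w) : Circle) : ℂ) ∂μ =
      ((χ (Q v) : Circle) : ℂ) *
        ∫ u, ((χ (β (-v) u) : Circle) : ℂ) * (Φ u * ((χ (Q (-u)) : Circle) : ℂ)) ∂μ := by
    rw [← integral_sub_left_eq_self (fun w => Φ (v - w) * ((χ (Q w) : Circle) : ℂ)) μ v,
      ← integral_const_mul]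
    congr 1
    ext u
    rw [sub_sub_cancel, sub_eq_add_neg v u, hQ.map_add, coe_addChar_add, coe_addChar_add,
      map_neg β, map_neg]
    simp only [_root_.neg_apply]
    ring
  rw [h2, fourier_eq_zero hχ hinv, mul_zero]
  intro h3
  have h4 := hb (-v) h3
  rw [norm_neg] at h4
  exact absurd hv (not_lt.2 h4)

include hχcont hQ in
/-- Fubini's theorem on a lattice containing the supports of `Φ` and of its convolution with
`χ ∘ Q`. -/
theorem setIntegral_mul_integral_eq {Φ : E → ℂ} (hΦ : Φ ∈ SchwartzBruhat E) {R : ℝ}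
    (hR : ∀ v, R < ‖v‖ → ∫ w, Φ (v - w) * ((χ (Q w) : Circle) : ℂ) ∂μ = 0)
    {M : AddSubgroup E} (hM : IsLattice M) (hRM : Metric.closedBall (0 : E) R ⊆ M)
    (hΦM : Function.support Φ ⊆ M) :
    ∫ v, (∫ w, Φ (v - w) * ((χ (Q w) : Circle) : ℂ) ∂μ) ∂μ =
      (∫ w in (M : Set E), ((χ (Q w) : Circle) : ℂ) ∂μ) * ∫ v, Φ v ∂μ := by
  have : ProperSpace E := FiniteDimensional.proper F E
  have h1 : ∫ v, (∫ w, Φ (v - w) * ((χ (Q w) : Circle) : ℂ) ∂μ) ∂μ =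
      ∫ v in (M : Set E), (∫ w, Φ (v - w) * ((χ (Q w) : Circle) : ℂ) ∂μ) ∂μ := by
    refine (setIntegral_eq_integral_of_forall_compl_eq_zero fun v hv => hR v ?_).symm
    by_contra h
    exact hv (hRM (by simpa using h))
  have h2 : ∀ v, ∫ w, Φ (v - w) * ((χ (Q w) : Circle) : ℂ) ∂μ =
      ∫ u, Φ u * ((χ (Q (v - u)) : Circle) : ℂ) ∂μ := by
    intro v
    rw [← integral_sub_left_eq_self (fun w => Φ (v - w) * ((χ (Q w) : Circle) : ℂ)) μ v]
    simp
  have hfin : IsFiniteMeasure (μ.restrict (M : Set E)) :=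
    ⟨by rw [Measure.restrict_apply_univ]; exact hM.isCompact.measure_lt_top⟩
  have hint : Integrable (Function.uncurry fun v u => Φ u * ((χ (Q (v - u)) : Circle) : ℂ))
      ((μ.restrict (M : Set E)).prod μ) := by
    have h3 : Integrable (fun z : E × E => (1 : ℂ) * Φ z.2) ((μ.restrict (M : Set E)).prod μ) :=
      Integrable.mul_prod (integrable_const _) (SchwartzBruhat.integrable hΦ)
    refine h3.mono (Continuous.aestronglyMeasurable ?_) (Filter.Eventually.of_forall fun z => ?_)
    · exact ((SchwartzBruhat.continuous hΦ).comp continuous_snd).mul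
        ((continuous_coe_addChar hχcont).comp (hQ.continuous.comp (by fun_prop)))
    · simp only [Function.uncurry, norm_mul, Circle.norm_coe, mul_one, one_mul, le_refl]
  simp_rw [h1, h2]
  rw [integral_integral_swap hint, ← integral_const_mul]
  congr 1
  ext u
  rw [integral_const_mul, mul_comm]
  by_cases hu : u ∈ M
  · have h4 := hM.setIntegral_add_right μ (fun v => ((χ (Q v) : Circle) : ℂ)) (M.neg_mem hu)
    simp only [← sub_eq_add_neg] at h4
    rw [h4]
  · have h5 : Φ u = 0 := by
      by_contra h
      exact hu (hΦM h)
    rw [h5, mul_zero, mul_zero]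

include hχcont hχ hQ in
/-- The integrals of `χ ∘ Q` over lattices stabilize, and their limit is the value at the origin
of the Fourier transform of `χ ∘ Q`. -/
theorem exists_gauss : ∃ G : ℂ,
    (∃ R : ℝ, ∀ M : AddSubgroup E, IsLattice M → Metric.closedBall (0 : E) R ⊆ M →
      ∫ w in (M : Set E), ((χ (Q w) : Circle) : ℂ) ∂μ = G) ∧
    ∀ Φ ∈ SchwartzBruhat E,
      ∫ v, (∫ w, Φ (v - w) * ((χ (Q w) : Circle) : ℂ) ∂μ) ∂μ = G * ∫ v, Φ v ∂μ := by
  obtain ⟨M₀, hM₀, -⟩ := exists_isLattice_subset F (Filter.univ_mem (f := 𝓝 (0 : E)))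
  have hΦ₀ := hM₀.indicator_mem 1
  set Φ₀ : E → ℂ := Set.indicator (M₀ : Set E) fun _ => 1 with hΦ₀_def
  have hI : ∫ v, Φ₀ v ∂μ ≠ 0 := by
    rw [hΦ₀_def, integral_indicator hM₀.measurableSet]
    simpa using (hM₀.measureReal_pos μ).ne'
  obtain ⟨R₀, hR₀⟩ := convolution_eq_zero_of_large hχ μ hQ hΦ₀
  have hb : ∀ Φ ∈ SchwartzBruhat E, ∃ R, Function.support Φ ⊆ Metric.closedBall (0 : E) R := by
    intro Φ hΦ
    obtain ⟨R, hR⟩ := hΦ.2.isCompact.isBounded.subset_closedBall 0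
    exact ⟨R, (subset_tsupport Φ).trans hR⟩
  obtain ⟨R₁, hR₁⟩ := hb Φ₀ hΦ₀
  have h1 : ∀ M : AddSubgroup E, IsLattice M → Metric.closedBall (0 : E) (max R₀ R₁) ⊆ M →
      ∫ w in (M : Set E), ((χ (Q w) : Circle) : ℂ) ∂μ =
        (∫ v, (∫ w, Φ₀ (v - w) * ((χ (Q w) : Circle) : ℂ) ∂μ) ∂μ) / ∫ v, Φ₀ v ∂μ := by
    intro M hM hRM
    rw [eq_div_iff hI]
    exact (setIntegral_mul_integral_eq hχcont μ hQ hΦ₀ hR₀ hM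
      ((Metric.closedBall_subset_closedBall (le_max_left _ _)).trans hRM)
      (hR₁.trans ((Metric.closedBall_subset_closedBall (le_max_right _ _)).trans hRM))).symm
  refine ⟨_, ⟨_, h1⟩, fun Φ hΦ => ?_⟩
  obtain ⟨R₂, hR₂⟩ := convolution_eq_zero_of_large hχ μ hQ hΦ
  obtain ⟨R₃, hR₃⟩ := hb Φ hΦ
  obtain ⟨M, hM, hRM⟩ := exists_isLattice_superset F
    (Metric.isBounded_closedBall (x := (0 : E)) (r := max (max R₀ R₁) (max R₂ R₃)))
  have hsub : ∀ r ≤ max (max R₀ R₁) (max R₂ R₃), Metric.closedBall (0 : E) r ⊆ M :=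
    fun r hr => (Metric.closedBall_subset_closedBall hr).trans hRM
  rw [← h1 M hM (hsub _ (le_max_left _ _))]
  exact setIntegral_mul_integral_eq hχcont μ hQ hΦ hR₂ hM
    (hsub _ ((le_max_left _ _).trans (le_max_right _ _)))
    (hR₃.trans (hsub _ ((le_max_right _ _).trans (le_max_right _ _))))

include hχcont hχ hQ in
/-- The square of the absolute value of an integral of `χ ∘ Q` over a lattice: the double integral
of `χ (Q (v + w) - Q w)` over the lattice, in which the integral over `w` forces `v` into the polar. -/
theorem normSq_setIntegral {M : AddSubgroup E} (hM : IsLattice M) :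
    ((‖∫ w in (M : Set E), ((χ (Q w) : Circle) : ℂ) ∂μ‖ ^ 2 : ℝ) : ℂ) =
      μ.real (M : Set E) * ∫ v in (M : Set E) ∩ {v | ∀ h ∈ M, ‖β v h‖ ≤ 1},
        ((χ (Q v) : Circle) : ℂ) ∂μ := by
  have : ProperSpace E := FiniteDimensional.proper F E
  have hβ : Continuous β := β.continuous_of_finiteDimensional
  have hfin : IsFiniteMeasure (μ.restrict (M : Set E)) :=
    ⟨by rw [Measure.restrict_apply_univ]; exact hM.isCompact.measure_lt_top⟩
  set g : E → ℂ := fun w => ((χ (Q w) : Circle) : ℂ) with hg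
  have hgc : Continuous g := (continuous_coe_addChar hχcont).comp hQ.continuous
  have h1 : ((‖∫ w in (M : Set E), g w ∂μ‖ ^ 2 : ℝ) : ℂ) =
      ∫ w in (M : Set E), (∫ v in (M : Set E), g v * ((χ (β v w) : Circle) : ℂ) ∂μ) ∂μ := by
    rw [Complex.ofReal_pow, ← Complex.conj_mul', ← integral_conj, ← integral_mul_const]
    refine setIntegral_congr_fun hM.measurableSet fun w hw => ?_
    rw [← hM.setIntegral_add_right μ g hw, ← integral_const_mul]
    congr 1
    ext v
    simp only [hg]
    have h2 : -Q w + Q (v + w) = Q v + β v w := by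
      rw [hQ.map_add]
      ring
    rw [← coe_addChar_neg, ← coe_addChar_add, ← coe_addChar_add, h2]
  have hint : Integrable (Function.uncurry fun w v => g v * ((χ (β v w) : Circle) : ℂ))
      ((μ.restrict (M : Set E)).prod (μ.restrict (M : Set E))) := by
    have h3 : Integrable (fun z : E × E => (1 : ℂ))
        ((μ.restrict (M : Set E)).prod (μ.restrict (M : Set E))) := integrable_const _
    refine h3.mono (Continuous.aestronglyMeasurable ?_) (Filter.Eventually.of_forall fun z => ?_)
    · refine (hgc.comp continuous_snd).mul ((continuous_coe_addChar hχcont).comp ?_)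
      exact (hβ.comp continuous_snd).clm_apply continuous_fst
    · simp only [Function.uncurry, hg, norm_mul, Circle.norm_coe, norm_one, mul_one, le_refl]
  rw [h1, integral_integral_swap hint, ← integral_const_mul,
    ← setIntegral_indicator (s := (M : Set E)) (isClosed_polar β hβ M).measurableSet]
  congr 1
  ext v
  rw [integral_const_mul]
  by_cases hv : v ∈ {v : E | ∀ h ∈ M, ‖β v h‖ ≤ 1}
  · rw [Set.indicator_of_mem hv, setIntegral_addChar_of_le hχ hM hv, mul_comm]
  · rw [Set.indicator_of_notMem hv, setIntegral_addChar_of_not_le hχ hM (map_add _) hv, mul_zero]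

include hχcont hχ hQ in
theorem norm_setIntegral_le {M : AddSubgroup E} (hM : IsLattice M) :
    ‖∫ w in (M : Set E), ((χ (Q w) : Circle) : ℂ) ∂μ‖ ^ 2 ≤
      μ.real (M : Set E) * μ.real {v | ∀ h ∈ M, ‖β v h‖ ≤ 1} := by
  have : ProperSpace E := FiniteDimensional.proper F E
  have h1 := congrArg norm (normSq_setIntegral hχcont hχ μ hQ hM)
  obtain ⟨C, -, hC⟩ := hM.exists_bound_of_injective hQ.injective
  have hfin : μ {v | ∀ h ∈ M, ‖β v h‖ ≤ 1} < ⊤ :=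
    (Metric.isBounded_closedBall.subset fun v hv =>
      mem_closedBall_zero_iff.2 (hC v hv)).measure_lt_top
  rw [Complex.norm_real, norm_mul, Complex.norm_real, Real.norm_of_nonneg (by positivity),
    Real.norm_of_nonneg measureReal_nonneg] at h1
  rw [h1]
  refine mul_le_mul_of_nonneg_left ?_ measureReal_nonneg
  refine (norm_integral_le_integral_norm _).trans ?_
  simp only [Circle.norm_coe, integral_const, smul_eq_mul, mul_one, measureReal_restrict_apply_univ]
  exact measureReal_mono Set.inter_subset_right hfin.ne

include hχcont hχ hQ in
theorem norm_setIntegral_eq {M : AddSubgroup E} (hM : IsLattice M)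
    (hsub : ∀ v, (∀ h ∈ M, ‖β v h‖ ≤ 1) → v ∈ M ∧ ‖Q v‖ ≤ 1) :
    ‖∫ w in (M : Set E), ((χ (Q w) : Circle) : ℂ) ∂μ‖ ^ 2 =
      μ.real (M : Set E) * μ.real {v | ∀ h ∈ M, ‖β v h‖ ≤ 1} := by
  have hD : MeasurableSet {v | ∀ h ∈ M, ‖β v h‖ ≤ 1} :=
    (isClosed_polar β β.continuous_of_finiteDimensional M).measurableSet
  have h1 := normSq_setIntegral hχcont hχ μ hQ hM
  have h2 : (M : Set E) ∩ {v | ∀ h ∈ M, ‖β v h‖ ≤ 1} = {v | ∀ h ∈ M, ‖β v h‖ ≤ 1} :=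
    Set.inter_eq_right.2 fun v hv => (hsub v hv).1
  rw [h2, setIntegral_congr_fun hD (g := fun _ => (1 : ℂ))] at h1
  · simp only [integral_const, measureReal_restrict_apply_univ, Complex.real_smul, mul_one] at h1
    exact_mod_cast h1
  · exact fun v hv => (coe_addChar_eq_one_iff hχ _).2 (hsub v hv).2

end Gauss


/-! ### The eighth power of the Weil factor -/

section EighthRoot

open Topology Measure

/-- In a non-archimedean local field of characteristic zero `-1` is a sum of four squares: it is
a limit of natural numbers, and the sums of four squares of integral elements form a compact set
containing all natural numbers. -/
theorem exists_four_squares_eq_neg_one (F : Type*) [NontriviallyNormedField F]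
    [IsUltrametricDist F] [ProperSpace F] [CharZero F] :
    ∃ a b c d : F, a ^ 2 + b ^ 2 + c ^ 2 + d ^ 2 = -1 := by
  set S : Set F := (fun p : F × F × F × F => p.1 ^ 2 + p.2.1 ^ 2 + p.2.2.1 ^ 2 + p.2.2.2 ^ 2) ''
    Metric.closedBall 0 1 with hS
  have hSc : IsClosed S := by
    refine ((isCompact_closedBall (0 : F × F × F × F) 1).image ?_).isClosed
    fun_prop
  have hnat : ∀ n : ℕ, ‖(n : F)‖ ≤ 1 := fun n => IsUltrametricDist.norm_natCast_le_one F n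
  have hmem : ∀ n : ℕ, (n : F) ∈ S := by
    intro n
    obtain ⟨a, b, c, d, h⟩ := Nat.sum_four_squares n
    refine ⟨((a : F), (b : F), (c : F), (d : F)), ?_, ?_⟩
    · rw [mem_closedBall_zero_iff]
      simp only [Prod.norm_def, max_le_iff]
      exact ⟨hnat a, hnat b, hnat c, hnat d⟩
    · change (a : F) ^ 2 + (b : F) ^ 2 + (c : F) ^ 2 + (d : F) ^ 2 = n
      rw [← h]
      push_cast
      ring
  -- differences of consecutive terms of a convergent subsequence of `ℕ`, minus one, tend to `-1`
  obtain ⟨l, -, φ, hφ, hl⟩ := (isCompact_closedBall (0 : F) 1).tendsto_subseq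
    (x := fun n : ℕ => (n : F)) fun n => by simpa using hnat n
  have h1 : Filter.Tendsto (fun n => ((φ (n + 1) - φ n - 1 : ℕ) : F)) Filter.atTop (𝓝 (-1)) := by
    have h2 : Filter.Tendsto (fun n => ((φ (n + 1) : ℕ) : F) - (φ n : F) - 1) Filter.atTop
        (𝓝 (l - l - 1)) :=
      ((hl.comp (Filter.tendsto_add_atTop_nat 1)).sub hl).sub tendsto_const_nhds
    rw [sub_self, zero_sub] at h2
    refine h2.congr fun n => ?_
    have h3 : φ n < φ (n + 1) := hφ (Nat.lt_succ_self n)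
    rw [Nat.cast_sub (by omega), Nat.cast_sub h3.le, Nat.cast_one]
  obtain ⟨p, -, hp⟩ := hSc.mem_of_tendsto h1 (Filter.Eventually.of_forall fun n => hmem _)
  exact ⟨_, _, _, _, hp⟩

variable {F : Type*} [NontriviallyNormedField F]
  {E : Type*} [NormedAddCommGroup E] [NormedSpace F E]

/-- Left multiplication by the quaternion `a + b i + c j + d k` on four copies of `E`. -/
def quaternionMul (E : Type*) [NormedAddCommGroup E] [NormedSpace F E] (a b c d : F) :
    (Fin 4 → E) →ₗ[F] (Fin 4 → E) where
  toFun w := ![a • w 0 - b • w 1 - c • w 2 - d • w 3, b • w 0 + a • w 1 - d • w 2 + c • w 3,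
    c • w 0 + d • w 1 + a • w 2 - b • w 3, d • w 0 - c • w 1 + b • w 2 + a • w 3]
  map_add' v w := by
    ext i
    fin_cases i <;> simp [smul_add] <;> abel
  map_smul' r w := by
    ext i
    fin_cases i <;> simp <;> module

theorem quaternionMul_conj (a b c d : F) (w : Fin 4 → E) :
    quaternionMul E a b c d (quaternionMul E a (-b) (-c) (-d) w) =
      (a ^ 2 + b ^ 2 + c ^ 2 + d ^ 2) • w := by
  ext i
  fin_cases i <;> simp [quaternionMul] <;> module

theorem sum_quaternionMul {q : LinearMap.BilinForm F E} (hq : ∀ u v, q u v = q v u) (a b c d : F)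
    (w : Fin 4 → E) :
    ∑ i, q (quaternionMul E a b c d w i) (quaternionMul E a b c d w i) =
      (a ^ 2 + b ^ 2 + c ^ 2 + d ^ 2) * ∑ i, q (w i) (w i) := by
  simp only [Fin.sum_univ_four, quaternionMul, LinearMap.coe_mk, AddHom.coe_mk,
    Matrix.cons_val, map_add, map_sub, map_smul, LinearMap.add_apply, LinearMap.sub_apply,
    LinearMap.smul_apply, smul_eq_mul]
  rw [hq (w 1) (w 0), hq (w 2) (w 0), hq (w 3) (w 0), hq (w 2) (w 1), hq (w 3) (w 1),
    hq (w 3) (w 2)]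
  ring

/-- The polar form of the orthogonal sum of four copies of a quadratic function. -/
noncomputable def polarFour (β : E →ₗ[F] (E →L[F] F)) :
    (Fin 4 → E) →ₗ[F] ((Fin 4 → E) →L[F] F) where
  toFun w := ∑ i, (β (w i)).comp (ContinuousLinearMap.proj i)
  map_add' v w := by
    ext x
    simp [Finset.sum_add_distrib]
  map_smul' r w := by
    ext x
    simp [Finset.mul_sum]

theorem IsNondegQuadratic.four {Q : E → F} {β : E →ₗ[F] (E →L[F] F)} (hQ : IsNondegQuadratic Q β) :
    IsNondegQuadratic (fun w : Fin 4 → E => ∑ i, Q (w i)) (polarFour β) where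
  continuous := continuous_finsetSum _ fun i _ => hQ.continuous.comp (continuous_apply i)
  map_add u v := by
    simp [hQ.map_add, Finset.sum_add_distrib, polarFour]
  injective := by
    intro v w h
    ext i
    apply hQ.injective
    ext x
    have h1 := congrArg (fun f : (Fin 4 → E) →L[F] F => f (Pi.single i x)) h
    have h2 : ∀ u : Fin 4 → E, polarFour β u (Pi.single i x) = β (u i) x := by
      intro u
      simp only [polarFour, LinearMap.coe_mk, AddHom.coe_mk, _root_.sum_apply,
        ContinuousLinearMap.comp_apply, ContinuousLinearMap.proj_apply]
      rw [Finset.sum_eq_single i]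
      · simp
      · intro j _ hj
        rw [Pi.single_eq_of_ne hj, map_zero]
      · simp
    simpa only [h2] using h1

theorem setIntegral_four {E : Type*} [NormedAddCommGroup E] [MeasurableSpace E]
    {χ : AddChar F Circle} (μ : Measure E) [SigmaFinite μ] (Q : E → F) (M : AddSubgroup E) :
    ∫ w in ((AddSubgroup.pi Set.univ fun _ : Fin 4 => M : AddSubgroup (Fin 4 → E)) :
        Set (Fin 4 → E)), ((χ (∑ i, Q (w i)) : Circle) : ℂ) ∂(Measure.pi fun _ => μ) =
      (∫ w in (M : Set E), ((χ (Q w) : Circle) : ℂ) ∂μ) ^ 4 := by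
  have h1 : ((AddSubgroup.pi Set.univ fun _ : Fin 4 => M : AddSubgroup (Fin 4 → E)) :
      Set (Fin 4 → E)) = Set.univ.pi fun _ => (M : Set E) := rfl
  rw [h1, Measure.restrict_pi_pi]
  have h2 : ∀ w : Fin 4 → E, ((χ (∑ i, Q (w i)) : Circle) : ℂ) =
      ∏ i, ((χ (Q (w i)) : Circle) : ℂ) := by
    intro w
    simp only [Fin.sum_univ_four, Fin.prod_univ_four, coe_addChar_add]
  simp_rw [h2]
  rw [integral_fintype_prod_eq_prod (f := fun _ : Fin 4 => fun x : E => ((χ (Q x) : Circle) : ℂ))]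
  simp

variable [IsUltrametricDist F] [ProperSpace F] [CharZero F] [FiniteDimensional F E]
  [MeasurableSpace E] [BorelSpace E]
  {χ : AddChar F Circle} (hχcont : Continuous χ) (hχ : ∀ a : F, χ a = 1 ↔ ‖a‖ ≤ 1)
  (μ : Measure E) [μ.IsAddHaarMeasure]
  {Q : E → F} {β : E →ₗ[F] (E →L[F] F)} (hQ : IsNondegQuadratic Q β)
  {q : LinearMap.BilinForm F E} (hq : ∀ u v, q u v = q v u) (hQq : ∀ u, Q u = q u u)

include hχcont hχ hQ hq hQq in
/-- The fourth power of a non-degenerate Gauss integral is real: the sum of four copies of `Q` is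
equivalent to its negative, through multiplication by a quaternion of norm `-1`. -/
theorem conj_gauss_pow_four {G : ℂ} {R : ℝ}
    (hG : ∀ M : AddSubgroup E, IsLattice M → Metric.closedBall (0 : E) R ⊆ M →
      ∫ w in (M : Set E), ((χ (Q w) : Circle) : ℂ) ∂μ = G) :
    (starRingEnd ℂ) (G ^ 4) = G ^ 4 := by
  have : ProperSpace E := FiniteDimensional.proper F E
  obtain ⟨a, b, c, d, habcd⟩ := exists_four_squares_eq_neg_one F
  set T := quaternionMul (F := F) E a b c d with hT
  set T' := quaternionMul (F := F) E a (-b) (-c) (-d) with hT'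
  have hTT' : ∀ w, T (T' w) = -w := by
    intro w
    rw [hT, hT', quaternionMul_conj, habcd, neg_one_smul]
  have hT'T : ∀ w, T' (T w) = -w := by
    intro w
    have h := quaternionMul_conj a (-b) (-c) (-d) w
    simp only [neg_neg, neg_sq] at h
    rw [hT, hT', h, habcd, neg_one_smul]
  let e : (Fin 4 → E) ≃L[F] (Fin 4 → E) :=
    (LinearEquiv.ofLinearMap T (-T') (by ext w; simp [hTT']) (by ext w; simp [hT'T])
      ).toContinuousLinearEquiv
  have he : ∀ w, e w = T w := fun w => rfl
  set π : Measure (Fin 4 → E) := Measure.pi fun _ => μ with hπ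
  set f : (Fin 4 → E) → ℂ := fun w => ((χ (∑ i, Q (w i)) : Circle) : ℂ) with hf
  have hfe : ∀ w, f (e w) = (starRingEnd ℂ) (f w) := by
    intro w
    simp only [hf]
    rw [← coe_addChar_neg]
    simp only [hQq, he]
    rw [sum_quaternionMul hq, habcd, neg_one_mul]
  obtain ⟨G₄, ⟨R₄, hG₄⟩, -⟩ := exists_gauss hχcont hχ π hQ.four
  have hlarge : ∀ r : ℝ, ∃ M : AddSubgroup E, IsLattice M ∧ Metric.closedBall 0 R ⊆ (M : Set E) ∧
      Metric.closedBall (0 : Fin 4 → E) r ⊆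
        (AddSubgroup.pi Set.univ fun _ : Fin 4 => M : AddSubgroup (Fin 4 → E)) := by
    intro r
    obtain ⟨M, hM, hRM⟩ := exists_isLattice_superset F
      (Metric.isBounded_closedBall (x := (0 : E)) (r := max R r))
    refine ⟨M, hM, (Metric.closedBall_subset_closedBall (le_max_left _ _)).trans hRM, ?_⟩
    intro w hw i _
    refine hRM (Metric.closedBall_subset_closedBall (le_max_right _ _) ?_)
    rw [mem_closedBall_zero_iff] at hw ⊢
    exact (norm_le_pi_norm w i).trans hw
  have hGG₄ : G₄ = G ^ 4 := by
    obtain ⟨M, hM, hRM, hRM'⟩ := hlarge R₄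
    rw [← hG₄ _ (IsLattice.pi fun _ => hM) hRM', setIntegral_four, hG M hM hRM]
  have : (π.map e).IsAddHaarMeasure := e.isAddHaarMeasure_map π
  obtain ⟨s, hs⟩ : ∃ s : NNReal, π.map e = s • π := ⟨_, isAddLeftInvariant_eq_smul (π.map e) π⟩
  -- transporting the integral of `f` along `e` conjugates it and scales the measure
  have hconj : (starRingEnd ℂ) G₄ = s * G₄ := by
    obtain ⟨M, hM, -, hM'⟩ := hlarge (max R₄ (‖(e : (Fin 4 → E) →L[F] (Fin 4 → E))‖ * max R₄ 0))
    set M₄ : AddSubgroup (Fin 4 → E) := AddSubgroup.pi Set.univ fun _ : Fin 4 => M with hM₄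
    have hL : IsLattice M₄ := IsLattice.pi fun _ => hM
    have h1 := hG₄ M₄ hL ((Metric.closedBall_subset_closedBall (le_max_left _ _)).trans hM')
    have h2 := hG₄ _ (hL.comap e.toContinuousAddEquiv) (by
      intro w hw
      refine hM' (Metric.closedBall_subset_closedBall (le_max_right _ _) ?_)
      rw [mem_closedBall_zero_iff] at hw ⊢
      refine ((e : (Fin 4 → E) →L[F] (Fin 4 → E)).le_opNorm w).trans ?_
      gcongr
      exact hw.trans (le_max_left _ _))
    have h3 : ∫ w in (M₄ : Set (Fin 4 → E)), f w ∂(π.map e) =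
        ∫ w in e ⁻¹' (M₄ : Set (Fin 4 → E)), f (e w) ∂π :=
      e.toHomeomorph.measurableEmbedding.setIntegral_map _ _
    rw [hs, Measure.restrict_smul, integral_smul_nnreal_measure, h1] at h3
    simp_rw [hfe, integral_conj] at h3
    have h4 : ∫ w in e ⁻¹' (M₄ : Set (Fin 4 → E)), f w ∂π = G₄ := h2
    rw [h4] at h3
    rw [← h3]
    rfl
  rw [← hGG₄]
  -- comparing absolute values, the scaling factor is one
  rcases eq_or_ne G₄ 0 with h0 | h0
  · rw [h0, map_zero]
  have h5 := congrArg norm hconj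
  rw [RCLike.norm_conj, norm_mul] at h5
  have h6 : ‖((s : NNReal) : ℂ)‖ = 1 := by
    have h7 := norm_ne_zero_iff.2 h0
    field_simp at h5
    exact h5.symm
  have h8 : (s : ℝ) = 1 := by
    simpa using h6
  rw [hconj]
  have h9 : s = 1 := by exact_mod_cast h8
  rw [h9]
  simp

end EighthRoot


/-! ### Local integrability of the inverse square root of the determinant -/

section DetIntegrable

open Topology Measure

variable {F : Type*} [NontriviallyNormedField F] [ProperSpace F]

theorem haarModule_le_one {a : F} (ha : ‖a‖ ≤ 1) : haarModule a ≤ 1 := by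
  let _ : MeasurableSpace F := borel F
  have : BorelSpace F := ⟨rfl⟩
  have hc : (addHaar : Measure F) (Metric.closedBall 0 1) ≠ ⊤ :=
    (isCompact_closedBall 0 1).measure_lt_top.ne
  have hsub : (fun b => a * b) '' Metric.closedBall (0 : F) 1 ⊆ Metric.closedBall (0 : F) 1 := by
    rintro _ ⟨b, hb, rfl⟩
    rw [mem_closedBall_zero_iff] at hb ⊢
    rw [norm_mul]
    exact mul_le_one₀ ha (norm_nonneg b) hb
  exact div_le_one_of_le₀ (ENNReal.toReal_mono hc (measure_mono hsub)) ENNReal.toReal_nonneg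

theorem haarModule_mono {a b : F} (h : ‖a‖ ≤ ‖b‖) : haarModule a ≤ haarModule b := by
  rcases eq_or_ne b 0 with rfl | hb
  · rw [norm_zero, norm_le_zero_iff] at h
    rw [h]
  have h1 : haarModule (a / b) ≤ 1 := haarModule_le_one (by
    rw [norm_div]
    exact div_le_one_of_le₀ h (norm_nonneg b))
  rw [div_eq_mul_inv, haarModule_mul, haarModule_inv, ← div_eq_mul_inv] at h1
  exact (div_le_one (haarModule_pos hb)).1 h1

/-- Off the origin the module is locally constant, because the norm is. -/
theorem measurable_haarModule [IsUltrametricDist F] [MeasurableSpace F] [BorelSpace F] :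
    Measurable (haarModule : F → ℝ) := by
  refine measurable_of_continuousOn_compl_singleton 0 fun a ha => ?_
  refine ContinuousAt.continuousWithinAt ?_
  have h : ∀ᶠ b in 𝓝 a, haarModule b = haarModule a := by
    filter_upwards [Metric.ball_mem_nhds a (norm_pos_iff.2 ha)] with b hb
    have h1 : ‖b‖ = ‖a‖ := by
      rw [mem_ball_iff_norm] at hb
      have h2 := IsUltrametricDist.norm_add_eq_max_of_norm_ne_norm hb.ne
      rw [sub_add_cancel, max_eq_right hb.le] at h2
      exact h2
    exact le_antisymm (haarModule_mono h1.le) (haarModule_mono h1.ge)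
  exact (continuousAt_const (y := haarModule a)).congr (h.mono fun b hb => hb.symm)

/-- The function `|a|_F ^ (-1/2)`, with the value `∞` at the origin. -/
noncomputable def invSqrtModule (a : F) : ENNReal :=
  ENNReal.ofReal (haarModule a) ^ (-(1 / 2) : ℝ)

theorem invSqrtModule_mul (a b : F) :
    invSqrtModule (a * b) = invSqrtModule a * invSqrtModule b := by
  rw [invSqrtModule, haarModule_mul, ENNReal.ofReal_mul (haarModule_nonneg a),
    ENNReal.mul_rpow_of_ne_top ENNReal.ofReal_ne_top ENNReal.ofReal_ne_top]
  rfl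

theorem invSqrtModule_ne_top {a : F} (ha : a ≠ 0) : invSqrtModule a ≠ ⊤ := by
  have h := haarModule_pos ha
  exact ENNReal.rpow_ne_top_of_ne_zero (by simpa using h) ENNReal.ofReal_ne_top

theorem invSqrtModule_anti {a b : F} (h : ‖a‖ ≤ ‖b‖) : invSqrtModule b ≤ invSqrtModule a := by
  rw [invSqrtModule, invSqrtModule, ENNReal.rpow_neg, ENNReal.rpow_neg, ENNReal.inv_le_inv]
  exact ENNReal.rpow_le_rpow (ENNReal.ofReal_le_ofReal (haarModule_mono h)) (by norm_num)

variable [IsUltrametricDist F] [MeasurableSpace F] [BorelSpace F]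

theorem measurable_invSqrtModule : Measurable (invSqrtModule : F → ENNReal) :=
  (measurable_haarModule.ennreal_ofReal).pow_const _

/-- The unit ball contains, besides the ball of radius `‖a‖`, the ball around one. -/
theorem haarModule_lt_one {a : F} (ha : ‖a‖ < 1) : haarModule a < 1 := by
  rcases eq_or_ne a 0 with rfl | ha0
  · rw [haarModule_zero]; exact one_pos
  set μ := (addHaar : Measure F)
  have h1 := map_mul_left_addHaar μ ha0
  have h2 : ENNReal.ofReal (haarModule a) * μ (Metric.closedBall 0 1) =
      μ (Metric.closedBall 0 ‖a‖) := by
    conv_rhs => rw [← h1]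
    rw [Measure.smul_apply, Measure.map_apply (by fun_prop) Metric.isClosed_closedBall.measurableSet,
      smul_eq_mul]
    congr 2
    ext b
    simp [norm_mul, ha0]
  have hc : μ (Metric.closedBall 0 1) ≠ ⊤ := (isCompact_closedBall 0 1).measure_lt_top.ne
  have hca : μ (Metric.closedBall 0 ‖a‖) ≠ ⊤ := (isCompact_closedBall 0 ‖a‖).measure_lt_top.ne
  have h3 : 0 < μ (Metric.ball (1 : F) 1) := Metric.measure_ball_pos μ 1 one_pos
  have h4 : μ (Metric.ball (1 : F) 1) + μ (Metric.closedBall 0 ‖a‖) ≤ μ (Metric.closedBall 0 1) := by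
    have hn : ∀ b ∈ Metric.ball (1 : F) 1, ‖b‖ = 1 := by
      intro b hb
      rw [mem_ball_iff_norm] at hb
      have h := IsUltrametricDist.norm_add_eq_max_of_norm_ne_norm (x := b - 1) (y := 1)
        (by rw [norm_one]; exact hb.ne)
      rwa [sub_add_cancel, norm_one, max_eq_right hb.le] at h
    rw [← measure_union _ Metric.isClosed_closedBall.measurableSet]
    · refine measure_mono (Set.union_subset (fun b hb => ?_)
        (Metric.closedBall_subset_closedBall ha.le))
      rw [mem_closedBall_zero_iff, hn b hb]
    · rw [Set.disjoint_left]
      intro b hb hb'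
      rw [mem_closedBall_zero_iff, hn b hb] at hb'
      exact absurd ha (not_lt.2 hb')
  refine lt_of_le_of_ne (haarModule_le_one ha.le) fun h5 => ?_
  rw [h5, ENNReal.ofReal_one, one_mul] at h2
  rw [← h2] at h4
  have h6 := ENNReal.lt_add_right hc h3.ne'
  rw [add_comm] at h6
  exact absurd h6 (not_lt.2 h4)

/-- The function `|s|^(-1/2)` is integrable over the unit ball. -/
theorem lintegral_invSqrtModule_ball (μ : Measure F) [μ.IsAddHaarMeasure] :
    ∫⁻ s in Metric.closedBall (0 : F) 1, invSqrtModule s ∂μ < ⊤ := by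
  obtain ⟨ϖ, hϖ0, hϖ1⟩ := NormedField.exists_norm_lt_one F
  have hϖ : ϖ ≠ 0 := norm_pos_iff.1 hϖ0
  set t : ENNReal := ENNReal.ofReal (haarModule ϖ) ^ (1 / 2 : ℝ) with ht
  have hρ0 : 0 < haarModule ϖ := haarModule_pos hϖ
  have ht0 : t ≠ 0 := by
    rw [ht]
    exact (ENNReal.rpow_pos (by simpa using hρ0) ENNReal.ofReal_ne_top).ne'
  have ht1 : t < 1 := by
    refine ENNReal.rpow_lt_one ?_ (by norm_num)
    rw [← ENNReal.ofReal_one]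
    exact (ENNReal.ofReal_lt_ofReal_iff one_pos).2 (haarModule_lt_one hϖ1)
  have htt : t ≠ ⊤ := (ht1.trans ENNReal.one_lt_top).ne
  have hsq : ENNReal.ofReal (haarModule ϖ) = t ^ 2 := by
    rw [ht, ← ENNReal.rpow_natCast, ← ENNReal.rpow_mul]
    norm_num
  have hinv : ∀ k : ℕ, invSqrtModule (ϖ ^ k) = (t⁻¹) ^ k := by
    intro k
    have h1 : invSqrtModule ϖ = t⁻¹ := by
      rw [invSqrtModule, ENNReal.rpow_neg]
    induction k with
    | zero =>
      rw [pow_zero, pow_zero, invSqrtModule, haarModule_one, ENNReal.ofReal_one, ENNReal.one_rpow]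
    | succ k ih => rw [pow_succ, invSqrtModule_mul, ih, h1, pow_succ]
  have hvol : ∀ k : ℕ, μ (Metric.closedBall 0 (‖ϖ‖ ^ k)) =
      (t ^ 2) ^ k * μ (Metric.closedBall 0 1) := by
    intro k
    have h1 := map_mul_left_addHaar μ (pow_ne_zero k hϖ)
    conv_lhs => rw [← h1]
    rw [Measure.smul_apply, Measure.map_apply (by fun_prop) Metric.isClosed_closedBall.measurableSet,
      smul_eq_mul, haarModule_pow, ENNReal.ofReal_pow hρ0.le, hsq]
    congr 2
    ext b
    simp [norm_mul, hϖ]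
  -- a step function dominating the integrand, whose integral is a geometric series
  set g : F → ENNReal := fun s => ∑' k : ℕ,
    (Metric.closedBall (0 : F) (‖ϖ‖ ^ k)).indicator (fun _ => (t⁻¹) ^ (k + 1)) s with hg
  have hle : ∀ s ∈ Metric.closedBall (0 : F) 1 \ {0}, invSqrtModule s ≤ g s := by
    rintro s ⟨hs, hs0⟩
    have hex : ∃ k : ℕ, ‖ϖ‖ ^ (k + 1) < ‖s‖ := by
      obtain ⟨k, hk⟩ := exists_pow_lt_of_lt_one (norm_pos_iff.2 hs0) hϖ1
      exact ⟨k, (pow_le_pow_of_le_one hϖ0.le hϖ1.le (Nat.le_succ k)).trans_lt hk⟩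
    classical
    set k := Nat.find hex with hk
    have h1 : ‖ϖ‖ ^ (k + 1) < ‖s‖ := Nat.find_spec hex
    have h2 : ‖s‖ ≤ ‖ϖ‖ ^ k := by
      rcases Nat.eq_zero_or_pos k with h0 | h0
      · rw [h0, pow_zero]
        simpa using hs
      · have h3 := Nat.find_min hex (show k - 1 < Nat.find hex by omega)
        rw [Nat.sub_add_cancel h0] at h3
        exact not_lt.1 h3
    calc invSqrtModule s ≤ invSqrtModule (ϖ ^ (k + 1)) :=
          invSqrtModule_anti (by rw [norm_pow]; exact h1.le)
      _ = (Metric.closedBall (0 : F) (‖ϖ‖ ^ k)).indicator (fun _ => (t⁻¹) ^ (k + 1)) s := by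
          rw [hinv, Set.indicator_of_mem (by simpa using h2)]
      _ ≤ g s := ENNReal.le_tsum k
  calc ∫⁻ s in Metric.closedBall (0 : F) 1, invSqrtModule s ∂μ
      ≤ ∫⁻ s in Metric.closedBall (0 : F) 1, g s ∂μ := by
        refine lintegral_mono_ae ?_
        have h0 : ∀ᵐ s ∂(μ.restrict (Metric.closedBall (0 : F) 1)), s ≠ 0 :=
          ae_restrict_of_ae (compl_mem_ae_iff.2 (measure_singleton 0))
        filter_upwards [h0, ae_restrict_mem Metric.isClosed_closedBall.measurableSet] with s h1 h2
        exact hle s ⟨h2, h1⟩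
    _ ≤ ∫⁻ s, g s ∂μ := setLIntegral_le_lintegral _ _
    _ = ∑' k : ℕ, (t⁻¹ * μ (Metric.closedBall 0 1)) * t ^ k := by
        rw [lintegral_tsum]
        · congr 1
          ext k
          rw [lintegral_indicator Metric.isClosed_closedBall.measurableSet, lintegral_const,
            Measure.restrict_apply_univ, hvol, pow_succ, ← ENNReal.inv_pow, ← pow_mul, two_mul,
            pow_add]
          calc (t ^ k)⁻¹ * t⁻¹ * (t ^ k * t ^ k * μ (Metric.closedBall 0 1))
              = ((t ^ k)⁻¹ * t ^ k) * (t⁻¹ * μ (Metric.closedBall 0 1) * t ^ k) := by ring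
            _ = _ := by
              rw [ENNReal.inv_mul_cancel (pow_ne_zero k ht0) (ENNReal.pow_ne_top htt), one_mul]
        · exact fun k => (measurable_const.indicator
            Metric.isClosed_closedBall.measurableSet).aemeasurable
    _ < ⊤ := by
        rw [ENNReal.tsum_mul_left, ENNReal.tsum_geometric]
        refine ENNReal.mul_lt_top (ENNReal.mul_lt_top (ENNReal.inv_lt_top.2
          (pos_iff_ne_zero.2 ht0)) (isCompact_closedBall 0 1).measure_lt_top) ?_
        exact ENNReal.inv_lt_top.2 (tsub_pos_of_lt ht1)

theorem exists_lintegral_invSqrtModule_le (μ : Measure F) [μ.IsAddHaarMeasure] {K : Set F}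
    (hK : IsCompact K) :
    ∃ C < ⊤, ∀ a : F, ∫⁻ s in K, invSqrtModule (a + s) ∂μ ≤ C := by
  refine ⟨μ K + ∫⁻ s in Metric.closedBall (0 : F) 1, invSqrtModule s ∂μ,
    ENNReal.add_lt_top.2 ⟨hK.measure_lt_top, lintegral_invSqrtModule_ball μ⟩, fun a => ?_⟩
  have h1 : ∀ s : F, invSqrtModule s ≤
      1 + (Metric.closedBall (0 : F) 1).indicator invSqrtModule s := by
    intro s
    by_cases hs : s ∈ Metric.closedBall (0 : F) 1
    · rw [Set.indicator_of_mem hs]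
      exact le_add_self
    · have h2 : ‖(1 : F)‖ ≤ ‖s‖ := by
        rw [norm_one]
        rw [mem_closedBall_zero_iff, not_le] at hs
        exact hs.le
      refine (invSqrtModule_anti h2).trans (le_trans (le_of_eq ?_) le_self_add)
      rw [invSqrtModule, haarModule_one, ENNReal.ofReal_one, ENNReal.one_rpow]
  calc ∫⁻ s in K, invSqrtModule (a + s) ∂μ
      ≤ ∫⁻ s in K, (1 + (Metric.closedBall (0 : F) 1).indicator invSqrtModule (a + s)) ∂μ :=
        lintegral_mono fun s => h1 (a + s)
    _ = μ K + ∫⁻ s in K, (Metric.closedBall (0 : F) 1).indicator invSqrtModule (a + s) ∂μ := by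
        rw [lintegral_add_left measurable_const]
        simp
    _ ≤ μ K + ∫⁻ s, (Metric.closedBall (0 : F) 1).indicator invSqrtModule (a + s) ∂μ := by
        gcongr
        exact Measure.restrict_le_self
    _ = _ := by
        rw [lintegral_add_left_eq_self (fun s =>
          (Metric.closedBall (0 : F) 1).indicator invSqrtModule s) a,
          lintegral_indicator Metric.isClosed_closedBall.measurableSet]

omit [ProperSpace F] [IsUltrametricDist F] [MeasurableSpace F] [BorelSpace F] in
/-- The determinant in terms of the Schur complement of the corner. -/
theorem det_succ_schur {n : ℕ} (M : Matrix (Fin (n + 1)) (Fin (n + 1)) F) (h : M 0 0 ≠ 0) :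
    M.det = M 0 0 * (Matrix.of fun i j : Fin n =>
      M i.succ j.succ - (M 0 0)⁻¹ * M i.succ 0 * M 0 j.succ).det := by
  set c : Fin (n + 1) → F := Fin.cons 0 fun i => (M 0 0)⁻¹ * M i.succ 0 with hc
  set N : Matrix (Fin (n + 1)) (Fin (n + 1)) F := Matrix.of fun i j => M i j - c i * M 0 j with hN
  have hN0 : ∀ j, N 0 j = M 0 j := by intro j; simp [hN, hc]
  have h1 : M.det = N.det := by
    refine Matrix.det_eq_of_forall_row_eq_smul_add_const c 0 (by simp [hc]) fun i j => ?_
    rw [hN0]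
    simp [hN]
  rw [h1, Matrix.det_succ_column_zero, Fin.sum_univ_succ]
  have h2 : ∀ i : Fin n, N i.succ 0 = 0 := by
    intro i
    simp only [hN, hc, Matrix.of_apply, Fin.cons_succ]
    field_simp
    ring
  simp only [h2, mul_zero, zero_mul, Finset.sum_const_zero, add_zero, hN0]
  simp only [Fin.val_zero, pow_zero, one_mul]
  congr 1

/-- Symmetric matrices. -/
def symmetricForms (F : Type*) [NontriviallyNormedField F] (n : ℕ) :
    Submodule F (Fin n → Fin n → F) where
  carrier := {S | ∀ i j, S i j = S j i}
  add_mem' ha hb i j := by simp only [Pi.add_apply, ha i j, hb i j]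
  zero_mem' i j := rfl
  smul_mem' c S hS i j := by simp only [Pi.smul_apply, hS i j]

/-- A symmetric matrix is determined by its corner, the rest of its first row, and the
complementary block. -/
def symmetricFormsSucc (F : Type*) [NontriviallyNormedField F] (n : ℕ) :
    symmetricForms F (n + 1) ≃ₗ[F] F × (Fin n → F) × symmetricForms F n where
  toFun S := (S.1 0 0, fun j => S.1 0 j.succ, ⟨fun i j => S.1 i.succ j.succ, fun i j => S.2 _ _⟩)
  invFun p := ⟨Fin.cons (Fin.cons p.1 p.2.1) fun i => Fin.cons (p.2.1 i) (p.2.2.1 i), by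
    intro i j
    refine Fin.cases ?_ (fun i => ?_) i <;> refine Fin.cases ?_ (fun j => ?_) j <;> simp
    exact p.2.2.2 i j⟩
  left_inv S := by
    ext i j
    refine Fin.cases ?_ (fun i => ?_) i <;> refine Fin.cases ?_ (fun j => ?_) j <;> simp
    exact S.2 _ _
  right_inv p := by
    ext <;> simp
  map_add' S T := rfl
  map_smul' c S := rfl

/-- The integrals of `|det (A + S)|^(-1/2)` over a compact set of symmetric matrices `S` are
bounded uniformly in `A`. The uniformity makes the induction on the size work: the Schur
complement of the corner is a translate of the complementary block. -/
theorem exists_lintegral_det_le (n : ℕ) : ∀ (ν : Measure (symmetricForms F n)) [ν.IsAddHaarMeasure]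
    {K : Set (symmetricForms F n)}, IsCompact K → ∃ C < ⊤, ∀ A : symmetricForms F n,
      ∫⁻ S in K, invSqrtModule (Matrix.of (A.1 + S.1)).det ∂ν ≤ C := by
  induction n with
  | zero =>
    intro ν _ K hK
    refine ⟨ν K, hK.measure_lt_top, fun A => ?_⟩
    simp [invSqrtModule, haarModule_one]
  | succ n ih =>
    intro ν _ K hK
    let e : symmetricForms F (n + 1) ≃L[F] F × (Fin n → F) × symmetricForms F n :=
      (symmetricFormsSucc F n).toContinuousLinearEquiv
    set μ : Measure F := addHaar
    set π : Measure (Fin n → F) := addHaar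
    have : ProperSpace (symmetricForms F n) := FiniteDimensional.proper F _
    set ν' : Measure (symmetricForms F n) := addHaar
    have : (ν.map e).IsAddHaarMeasure := e.isAddHaarMeasure_map ν
    have : (π.prod ν').IsAddHaarMeasure := inferInstance
    obtain ⟨c, hc⟩ : ∃ c : NNReal, ν.map e = c • (μ.prod (π.prod ν')) :=
      ⟨_, isAddLeftInvariant_eq_smul _ _⟩
    set K₁ : Set F := Prod.fst '' (e '' K) with hK₁
    set K₂ : Set (Fin n → F) := (fun p => p.2.1) '' (e '' K) with hK₂
    set K₃ : Set (symmetricForms F n) := (fun p => p.2.2) '' (e '' K) with hK₃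
    have heK : IsCompact (e '' K) := hK.image e.continuous
    have hK₁c : IsCompact K₁ := heK.image continuous_fst
    have hK₂c : IsCompact K₂ := heK.image (by fun_prop)
    have hK₃c : IsCompact K₃ := heK.image (by fun_prop)
    obtain ⟨C₁, hC₁, h₁⟩ := exists_lintegral_invSqrtModule_le μ hK₁c
    obtain ⟨C₃, hC₃, h₃⟩ := ih ν' hK₃c
    refine ⟨c * (C₁ * (π K₂ * C₃)), ENNReal.mul_lt_top ENNReal.coe_lt_top (ENNReal.mul_lt_top hC₁
      (ENNReal.mul_lt_top hK₂c.measure_lt_top hC₃)), fun A => ?_⟩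
    set f : symmetricForms F (n + 1) → ENNReal :=
      fun S => invSqrtModule (Matrix.of (A.1 + S.1)).det with hf
    have hfm : Measurable f := by
      refine measurable_invSqrtModule.comp (Continuous.measurable ?_)
      refine Continuous.matrix_det (continuous_matrix fun i j => ?_)
      have : Continuous fun S : symmetricForms F (n + 1) => S.1 i j :=
        (continuous_apply_apply i j).comp continuous_subtype_val
      exact continuous_const.add this
    have hgm : Measurable fun p => f (e.symm p) := hfm.comp e.symm.continuous.measurable
    have hstep : ∀ s : F, A.1 0 0 + s ≠ 0 →
        ∫⁻ q in K₂ ×ˢ K₃, f (e.symm (s, q)) ∂(π.prod ν') ≤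
          invSqrtModule (A.1 0 0 + s) * (π K₂ * C₃) := by
      intro s hs
      rw [← Measure.prod_restrict, lintegral_prod (fun q => f (e.symm (s, q)))
        ((hgm.comp measurable_prodMk_left).aemeasurable)]
      have hin : ∀ b : Fin n → F, ∫⁻ S in K₃, f (e.symm (s, b, S)) ∂ν' ≤
          invSqrtModule (A.1 0 0 + s) * C₃ := by
        intro b
        -- the Schur complement of the corner is `A' + S`
        let A' : symmetricForms F n := ⟨fun i j => A.1 i.succ j.succ -
          (A.1 0 0 + s)⁻¹ * (A.1 i.succ 0 + b i) * (A.1 0 j.succ + b j), fun i j => by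
            beta_reduce
            rw [A.2 i.succ j.succ, A.2 i.succ 0, A.2 0 j.succ]
            ring⟩
        have hdet : ∀ S : symmetricForms F n, f (e.symm (s, b, S)) =
            invSqrtModule (A.1 0 0 + s) * invSqrtModule (Matrix.of (A'.1 + S.1)).det := by
          intro S
          rw [← invSqrtModule_mul]
          simp only [hf]
          have h00 : (Matrix.of (A.1 + (e.symm (s, b, S)).1)) 0 0 = A.1 0 0 + s := rfl
          have h0 : ∀ j : Fin n, (Matrix.of (A.1 + (e.symm (s, b, S)).1)) 0 j.succ =
            A.1 0 j.succ + b j := fun j => rfl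
          have h1 : ∀ j : Fin n, (Matrix.of (A.1 + (e.symm (s, b, S)).1)) j.succ 0 =
            A.1 j.succ 0 + b j := fun j => rfl
          have h2 : ∀ i j : Fin n, (Matrix.of (A.1 + (e.symm (s, b, S)).1)) i.succ j.succ =
            A.1 i.succ j.succ + S.1 i j := fun i j => rfl
          rw [det_succ_schur _ (by rw [h00]; exact hs)]
          simp only [h00, h0, h1, h2]
          congr 3
          ext i j
          simp only [Matrix.of_apply, Pi.add_apply, A']
          ring
        simp_rw [hdet]
        rw [lintegral_const_mul' _ _ (invSqrtModule_ne_top hs)]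
        gcongr
        exact h₃ A'
      calc ∫⁻ b in K₂, ∫⁻ S in K₃, f (e.symm (s, b, S)) ∂ν' ∂π
          ≤ ∫⁻ b in K₂, invSqrtModule (A.1 0 0 + s) * C₃ ∂π := lintegral_mono fun b => hin b
        _ = invSqrtModule (A.1 0 0 + s) * (π K₂ * C₃) := by
          rw [lintegral_const, Measure.restrict_apply_univ]
          ring
    have hKm : MeasurableSet (K₁ ×ˢ K₂ ×ˢ K₃) :=
      hK₁c.measurableSet.prod (hK₂c.measurableSet.prod hK₃c.measurableSet)
    calc ∫⁻ S in K, f S ∂ν ≤ ∫⁻ S in e ⁻¹' (K₁ ×ˢ K₂ ×ˢ K₃), f S ∂ν := by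
          refine lintegral_mono_set fun S hS => ?_
          exact ⟨⟨_, ⟨S, hS, rfl⟩, rfl⟩, ⟨_, ⟨S, hS, rfl⟩, rfl⟩, ⟨_, ⟨S, hS, rfl⟩, rfl⟩⟩
      _ = ∫⁻ p in K₁ ×ˢ K₂ ×ˢ K₃, f (e.symm p) ∂(ν.map e) := by
          rw [setLIntegral_map hKm hgm e.continuous.measurable]
          simp
      _ = c * ∫⁻ s in K₁, (∫⁻ q in K₂ ×ˢ K₃, f (e.symm (s, q)) ∂(π.prod ν')) ∂μ := by
          rw [hc, Measure.restrict_smul, lintegral_smul_measure, ← Measure.prod_restrict,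
            lintegral_prod _ hgm.aemeasurable]
          rfl
      _ ≤ c * ∫⁻ s in K₁, invSqrtModule (A.1 0 0 + s) * (π K₂ * C₃) ∂μ := by
          gcongr 1
          refine lintegral_mono_ae ?_
          have h0 : ∀ᵐ s ∂(μ.restrict K₁), s ≠ -A.1 0 0 :=
            ae_restrict_of_ae (compl_mem_ae_iff.2 (measure_singleton _))
          filter_upwards [h0] with s hs
          exact hstep s fun h => hs (eq_neg_of_add_eq_zero_right h)
      _ ≤ c * (C₁ * (π K₂ * C₃)) := by
          rw [lintegral_mul_const' _ _ (ENNReal.mul_lt_top hK₂c.measure_lt_top hC₃).ne]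
          gcongr
          exact h₁ _

end DetIntegrable


/-! ### The symplectic Lie algebra -/

section SymplecticBasics

open Topology Measure

variable {F : Type*} [NontriviallyNormedField F]
  {W : Type*} [NormedAddCommGroup W] [NormedSpace F W]
  {B : LinearMap.BilinForm F W}

theorem form_swap (hB : B.IsAlt) (u v : W) : B u v = -B v u := (hB.neg_eq v u).symm

theorem sp_apply_left (x : sp B) (u v : W) : B (x.1 u) v = -B u (x.1 v) :=
  eq_neg_of_add_eq_zero_left (x.2 u v)

theorem sp_symm (hB : B.IsAlt) (x : sp B) (u v : W) : B (x.1 u) v = B (x.1 v) u := by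
  rw [sp_apply_left, form_swap hB u, neg_neg]

theorem eq_zero_of_form_eq_zero (hBnd : B.Nondegenerate) {u : W} (h : ∀ v, B u v = 0) : u = 0 :=
  hBnd.1 u h

theorem exists_form_ne_zero (hBnd : B.Nondegenerate) {a : W} (ha : a ≠ 0) : ∃ u, B a u ≠ 0 := by
  by_contra h
  push Not at h
  exact ha (eq_zero_of_form_eq_zero hBnd h)

theorem exists_form_ne_zero_pair (hBnd : B.Nondegenerate) {a b : W} (ha : a ≠ 0) (hb : b ≠ 0) :
    ∃ u, B a u ≠ 0 ∧ B b u ≠ 0 := by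
  obtain ⟨u, hu⟩ := exists_form_ne_zero hBnd ha
  obtain ⟨v, hv⟩ := exists_form_ne_zero hBnd hb
  by_cases hbu : B b u = 0
  · by_cases hav : B a v = 0
    · refine ⟨u + v, ?_, ?_⟩ <;> rw [map_add]
      · rwa [hav, add_zero]
      · rwa [hbu, zero_add]
    · exact ⟨v, hav, hv⟩
  · exact ⟨u, hu, hbu⟩

/-- The element `w ↦ ⟨w, u⟩ v + ⟨w, v⟩ u` of the symplectic Lie algebra. -/
def symProd (hB : B.IsAlt) [CompleteSpace F] [FiniteDimensional F W] (u v : W) : sp B :=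
  ⟨LinearMap.toContinuousLinearMap ((B.flip u).smulRight v + (B.flip v).smulRight u), fun a b => by
    change B (B a u • v + B a v • u) b + B a (B b u • v + B b v • u) = 0
    simp only [map_add, map_smul, LinearMap.add_apply, LinearMap.smul_apply, smul_eq_mul]
    rw [form_swap hB v b, form_swap hB u b]
    ring⟩

theorem sp_form_add (hB : B.IsAlt) (x : sp B) (u v : W) :
    B (x.1 (u + v)) (u + v) = B (x.1 u) u + B (x.1 v) v + 2 * B (x.1 u) v := by
  simp only [map_add, LinearMap.add_apply]
  rw [sp_symm hB x v u]
  ring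

variable [CompleteSpace F] [FiniteDimensional F W]

theorem symProd_apply (hB : B.IsAlt) (u v w : W) :
    (symProd hB u v).1 w = B w u • v + B w v • u := rfl

/-- The form as a continuous linear map with values in the dual. -/
noncomputable def contForm (B : LinearMap.BilinForm F W) : W →L[F] (W →L[F] F) :=
  LinearMap.toContinuousLinearMap
    ((LinearMap.toContinuousLinearMap : (W →ₗ[F] F) ≃ₗ[F] (W →L[F] F)).toLinearMap ∘ₗ B)

theorem continuous_form {X : Type*} [TopologicalSpace X] {f g : X → W} (hf : Continuous f)
    (hg : Continuous g) : Continuous fun x => B (f x) (g x) :=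
  ((contForm B).continuous.comp hf).clm_apply hg

theorem norm_form_le (u v : W) : ‖B u v‖ ≤ ‖contForm B‖ * ‖u‖ * ‖v‖ :=
  (contForm B).le_opNorm₂ u v

/-- The polar form `(u, v) ↦ 2 ⟨x u, v⟩` of the quadratic form of `x`. -/
noncomputable def spPolar (B : LinearMap.BilinForm F W) (x : sp B) : W →ₗ[F] (W →L[F] F) :=
  (2 : F) • ((contForm B : W →ₗ[F] (W →L[F] F)) ∘ₗ (x.1 : W →ₗ[F] W))

theorem spPolar_apply (x : sp B) (u v : W) : spPolar B x u v = 2 * B (x.1 u) v := rfl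

theorem isNondegQuadratic_sp [CharZero F] (hB : B.IsAlt) (hBnd : B.Nondegenerate) {x : sp B}
    (hx : LinearMap.det (x.1 : W →ₗ[F] W) ≠ 0) :
    IsNondegQuadratic (fun w => B (x.1 w) w) (spPolar B x) where
  continuous := continuous_form x.1.continuous continuous_id
  map_add u v := sp_form_add hB x u v
  injective := by
    rw [← LinearMap.ker_eq_bot, LinearMap.ker_eq_bot']
    intro u hu
    have h1 : x.1 u = 0 := by
      refine eq_zero_of_form_eq_zero hBnd fun v => ?_
      have h2 : spPolar B x u v = 0 := by rw [hu]; rfl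
      rw [spPolar_apply] at h2
      exact (mul_eq_zero.1 h2).resolve_left two_ne_zero
    have h3 := ((LinearMap.isUnit_iff_ker_eq_bot (x.1 : W →ₗ[F] W)).1
      ((LinearMap.isUnit_iff_isUnit_det _).2 hx.isUnit))
    exact (LinearMap.ker_eq_bot'.1 h3) u h1

/-- The symplectic Lie algebra as a space of symmetric matrices: the Gram matrices of the forms
`⟨x u, v⟩`. -/
noncomputable def spEquiv (hB : B.IsAlt) (hBnd : B.Nondegenerate) :
    sp B ≃ₗ[F] symmetricForms F (Module.finrank F W) where
  toFun x := ⟨fun i j => B (x.1 (Module.finBasis F W i)) (Module.finBasis F W j),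
    fun i j => sp_symm hB x _ _⟩
  map_add' x y := by
    ext i j
    simp
  map_smul' c x := by
    ext i j
    simp
  invFun S := ⟨LinearMap.toContinuousLinearMap (Matrix.toLin (Module.finBasis F W)
      (B.dualBasis hBnd (Module.finBasis F W)) (Matrix.of S.1)), by
    intro u v
    set b := Module.finBasis F W
    set f : W →ₗ[F] W := Matrix.toLin b (B.dualBasis hBnd b) (Matrix.of S.1) with hf
    have h1 : ∀ i j, B (f (b i)) (b j) = S.1 j i := by
      intro i j
      rw [← LinearMap.BilinForm.dualBasis_repr_apply hBnd b, hf, Matrix.toLin_self]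
      simp [Finsupp.single_apply]
    have h2 : B.compLeft f + B.compRight f = 0 := by
      refine LinearMap.BilinForm.ext_basis b fun i j => ?_
      simp only [LinearMap.add_apply, LinearMap.BilinForm.compLeft_apply,
        LinearMap.BilinForm.compRight_apply, LinearMap.zero_apply]
      rw [form_swap hB (b i), h1, h1, S.2 j i, add_neg_cancel]
    exact congrArg (fun C : LinearMap.BilinForm F W => C u v) h2⟩
  left_inv x := by
    ext w
    simp only [LinearMap.coe_toContinuousLinearMap']
    set b := Module.finBasis F W
    have h : Matrix.toLin b (B.dualBasis hBnd b) (Matrix.of fun i j => B (x.1 (b i)) (b j)) =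
        (x.1 : W →ₗ[F] W) := by
      rw [← Matrix.toLin_toMatrix b (B.dualBasis hBnd b) (x.1 : W →ₗ[F] W)]
      congr 1
      ext i j
      rw [LinearMap.toMatrix_apply, LinearMap.BilinForm.dualBasis_repr_apply, Matrix.of_apply,
        sp_symm hB]
      rfl
    exact congrArg (fun f : W →ₗ[F] W => f w) h
  right_inv S := by
    ext i j
    simp only [LinearMap.coe_toContinuousLinearMap']
    rw [← LinearMap.BilinForm.dualBasis_repr_apply hBnd, Matrix.toLin_self]
    simpa [Finsupp.single_apply] using S.2 j i

/-- Up to a constant, the determinant of `x` is that of its symmetric matrix. -/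
theorem exists_det_spEquiv (hB : B.IsAlt) (hBnd : B.Nondegenerate) :
    ∃ c : F, c ≠ 0 ∧ ∀ x : sp B, (Matrix.of (spEquiv hB hBnd x).1).det =
      c * LinearMap.det (x.1 : W →ₗ[F] W) := by
  set b := Module.finBasis F W with hb
  set d := B.dualBasis hBnd b with hd
  refine ⟨(LinearMap.toMatrix b d LinearMap.id).det, ?_, fun x => ?_⟩
  · have h1 : LinearMap.toMatrix b d LinearMap.id * LinearMap.toMatrix d b LinearMap.id = 1 := by
      rw [← LinearMap.toMatrix_comp d b d, LinearMap.id_comp, LinearMap.toMatrix_id]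
    have h2 := congrArg Matrix.det h1
    rw [Matrix.det_mul, Matrix.det_one] at h2
    exact left_ne_zero_of_mul_eq_one h2
  · rw [← LinearMap.det_toMatrix b, ← Matrix.det_mul, ← LinearMap.toMatrix_comp b b d,
      LinearMap.id_comp]
    congr 1
    ext i j
    rw [LinearMap.toMatrix_apply, hd, LinearMap.BilinForm.dualBasis_repr_apply, Matrix.of_apply]
    exact sp_symm hB x _ _

/-- The function `|det x|^(-1/2)` is locally integrable on the symplectic Lie algebra. -/
theorem lintegral_invSqrtModule_det_lt_top {F : Type*} [NontriviallyNormedField F]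
    [IsUltrametricDist F] [ProperSpace F]
    {W : Type*} [NormedAddCommGroup W] [NormedSpace F W] [FiniteDimensional F W]
    {B : LinearMap.BilinForm F W} (hB : B.IsAlt) (hBnd : B.Nondegenerate)
    (ν : Measure (sp B)) [ν.IsAddHaarMeasure] {K : Set (sp B)} (hK : IsCompact K) :
    ∫⁻ x in K, invSqrtModule (LinearMap.det (x.1 : W →ₗ[F] W)) ∂ν < ⊤ := by
  let _ : MeasurableSpace F := borel F
  have : BorelSpace F := ⟨rfl⟩
  let e : sp B ≃L[F] symmetricForms F (Module.finrank F W) :=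
    (spEquiv hB hBnd).toContinuousLinearEquiv
  obtain ⟨c, hc, hdet⟩ := exists_det_spEquiv hB hBnd
  have : (ν.map e).IsAddHaarMeasure := e.isAddHaarMeasure_map ν
  obtain ⟨C, hC, h⟩ := exists_lintegral_det_le (Module.finrank F W) (ν.map e)
    (hK.image e.continuous)
  have h0 := h 0
  have hemb : MeasurableEmbedding e := e.toHomeomorph.measurableEmbedding
  rw [hemb.restrict_map, Set.preimage_image_eq _ e.injective, hemb.lintegral_map] at h0
  have h1 : ∀ x : sp B, invSqrtModule (Matrix.of
      ((0 : symmetricForms F (Module.finrank F W)).1 + (e x).1)).det =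
        invSqrtModule c * invSqrtModule (LinearMap.det (x.1 : W →ₗ[F] W)) := by
    intro x
    rw [← invSqrtModule_mul, ← hdet x]
    simp only [ZeroMemClass.coe_zero, zero_add]
    rfl
  have h2 : ∫⁻ x in K, invSqrtModule c *
      invSqrtModule (LinearMap.det (x.1 : W →ₗ[F] W)) ∂ν ≤ C := by
    simp_rw [← h1]
    exact h0
  rw [lintegral_const_mul' _ _ (invSqrtModule_ne_top hc)] at h2
  have h3 : invSqrtModule c ≠ 0 := by
    rw [invSqrtModule, ENNReal.rpow_neg]
    refine ENNReal.inv_ne_zero.2 (ENNReal.rpow_ne_top_of_nonneg (by norm_num) ENNReal.ofReal_ne_top)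
  by_contra h4
  rw [not_lt, top_le_iff] at h4
  rw [h4, ENNReal.mul_top h3] at h2
  exact absurd hC (not_lt.2 h2)

end SymplecticBasics


/-! ### The moment map -/

section MomentMap

open Topology

variable {F : Type*} [NontriviallyNormedField F]

/-- A continuous bilinear map without zero divisors on proper spaces is bounded below. -/
theorem exists_lower_bound_bilinear {E V : Type*} [NormedAddCommGroup E] [NormedSpace F E]
    [ProperSpace E] [NormedAddCommGroup V] [NormedSpace F V] {T : E → E → V}
    (hT : Continuous fun p : E × E => T p.1 p.2)
    (hsmul : ∀ (r s : F) a b, T (r • a) (s • b) = (r * s) • T a b)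
    (h0 : ∀ a b, a ≠ 0 → b ≠ 0 → T a b ≠ 0) :
    ∃ c : ℝ, 0 < c ∧ ∀ a b, c * ‖a‖ * ‖b‖ ≤ ‖T a b‖ := by
  obtain ⟨r, hr⟩ := NormedField.exists_one_lt_norm F
  have hr0 : 0 < ‖r‖ := one_pos.trans hr
  set A : Set E := {a | 1 / ‖r‖ ≤ ‖a‖ ∧ ‖a‖ ≤ 1} with hA
  have hAc : IsCompact A := by
    refine (isCompact_closedBall (0 : E) 1).of_isClosed_subset ?_ fun a ha => by simpa using ha.2
    exact (isClosed_le continuous_const continuous_norm).inter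
      (isClosed_le continuous_norm continuous_const)
  have hA0 : ∀ a ∈ A, a ≠ 0 := by
    intro a ha
    exact norm_pos_iff.1 ((by positivity : 0 < 1 / ‖r‖).trans_le ha.1)
  obtain ⟨δ, hδ, hδA⟩ : ∃ δ : ℝ, 0 < δ ∧ ∀ p ∈ A ×ˢ A, δ ≤ ‖T p.1 p.2‖ :=
    (hAc.prod hAc).exists_forall_le' hT.norm.continuousOn
      fun p hp => norm_pos_iff.2 (h0 _ _ (hA0 _ hp.1) (hA0 _ hp.2))
  refine ⟨δ, hδ, fun a b => ?_⟩
  rcases eq_or_ne a 0 with rfl | ha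
  · simp
  rcases eq_or_ne b 0 with rfl | hb
  · simp
  obtain ⟨s, hs, hs1, hs2, -⟩ := rescale_to_shell hr one_pos ha
  obtain ⟨t, ht, ht1, ht2, -⟩ := rescale_to_shell hr one_pos hb
  have h := hδA (s • a, t • b) ⟨⟨hs2, hs1.le⟩, ⟨ht2, ht1.le⟩⟩
  simp only [hsmul, norm_smul, norm_mul] at h
  rw [norm_smul] at hs1 ht1
  have hs' := norm_pos_iff.2 hs
  have ht' := norm_pos_iff.2 ht
  have h1 : (‖s‖ * ‖a‖) * (‖t‖ * ‖b‖) ≤ 1 :=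
    mul_le_one₀ hs1.le (by positivity) ht1.le
  have h2 : δ * ((‖s‖ * ‖a‖) * (‖t‖ * ‖b‖)) ≤ δ := mul_le_of_le_one_right hδ.le h1
  have h3 : (‖s‖ * ‖t‖) * (δ * ‖a‖ * ‖b‖) ≤ (‖s‖ * ‖t‖) * ‖T a b‖ := by
    calc _ = δ * ((‖s‖ * ‖a‖) * (‖t‖ * ‖b‖)) := by ring
      _ ≤ _ := h2.trans h
  exact le_of_mul_le_mul_left h3 (by positivity)

variable {W : Type*} [NormedAddCommGroup W] [NormedSpace F W] [CompleteSpace F]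
  [FiniteDimensional F W] {B : LinearMap.BilinForm F W}

/-- The polarized moment map `(a, b) ↦ (x ↦ ⟨x a, b⟩)`. -/
noncomputable def polarMoment (B : LinearMap.BilinForm F W) (a b : W) : sp B →L[F] F :=
  ((LinearMap.toContinuousLinearMap (B.flip b)).comp
    (ContinuousLinearMap.apply F W a)).comp (sp B).subtypeL

theorem polarMoment_apply (a b : W) (x : sp B) : polarMoment B a b x = B (x.1 a) b := rfl

theorem polarMoment_self (w : W) : polarMoment B w w = moment B w := rfl

theorem polarMoment_smul (r s : F) (a b : W) :
    polarMoment B (r • a) (s • b) = (r * s) • polarMoment B a b := by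
  ext x
  simp only [polarMoment_apply, map_smul, LinearMap.smul_apply, smul_eq_mul, smul_apply]
  ring

theorem continuous_polarMoment : Continuous fun p : W × W => polarMoment B p.1 p.2 := by
  have h1 : Continuous fun b : W => LinearMap.toContinuousLinearMap (B.flip b) :=
    ((LinearMap.toContinuousLinearMap : (W →ₗ[F] F) ≃ₗ[F] (W →L[F] F)).toLinearMap ∘ₗ
      B.flip).continuous_of_finiteDimensional
  exact ((h1.comp continuous_snd).clm_comp
    ((ContinuousLinearMap.apply F W).continuous.comp continuous_fst)).clm_comp continuous_const

theorem polarMoment_ne_zero [CharZero F] (hB : B.IsAlt) (hBnd : B.Nondegenerate) {a b : W}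
    (ha : a ≠ 0) (hb : b ≠ 0) : polarMoment B a b ≠ 0 := by
  -- both functionals `⟨a, ·⟩` and `⟨b, ·⟩` are non-zero at a common vector `u`
  obtain ⟨u, hau, hbu⟩ := exists_form_ne_zero_pair hBnd ha hb
  intro h
  have h2 := congrArg (fun f : sp B →L[F] F => f (symProd hB u u)) h
  simp only [polarMoment_apply, symProd_apply, map_add, map_smul, LinearMap.add_apply,
    LinearMap.smul_apply, smul_eq_mul, zero_apply] at h2
  rw [form_swap hB u b] at h2
  have h3 : (2 : F) * (B a u * B b u) = 0 := by linear_combination -h2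
  exact mul_ne_zero two_ne_zero (mul_ne_zero hau hbu) h3

theorem moment_smul (r : F) (w : W) : moment B (r • w) = r ^ 2 • moment B w := by
  rw [← polarMoment_self, polarMoment_smul, polarMoment_self, sq]

theorem moment_zero : moment B 0 = 0 := by
  ext x
  rw [moment_apply, map_zero]
  rfl

theorem continuous_moment : Continuous (moment B) :=
  continuous_polarMoment.comp (continuous_id.prodMk continuous_id)

theorem moment_ne_zero [CharZero F] (hB : B.IsAlt) (hBnd : B.Nondegenerate) {w : W} :
    moment B w ≠ 0 ↔ w ≠ 0 := by
  refine ⟨?_, fun hw => polarMoment_ne_zero hB hBnd hw hw⟩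
  rintro h rfl
  exact h moment_zero

/-- The difference of two values of the moment map factors, as for squares of numbers. -/
theorem moment_sub_moment (hB : B.IsAlt) (v w : W) :
    moment B v - moment B w = polarMoment B (v - w) (v + w) := by
  ext x
  change B (x.1 v) v - B (x.1 w) w = B (x.1 (v - w)) (v + w)
  simp only [map_add, map_sub, LinearMap.sub_apply]
  rw [sp_symm hB x w v]
  ring

theorem exists_lower_bound_polarMoment [ProperSpace F] [CharZero F] (hB : B.IsAlt)
    (hBnd : B.Nondegenerate) :
    ∃ c : ℝ, 0 < c ∧ ∀ a b : W, c * ‖a‖ * ‖b‖ ≤ ‖polarMoment B a b‖ :=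
  have : ProperSpace W := FiniteDimensional.proper F W
  exists_lower_bound_bilinear (F := F) (V := sp B →L[F] F) continuous_polarMoment polarMoment_smul
    fun _ _ ha hb => polarMoment_ne_zero hB hBnd ha hb

theorem norm_polarMoment_le (a b : W) :
    ‖polarMoment B a b‖ ≤ ‖contForm B‖ * ‖a‖ * ‖b‖ := by
  refine ContinuousLinearMap.opNorm_le_bound _ (by positivity) fun x => ?_
  rw [polarMoment_apply]
  calc ‖B (x.1 a) b‖ ≤ ‖contForm B‖ * ‖x.1 a‖ * ‖b‖ := norm_form_le _ _
    _ ≤ ‖contForm B‖ * (‖x‖ * ‖a‖) * ‖b‖ := by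
      gcongr
      exact x.1.le_opNorm a
    _ = _ := by ring

end MomentMap

/-! ### Gauss integrals on the symplectic space -/

section DetWeight

variable {F : Type*} [NontriviallyNormedField F] [ProperSpace F]
  {W : Type*} [NormedAddCommGroup W] [NormedSpace F W] {B : LinearMap.BilinForm F W}

/-- The density `|2|^(-n/2) |det x|^(-1/2)`. -/
noncomputable def detWeight (x : sp B) : ℝ :=
  haarModule (2 : F) ^ (-(Module.finrank F W : ℝ) / 2) *
    haarModule (LinearMap.det (x.1 : W →ₗ[F] W)) ^ (-(1 / 2) : ℝ)

theorem detWeight_nonneg (x : sp B) : 0 ≤ detWeight x :=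
  mul_nonneg (Real.rpow_nonneg (haarModule_nonneg _) _) (Real.rpow_nonneg (haarModule_nonneg _) _)

theorem detWeight_sq (x : sp B) : detWeight x ^ 2 =
    (haarModule (2 : F) ^ Module.finrank F W)⁻¹ *
      (haarModule (LinearMap.det (x.1 : W →ₗ[F] W)))⁻¹ := by
  rw [detWeight, mul_pow, ← Real.rpow_natCast (_ ^ _) 2, ← Real.rpow_natCast (_ ^ _) 2,
    ← Real.rpow_mul (haarModule_nonneg _), ← Real.rpow_mul (haarModule_nonneg _),
    ← Real.rpow_natCast, ← Real.rpow_neg (haarModule_nonneg _),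
    ← Real.rpow_neg_one (haarModule (LinearMap.det _))]
  congr 2 <;> push_cast <;> ring

theorem haarModule_mul_measureReal_preimage {W : Type*} [NormedAddCommGroup W]
    [NormedSpace F W] [FiniteDimensional F W] [MeasurableSpace W] [BorelSpace W] (μ : Measure W)
    [μ.IsAddHaarMeasure] {T : W →ₗ[F] W} (hT : LinearMap.det T ≠ 0)
    {s : Set W} (hs : MeasurableSet s) :
    haarModule (LinearMap.det T) * μ.real (T ⁻¹' s) = μ.real s := by
  have h := congrArg ENNReal.toReal (measure_preimage_linearMap μ hT hs)
  rwa [ENNReal.toReal_mul, ENNReal.toReal_ofReal (haarModule_nonneg _)] at h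

end DetWeight

section ScaledLattice

open Topology Measure

variable {F : Type*} [NontriviallyNormedField F] [IsUltrametricDist F]
  {W : Type*} [NormedAddCommGroup W] [NormedSpace F W]

/-- The lattice `c⁻¹ L`. -/
def scaledLattice (L : Submodule (integerRing F) W) (c : F) : AddSubgroup W :=
  L.toAddSubgroup.comap (DistribSMul.toAddMonoidHom W c)

theorem mem_scaledLattice {L : Submodule (integerRing F) W} {c : F} {w : W} :
    w ∈ scaledLattice L c ↔ c • w ∈ L := Iff.rfl

variable {L : Submodule (integerRing F) W}

theorem isLattice_scaledLattice (hL : IsLattice L.toAddSubgroup) {c : F} (hc : c ≠ 0) :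
    IsLattice (scaledLattice L c) := by
  let e : W ≃ₜ+ W :=
    { Homeomorph.smulOfNeZero (α := W) c hc with
      map_add' := fun u v => smul_add c u v }
  exact hL.comap e

theorem exists_closedBall_subset_scaledLattice (hL : IsLattice L.toAddSubgroup) (R : ℝ) :
    ∃ ε : ℝ, 0 < ε ∧ ∀ c : F, ‖c‖ < ε → Metric.closedBall (0 : W) R ⊆ scaledLattice L c := by
  obtain ⟨δ, hδ, hδL⟩ := Metric.mem_nhds_iff.1 hL.mem_nhds
  refine ⟨δ / (|R| + 1), by positivity, fun c hc w hw => hδL ?_⟩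
  rw [mem_closedBall_zero_iff] at hw
  change c • w ∈ _
  rw [mem_ball_zero_iff, norm_smul]
  rw [lt_div_iff₀ (by positivity)] at hc
  refine lt_of_le_of_lt ?_ hc
  gcongr
  linarith [le_abs_self R]

variable {B : LinearMap.BilinForm F W}

theorem mem_dual_scaledLattice
    (hLdual : ∀ w : W, (∀ w' ∈ L, ‖B w w'‖ ≤ 1) ↔ w ∈ L) {c : F} (hc : c ≠ 0) (w : W) :
    (∀ h ∈ scaledLattice L c, ‖B w h‖ ≤ 1) ↔ c⁻¹ • w ∈ L := by
  rw [← hLdual]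
  constructor
  · intro h w' hw'
    have h1 := h (c⁻¹ • w') (by rw [mem_scaledLattice, smul_inv_smul₀ hc]; exact hw')
    rwa [map_smul, ← LinearMap.smul_apply, ← map_smul] at h1
  · intro h w' hw'
    have h1 := h (c • w') hw'
    rwa [map_smul, map_smul, LinearMap.smul_apply, smul_smul, mul_inv_cancel₀ hc, one_smul] at h1

variable [ProperSpace F] [FiniteDimensional F W] [MeasurableSpace W] [BorelSpace W]
  (μ : Measure W) [μ.IsAddHaarMeasure]

theorem measureReal_scaledLattice (hL : IsLattice L.toAddSubgroup) (hμ : μ (L : Set W) = 1) {c : F}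
    (hc : c ≠ 0) :
    haarModule c ^ Module.finrank F W * μ.real (scaledLattice L c : Set W) = 1 := by
  have hdet : LinearMap.det (c • LinearMap.id : W →ₗ[F] W) = c ^ Module.finrank F W := by
    rw [LinearMap.det_smul, LinearMap.det_id, mul_one]
  have h := haarModule_mul_measureReal_preimage μ (T := c • LinearMap.id)
    (by rw [hdet]; exact pow_ne_zero _ hc) hL.measurableSet
  rw [hdet, haarModule_pow] at h
  refine h.trans ?_
  rw [measureReal_def]
  exact (congrArg ENNReal.toReal hμ).trans ENNReal.toReal_one

variable [CharZero F]

/-- For a self-dual lattice the product of the volumes of a multiple and of its polar does not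
depend on the multiple. -/
theorem measureReal_mul_polar (hL : IsLattice L.toAddSubgroup) (hμ : μ (L : Set W) = 1)
    (hLdual : ∀ w : W, (∀ w' ∈ L, ‖B w w'‖ ≤ 1) ↔ w ∈ L) {x : sp B}
    (hx : LinearMap.det (x.1 : W →ₗ[F] W) ≠ 0) {c : F} (hc : c ≠ 0) :
    μ.real (scaledLattice L c : Set W) *
      μ.real {v | ∀ h ∈ scaledLattice L c, ‖spPolar B x v h‖ ≤ 1} = detWeight x ^ 2 := by
  have hset : {v | ∀ h ∈ scaledLattice L c, ‖spPolar B x v h‖ ≤ 1} =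
      ((2 * c⁻¹) • (x.1 : W →ₗ[F] W)) ⁻¹' (L.toAddSubgroup : Set W) := by
    ext v
    have h1 := mem_dual_scaledLattice hLdual hc ((2 : F) • x.1 v)
    simp only [map_smul, LinearMap.smul_apply, smul_smul] at h1
    rw [mul_comm c⁻¹] at h1
    exact h1
  have hdet : LinearMap.det ((2 * c⁻¹) • (x.1 : W →ₗ[F] W)) =
      (2 * c⁻¹) ^ Module.finrank F W * LinearMap.det (x.1 : W →ₗ[F] W) := LinearMap.det_smul _ _
  have h2 : (2 * c⁻¹) ^ Module.finrank F W ≠ 0 :=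
    pow_ne_zero _ (mul_ne_zero two_ne_zero (inv_ne_zero hc))
  have h3 := haarModule_mul_measureReal_preimage μ (by rw [hdet]; exact mul_ne_zero h2 hx)
    hL.measurableSet
  rw [hdet, ← hset] at h3
  have h4 : μ.real (L.toAddSubgroup : Set W) = 1 := by
    rw [measureReal_def]
    exact (congrArg ENNReal.toReal hμ).trans ENNReal.toReal_one
  have h5 := measureReal_scaledLattice μ hL hμ hc
  rw [h4, haarModule_mul, haarModule_pow, haarModule_mul, haarModule_inv] at h3
  rw [detWeight_sq]
  have p1 := haarModule_pos hc
  have p2 := haarModule_pos hx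
  have p3 := haarModule_pos (two_ne_zero (α := F))
  rw [mul_pow, inv_pow] at h3
  field_simp at h3 ⊢
  calc _ = (haarModule c ^ Module.finrank F W * μ.real (scaledLattice L c : Set W)) *
        (μ.real {v | ∀ h ∈ scaledLattice L c, ‖spPolar B x v h‖ ≤ 1} *
          haarModule (2 : F) ^ Module.finrank F W *
            haarModule (LinearMap.det (x.1 : W →ₗ[F] W)) / haarModule c ^ Module.finrank F W) := by
        field_simp
    _ = 1 := by
        rw [h5, one_mul, div_eq_one_iff_eq (by positivity)]
        linear_combination h3

variable {χ : AddChar F Circle} (hχcont : Continuous χ) (hχ : ∀ a : F, χ a = 1 ↔ ‖a‖ ≤ 1)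
  (hB : B.IsAlt) (hBnd : B.Nondegenerate) (hL : IsLattice L.toAddSubgroup)
  (hμ : μ (L : Set W) = 1) (hLdual : ∀ w : W, (∀ w' ∈ L, ‖B w w'‖ ≤ 1) ↔ w ∈ L)

include hχcont hχ hB hBnd hL hμ hLdual in
theorem norm_gauss_le {x : sp B} (hx : LinearMap.det (x.1 : W →ₗ[F] W) ≠ 0) {c : F} (hc : c ≠ 0) :
    ‖∫ w in (scaledLattice L c : Set W), ((χ (B (x.1 w) w) : Circle) : ℂ) ∂μ‖ ≤ detWeight x := by
  have h := norm_setIntegral_le hχcont hχ μ (isNondegQuadratic_sp hB hBnd hx)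
    (isLattice_scaledLattice hL hc)
  rw [measureReal_mul_polar μ hL hμ hLdual hx hc] at h
  exact (pow_le_pow_iff_left₀ (norm_nonneg _) (detWeight_nonneg x) two_ne_zero).1 h

include hχcont hχ hB hBnd hL hμ hLdual in
/-- For large lattices the bound for the absolute value of the Gauss integral is attained. -/
theorem exists_norm_gauss_eq {x : sp B} (hx : LinearMap.det (x.1 : W →ₗ[F] W) ≠ 0) :
    ∃ ε : ℝ, 0 < ε ∧ ∀ c : F, c ≠ 0 → ‖c‖ < ε →
      ‖∫ w in (scaledLattice L c : Set W), ((χ (B (x.1 w) w) : Circle) : ℂ) ∂μ‖ = detWeight x := by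
  obtain ⟨C, hC, hb⟩ := (isLattice_scaledLattice hL (one_ne_zero (α := F))).exists_bound_of_injective
    (isNondegQuadratic_sp hB hBnd hx).injective
  obtain ⟨ε₁, hε₁, h₁⟩ := exists_closedBall_subset_scaledLattice hL C
  refine ⟨min (min ε₁ 1) (1 / (‖contForm B‖ * ‖x.1‖ * C * C + 1)), by positivity,
    fun c hc hcε => ?_⟩
  have hc1 : ‖c‖ < 1 := hcε.trans_le ((min_le_left _ _).trans (min_le_right _ _))
  have h := norm_setIntegral_eq hχcont hχ μ (isNondegQuadratic_sp hB hBnd hx)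
    (isLattice_scaledLattice hL hc) ?_
  · rw [measureReal_mul_polar μ hL hμ hLdual hx hc] at h
    exact (pow_left_inj₀ (norm_nonneg _) (detWeight_nonneg x) two_ne_zero).1 h
  intro v hv
  -- The polar of the scaled lattice is `c` times the polar of `L`, hence small.
  have hv' : ‖c⁻¹ • v‖ ≤ C := by
    refine hb _ fun h hh => ?_
    have h2 := hv (c⁻¹ • h) (by
      rw [mem_scaledLattice, smul_inv_smul₀ hc]
      simpa [mem_scaledLattice] using hh)
    rw [spPolar_apply] at h2 ⊢
    rwa [map_smul, ← LinearMap.smul_apply, ← map_smul, ← map_smul] at h2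
  have hvn : ‖v‖ ≤ ‖c‖ * C := by
    rw [norm_smul, norm_inv, inv_mul_le_iff₀ (norm_pos_iff.2 hc)] at hv'
    exact hv'
  have hvC : ‖v‖ ≤ C := hvn.trans (mul_le_of_le_one_left hC.le hc1.le)
  refine ⟨h₁ c (hcε.trans_le ((min_le_left _ _).trans (min_le_left _ _)))
    (mem_closedBall_zero_iff.2 hvC), ?_⟩
  have h3 : ‖c‖ * (‖contForm B‖ * ‖x.1‖ * C * C + 1) < 1 := by
    have := hcε.trans_le (min_le_right _ _)
    rwa [lt_div_iff₀ (by positivity)] at this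
  calc ‖B (x.1 v) v‖ ≤ ‖contForm B‖ * ‖x.1 v‖ * ‖v‖ := norm_form_le _ _
    _ ≤ ‖contForm B‖ * (‖x.1‖ * C) * (‖c‖ * C) := by
      gcongr
      exact (x.1.le_opNorm v).trans (by gcongr)
    _ = ‖c‖ * (‖contForm B‖ * ‖x.1‖ * C * C) := by ring
    _ ≤ ‖c‖ * (‖contForm B‖ * ‖x.1‖ * C * C + 1) := by
      gcongr
      linarith
    _ ≤ 1 := h3.le

end ScaledLattice


/-! ### The Weil factor -/

section WeilFactor

open Topology Measure

variable {F : Type*} [NontriviallyNormedField F] [IsUltrametricDist F] [ProperSpace F]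
  {E : Type*} [NormedAddCommGroup E] [NormedSpace F E] [FiniteDimensional F E]
  [MeasurableSpace E] [BorelSpace E] {χ : AddChar F Circle} {μ : Measure E} [μ.IsAddHaarMeasure]
  {q : QuadraticForm F E}

theorem IsWeilFactor.unique {γ γ' : ℂ} (h : IsWeilFactor χ μ q γ) (h' : IsWeilFactor χ μ q γ') :
    γ = γ' := by
  obtain ⟨h1, c, hc, h2⟩ := h
  obtain ⟨h1', c', hc', h2'⟩ := h'
  obtain ⟨M, hM, -⟩ := exists_isLattice_subset F (Filter.univ_mem (f := 𝓝 (0 : E)))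
  have hI : ∫ v, (Set.indicator (M : Set E) fun _ => (1 : ℂ)) v ∂μ ≠ 0 := by
    rw [integral_indicator hM.measurableSet]
    simpa using (hM.measureReal_pos μ).ne'
  have h3 : γ * c = γ' * c' :=
    mul_right_cancel₀ hI ((h2 _ (hM.indicator_mem 1)).symm.trans (h2' _ (hM.indicator_mem 1)))
  have h4 : c = c' := by
    have h5 := congrArg norm h3
    rwa [norm_mul, norm_mul, h1, h1', one_mul, one_mul, Complex.norm_real, Complex.norm_real,
      Real.norm_of_nonneg hc.le, Real.norm_of_nonneg hc'.le] at h5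
  rw [← h4] at h3
  exact mul_right_cancel₀ (Complex.ofReal_ne_zero.2 hc.ne') h3

/-- The Weil factor is determined by its defining property, so that the choice in its definition is
immaterial. -/
theorem weilFactor_eq {γ : ℂ} (h : IsWeilFactor χ μ q γ) : weilFactor χ μ q = γ := by
  have hex : ∃ γ, IsWeilFactor χ μ q γ := ⟨γ, h⟩
  rw [weilFactor, dif_pos hex]
  exact hex.choose_spec.unique h

variable [CharZero F] {W : Type*} [NormedAddCommGroup W] [NormedSpace F W] [FiniteDimensional F W]
  [MeasurableSpace W] [BorelSpace W] {L : Submodule (integerRing F) W}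
  {B : LinearMap.BilinForm F W} (μ : Measure W) [μ.IsAddHaarMeasure]
  (hχcont : Continuous χ) (hχ : ∀ a : F, χ a = 1 ↔ ‖a‖ ≤ 1)
  (hB : B.IsAlt) (hBnd : B.Nondegenerate) (hL : IsLattice L.toAddSubgroup)
  (hμ : μ (L : Set W) = 1) (hLdual : ∀ w : W, (∀ w' ∈ L, ‖B w w'‖ ≤ 1) ↔ w ∈ L)

theorem detWeight_pos {x : sp B} (hx : LinearMap.det (x.1 : W →ₗ[F] W) ≠ 0) : 0 < detWeight x :=
  mul_pos (Real.rpow_pos_of_pos (haarModule_pos two_ne_zero) _)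
    (Real.rpow_pos_of_pos (haarModule_pos hx) _)

include hχcont hχ hB hBnd hL hμ hLdual in
/-- The Weil factor of the quadratic form of an invertible `x` is the argument of the stable value
of the Gauss integrals, whose absolute value is `detWeight x`. -/
theorem weilFactor_spec {x : sp B} (hx : LinearMap.det (x.1 : W →ₗ[F] W) ≠ 0) :
    IsWeilFactor χ μ (spQuadraticForm B x) (weilFactor χ μ (spQuadraticForm B x)) ∧
      weilFactor χ μ (spQuadraticForm B x) ^ 8 = 1 ∧
      ∃ ε : ℝ, 0 < ε ∧ ∀ c : F, c ≠ 0 → ‖c‖ < ε →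
        ∫ w in (scaledLattice L c : Set W), ((χ (B (x.1 w) w) : Circle) : ℂ) ∂μ =
          weilFactor χ μ (spQuadraticForm B x) * detWeight x := by
  have hQ := isNondegQuadratic_sp hB hBnd hx
  obtain ⟨G, ⟨R, hR⟩, hG⟩ := exists_gauss hχcont hχ μ hQ
  have hconj := conj_gauss_pow_four hχcont hχ μ hQ (q := B.compLeft (x.1 : W →ₗ[F] W))
    (fun u v => sp_symm hB x u v) (fun u => rfl) hR
  obtain ⟨ε₁, hε₁, h₁⟩ := exists_closedBall_subset_scaledLattice hL R
  obtain ⟨ε₂, hε₂, h₂⟩ := exists_norm_gauss_eq μ hχcont hχ hB hBnd hL hμ hLdual hx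
  have hstab : ∀ c : F, c ≠ 0 → ‖c‖ < ε₁ →
      ∫ w in (scaledLattice L c : Set W), ((χ (B (x.1 w) w) : Circle) : ℂ) ∂μ = G :=
    fun c hc hcε => hR _ (isLattice_scaledLattice hL hc) (h₁ c hcε)
  obtain ⟨c, hc0, hc⟩ := NormedField.exists_norm_lt F (lt_min hε₁ hε₂)
  have hc0' := norm_pos_iff.1 hc0
  have hnorm : ‖G‖ = detWeight x := by
    rw [← hstab c hc0' (hc.trans_le (min_le_left _ _))]
    exact h₂ c hc0' (hc.trans_le (min_le_right _ _))
  have hpos := detWeight_pos hx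
  have hposC : (detWeight x : ℂ) ≠ 0 := Complex.ofReal_ne_zero.2 hpos.ne'
  have hγn : ‖G / detWeight x‖ = 1 := by
    rw [norm_div, hnorm, Complex.norm_real, Real.norm_of_nonneg hpos.le, div_self hpos.ne']
  have hγ : IsWeilFactor χ μ (spQuadraticForm B x) (G / detWeight x) := by
    refine ⟨hγn, detWeight x, hpos, fun Φ hΦ => ?_⟩
    rw [div_mul_cancel₀ _ hposC, ← hG Φ hΦ]
    rfl
  rw [weilFactor_eq hγ]
  refine ⟨hγ, ?_, ε₁, hε₁, fun c hc hcε => ?_⟩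
  · have h1 : (starRingEnd ℂ) ((G / detWeight x) ^ 4) = (G / detWeight x) ^ 4 := by
      rw [div_pow, map_div₀, hconj, map_pow, Complex.conj_ofReal]
    have h2 := Complex.mul_conj' ((G / detWeight x) ^ 4)
    rw [h1, norm_pow, hγn] at h2
    calc (G / detWeight x) ^ 8 = (G / detWeight x) ^ 4 * (G / detWeight x) ^ 4 := by ring
      _ = 1 := by rw [h2]; simp
  · rw [hstab c hc hcε, div_mul_cancel₀ _ hposC]

end WeilFactor

/-! ### The distribution `chc` -/

section Chc

open Topology Measure

variable {F : Type*} [NontriviallyNormedField F] [IsUltrametricDist F] [ProperSpace F] [CharZero F]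
  {W : Type*} [NormedAddCommGroup W] [NormedSpace F W] [FiniteDimensional F W]
  {χ : AddChar F Circle} {B : LinearMap.BilinForm F W}

theorem exists_norm_le_of_norm_moment_le (hB : B.IsAlt) (hBnd : B.Nondegenerate) (C : ℝ) :
    ∃ R : ℝ, ∀ w, ‖moment B w‖ ≤ C → ‖w‖ ≤ R := by
  obtain ⟨c, hc, h⟩ := exists_lower_bound_polarMoment hB hBnd
  refine ⟨Real.sqrt (C / c), fun w hw => Real.le_sqrt_of_sq_le ?_⟩
  rw [le_div_iff₀ hc]
  have h1 := h w w
  rw [polarMoment_self] at h1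
  nlinarith

theorem isCompact_preimage_moment (hB : B.IsAlt) (hBnd : B.Nondegenerate)
    {K : Set (sp B →L[F] F)} (hK : IsCompact K) : IsCompact (moment B ⁻¹' K) := by
  have : ProperSpace W := FiniteDimensional.proper F W
  obtain ⟨C, hC⟩ := (IsCompact.isBounded (α := sp B →L[F] F) hK).exists_norm_le
  obtain ⟨R, hR⟩ := exists_norm_le_of_norm_moment_le hB hBnd C
  refine (isCompact_closedBall (0 : W) R).of_isClosed_subset
    (hK.isClosed.preimage continuous_moment) fun w hw => ?_
  exact mem_closedBall_zero_iff.2 (hR w (hC _ hw))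

variable [MeasurableSpace W] [BorelSpace W] (μ : Measure W) [μ.IsAddHaarMeasure]
  (ν : Measure (sp B)) [ν.IsAddHaarMeasure]
  (hχcont : Continuous χ) (hχ : ∀ a : F, χ a = 1 ↔ ‖a‖ ≤ 1)
  (hB : B.IsAlt) (hBnd : B.Nondegenerate)

include hχ in
theorem integrable_inner {ψ : sp B → ℂ} (hψ : ψ ∈ SchwartzBruhat (sp B)) (ξ : sp B →L[F] F) :
    Integrable (fun x : sp B => ((χ (ξ x) : Circle) : ℂ) * ψ x) ν := by
  simp_rw [mul_comm _ (ψ _)]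
  exact SchwartzBruhat.integrable (SchwartzBruhat.mul_addChar hχ hψ ξ.continuous)

include hχcont hχ hB hBnd in
theorem continuous_hasCompactSupport_outer {ψ : sp B → ℂ} (hψ : ψ ∈ SchwartzBruhat (sp B)) :
    Continuous (fun w : W => ∫ x : sp B, ((χ (B (x.1 w) w) : Circle) : ℂ) * ψ x ∂ν) ∧
      HasCompactSupport fun w : W => ∫ x : sp B, ((χ (B (x.1 w) w) : Circle) : ℂ) * ψ x ∂ν := by
  have h1 := continuous_fourier hχcont (μ := ν) hψ
  have h2 := hasCompactSupport_fourier hχ (μ := ν) hψ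
  refine ⟨h1.comp continuous_moment, ?_⟩
  refine HasCompactSupport.intro (isCompact_preimage_moment hB hBnd h2.isCompact) fun w hw => ?_
  exact image_eq_zero_of_notMem_tsupport (f := fun ξ : sp B →L[F] F =>
    ∫ x, ((χ (ξ x) : Circle) : ℂ) * ψ x ∂ν) hw

include hχcont hχ hB hBnd in
theorem integrable_outer {ψ : sp B → ℂ} (hψ : ψ ∈ SchwartzBruhat (sp B)) :
    Integrable (fun w : W => ∫ x : sp B, ((χ (B (x.1 w) w) : Circle) : ℂ) * ψ x ∂ν) μ :=
  have h := continuous_hasCompactSupport_outer ν hχcont hχ hB hBnd hψ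
  h.1.integrable_of_hasCompactSupport h.2

/-- The distribution `chc`: the integral over `W` of the Fourier transform along the moment map. -/
noncomputable def chcDistribution : Distribution (sp B) where
  toFun ψ := ∫ w : W, (∫ x : sp B, ((χ (B (x.1 w) w) : Circle) : ℂ) * (ψ : sp B → ℂ) x ∂ν) ∂μ
  map_add' φ ψ := by
    have h := fun (φ : SchwartzBruhat (sp B)) => integrable_outer μ ν hχcont hχ hB hBnd φ.2
    rw [← integral_add (h φ) (h ψ)]
    congr 1
    ext w
    refine Eq.trans ?_ (integral_add (integrable_inner ν hχ φ.2 (moment B w))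
      (integrable_inner ν hχ ψ.2 (moment B w)))
    congr 1
    ext x
    exact mul_add _ _ _
  map_smul' r ψ := by
    simp only [RingHom.id_apply, smul_eq_mul]
    rw [← integral_const_mul]
    congr 1
    ext w
    rw [← integral_const_mul]
    congr 1
    ext x
    exact mul_left_comm _ _ _

variable {L : Submodule (integerRing F) W} (hL : IsLattice L.toAddSubgroup)
  (hμ : μ (L : Set W) = 1) (hLdual : ∀ w : W, (∀ w' ∈ L, ‖B w w'‖ ≤ 1) ↔ w ∈ L)

theorem continuous_det_sp : Continuous fun x : sp B => LinearMap.det (x.1 : W →ₗ[F] W) :=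
  ContinuousLinearMap.continuous_det.comp continuous_subtype_val

theorem detWeight_eq_toReal (x : sp B) :
    detWeight x = haarModule (2 : F) ^ (-(Module.finrank F W : ℝ) / 2) *
      (invSqrtModule (LinearMap.det (x.1 : W →ₗ[F] W))).toReal := by
  rw [detWeight, invSqrtModule, ← ENNReal.toReal_rpow, ENNReal.toReal_ofReal (haarModule_nonneg _)]

theorem measurable_invSqrtModule_det :
    Measurable fun x : sp B => invSqrtModule (LinearMap.det (x.1 : W →ₗ[F] W)) := by
  let _ : MeasurableSpace F := borel F
  have : BorelSpace F := ⟨rfl⟩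
  exact measurable_invSqrtModule.comp continuous_det_sp.measurable

include hB hBnd in
theorem integrableOn_detWeight {K : Set (sp B)} (hK : IsCompact K) :
    IntegrableOn (fun x : sp B => detWeight x) K ν := by
  simp_rw [detWeight_eq_toReal]
  exact (integrable_toReal_of_lintegral_ne_top measurable_invSqrtModule_det.aemeasurable
    (lintegral_invSqrtModule_det_lt_top hB hBnd ν hK).ne).const_mul _

include hB hBnd in
/-- The determinant vanishes on a null set only, as `|0|^(-1/2)` is infinite in the integral. -/
theorem ae_det_ne_zero {K : Set (sp B)} (hK : IsCompact K) :
    ∀ᵐ x ∂ν, x ∈ K → LinearMap.det (x.1 : W →ₗ[F] W) ≠ 0 := by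
  have h := ae_lt_top measurable_invSqrtModule_det
    (lintegral_invSqrtModule_det_lt_top hB hBnd ν hK).ne
  filter_upwards [(ae_restrict_iff' hK.measurableSet).1 h] with x hx hxK h0
  have h1 := hx hxK
  rw [h0, invSqrtModule, haarModule_zero, ENNReal.ofReal_zero,
    ENNReal.zero_rpow_of_neg (by norm_num)] at h1
  exact lt_irrefl _ h1

include hχcont hχ hB hBnd hL hμ hLdual in
/-- The distribution `chc` is a locally integrable function. Over the lattice `ϖ⁻ᵏ L` the two
integrals may be exchanged; the inner integral is then a Gauss integral, which is bounded by
`detWeight x` and eventually constant in `k`. -/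
theorem chc_eq_integral {ψ : sp B → ℂ} (hψ : ψ ∈ SchwartzBruhat (sp B)) :
    Integrable (fun x : sp B => weilFactor χ μ (spQuadraticForm B x) * (detWeight x : ℂ) * ψ x) ν ∧
    ∫ w : W, (∫ x : sp B, ((χ (B (x.1 w) w) : Circle) : ℂ) * ψ x ∂ν) ∂μ =
      ∫ x : sp B, weilFactor χ μ (spQuadraticForm B x) * (detWeight x : ℂ) * ψ x ∂ν := by
  have : ProperSpace W := FiniteDimensional.proper F W
  have : ProperSpace (sp B) := FiniteDimensional.proper F _
  obtain ⟨ϖ, hϖ0, hϖ1⟩ := NormedField.exists_norm_lt_one F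
  have hϖ : ∀ k : ℕ, ϖ ^ k ≠ 0 := fun k => pow_ne_zero k (norm_pos_iff.1 hϖ0)
  have hsmall : ∀ ε : ℝ, 0 < ε → ∀ᶠ k : ℕ in Filter.atTop, ‖ϖ ^ k‖ < ε := by
    intro ε hε
    have h := tendsto_pow_atTop_nhds_zero_of_lt_one hϖ0.le hϖ1
    simp_rw [norm_pow]
    exact h.eventually_lt_const hε
  set K := tsupport ψ with hK
  have hKc : IsCompact K := hψ.2.isCompact
  have hψ0 : ∀ x, x ∉ K → ψ x = 0 := fun x hx => image_eq_zero_of_notMem_tsupport hx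
  set g : ℕ → sp B → ℂ := fun k x =>
    ∫ w in (scaledLattice L (ϖ ^ k) : Set W), ((χ (B (x.1 w) w) : Circle) : ℂ) ∂μ with hg
  set f : W → ℂ := fun w => ∫ x : sp B, ((χ (B (x.1 w) w) : Circle) : ℂ) * ψ x ∂ν with hf
  have hcont : Continuous fun p : W × sp B => ((χ (B (p.2.1 p.1) p.1) : Circle) : ℂ) := by
    refine (continuous_coe_addChar hχcont).comp (continuous_form ?_ continuous_fst)
    exact (continuous_subtype_val.comp continuous_snd).clm_apply continuous_fst
  have hint : ∀ k, Integrable (Function.uncurry fun (w : W) (x : sp B) =>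
      ((χ (B (x.1 w) w) : Circle) : ℂ) * ψ x)
      ((μ.restrict (scaledLattice L (ϖ ^ k) : Set W)).prod ν) := by
    intro k
    have hLk := isLattice_scaledLattice hL (hϖ k)
    have hfin : IsFiniteMeasure (μ.restrict (scaledLattice L (ϖ ^ k) : Set W)) :=
      ⟨by rw [Measure.restrict_apply_univ]; exact hLk.isCompact.measure_lt_top⟩
    have h3 : Integrable (fun z : W × sp B => (1 : ℂ) * ψ z.2)
        ((μ.restrict (scaledLattice L (ϖ ^ k) : Set W)).prod ν) :=
      Integrable.mul_prod (integrable_const _) (SchwartzBruhat.integrable hψ)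
    refine h3.mono (Continuous.aestronglyMeasurable ?_) (Filter.Eventually.of_forall fun z => ?_)
    · exact hcont.mul ((SchwartzBruhat.continuous hψ).comp continuous_snd)
    · simp only [Function.uncurry, norm_mul, Circle.norm_coe, one_mul, le_refl]
  have hinner : ∀ k x, ∫ w in (scaledLattice L (ϖ ^ k) : Set W),
      ((χ (B (x.1 w) w) : Circle) : ℂ) * ψ x ∂μ = g k x * ψ x := fun k x =>
    integral_mul_const _ _
  have hswap : ∀ k, ∫ w in (scaledLattice L (ϖ ^ k) : Set W), f w ∂μ = ∫ x, g k x * ψ x ∂ν := by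
    intro k
    rw [hf, integral_integral_swap (hint k)]
    simp_rw [hinner]
  have hmeas : ∀ k, AEStronglyMeasurable (fun x => g k x * ψ x) ν := by
    intro k
    have h := (hint k).integral_prod_right.aestronglyMeasurable
    simp only [Function.uncurry_apply_pair, hinner] at h
    exact h
  have hf_supp : ∀ᶠ k in Filter.atTop, ∫ w in (scaledLattice L (ϖ ^ k) : Set W), f w ∂μ =
      ∫ w, f w ∂μ := by
    obtain ⟨-, hfs⟩ := continuous_hasCompactSupport_outer (χ := χ) ν hχcont hχ hB hBnd hψ
    obtain ⟨R, hR⟩ := hfs.isCompact.isBounded.subset_closedBall 0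
    obtain ⟨ε, hε, hsub⟩ := exists_closedBall_subset_scaledLattice hL R
    filter_upwards [hsmall ε hε] with k hk
    refine setIntegral_eq_integral_of_forall_compl_eq_zero fun w hw => ?_
    exact image_eq_zero_of_notMem_tsupport fun h => hw (hsub _ hk (hR h))
  have hdet : ∀ᵐ x ∂ν, x ∈ K → LinearMap.det (x.1 : W →ₗ[F] W) ≠ 0 :=
    ae_det_ne_zero ν hB hBnd hKc
  have hlim : ∀ᵐ x ∂ν, Filter.Tendsto (fun k => g k x * ψ x) Filter.atTop
      (𝓝 (weilFactor χ μ (spQuadraticForm B x) * (detWeight x : ℂ) * ψ x)) := by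
    filter_upwards [hdet] with x hx
    by_cases hxK : x ∈ K
    · obtain ⟨-, -, ε, hε, h⟩ := weilFactor_spec μ hχcont hχ hB hBnd hL hμ hLdual (hx hxK)
      refine tendsto_const_nhds.congr' ?_
      filter_upwards [hsmall ε hε] with k hk
      rw [hg]
      simp only []
      rw [h _ (hϖ k) hk]
    · simp [hψ0 x hxK]
  obtain ⟨C, hC⟩ := hψ.2.exists_bound_of_continuous (SchwartzBruhat.continuous hψ)
  have hbound_int : Integrable (fun x => K.indicator (fun x => detWeight x) x * C) ν :=
    ((integrable_indicator_iff hKc.measurableSet).2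
      (integrableOn_detWeight ν hB hBnd hKc)).mul_const C
  have hbound : ∀ k, ∀ᵐ x ∂ν, ‖g k x * ψ x‖ ≤ K.indicator (fun x => detWeight x) x * C := by
    intro k
    filter_upwards [hdet] with x hx
    by_cases hxK : x ∈ K
    · rw [norm_mul, Set.indicator_of_mem hxK]
      exact mul_le_mul (norm_gauss_le μ hχcont hχ hB hBnd hL hμ hLdual (hx hxK) (hϖ k)) (hC x)
        (norm_nonneg _) (detWeight_nonneg x)
    · rw [hψ0 x hxK, Set.indicator_of_notMem hxK]
      simp
  have htend := tendsto_integral_of_dominated_convergence _ hmeas hbound_int hbound hlim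
  refine ⟨?_, ?_⟩
  · refine hbound_int.mono' (aestronglyMeasurable_of_tendsto_ae _ hmeas hlim) ?_
    filter_upwards [hlim, ae_all_iff.2 hbound] with x h1 h2
    exact le_of_tendsto h1.norm (Filter.Eventually.of_forall h2)
  · refine tendsto_nhds_unique ?_ htend
    refine tendsto_const_nhds.congr' ?_
    filter_upwards [hf_supp] with k hk
    rw [← hswap k, hk]

end Chc


/-! ### Coadjoint orbits -/

section Orbits

variable {F : Type*} [NontriviallyNormedField F] [CompleteSpace F]
  {W : Type*} [NormedAddCommGroup W] [NormedSpace F W] [FiniteDimensional F W]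
  {B : LinearMap.BilinForm F W}

/-- The symplectic transvection `w ↦ w + r ⟨a, w⟩ a`. -/
noncomputable def spTransvection (hB : B.IsAlt) (r : F) (a : W) : Sp B :=
  ⟨(LinearEquiv.transvection (f := r • B a) (v := a)
      (by simp [hB.self_eq_zero a])).toContinuousLinearEquiv, fun u v => by
    change B (u + (r • B a) u • a) (v + (r • B a) v • a) = B u v
    simp only [map_add, map_smul, LinearMap.add_apply, LinearMap.smul_apply, smul_eq_mul,
      hB.self_eq_zero a]
    rw [form_swap hB u a]
    ring⟩

theorem spTransvection_apply (hB : B.IsAlt) (r : F) (a w : W) :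
    (spTransvection hB r a).1 w = w + (r * B a w) • a := rfl

/-- The symplectic group acts transitively on the non-zero vectors. -/
theorem exists_sp_apply_eq (hB : B.IsAlt) (hBnd : B.Nondegenerate) {u v : W} (hu : u ≠ 0)
    (hv : v ≠ 0) : ∃ g : Sp B, g.1 u = v := by
  have key : ∀ u v : W, B v u ≠ 0 → ∃ g : Sp B, g.1 u = v := by
    intro u v h
    refine ⟨spTransvection hB (B v u)⁻¹ (v - u), ?_⟩
    rw [spTransvection_apply, map_sub, LinearMap.sub_apply, hB.self_eq_zero u, sub_zero,
      inv_mul_cancel₀ h, one_smul, add_sub_cancel]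
  obtain ⟨z, hz, hz'⟩ := exists_form_ne_zero_pair hBnd hu hv
  obtain ⟨g, hg⟩ := key u z (by rw [form_swap hB]; exact neg_ne_zero.2 hz)
  obtain ⟨h, hh⟩ := key z v hz'
  refine ⟨h * g, ?_⟩
  change h.1 (g.1 u) = v
  rw [hg, hh]

theorem coadjoint_moment (g : Sp B) (w : W) : coadjoint B g (moment B w) = moment B (g.1 w) := by
  ext x
  have hg : ∀ u v, B (g.1 u) (g.1 v) = B u v := g.2
  have hi : ∀ w, g.1 (g⁻¹.1 w) = w := fun w => g.1.apply_symm_apply w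
  have h1 : coadjoint B g (moment B w) x = B (g⁻¹.1 (x.1 ((g⁻¹)⁻¹.1 w))) w := rfl
  rw [h1, inv_inv, moment_apply, ← hg, hi]

theorem coadjointOrbit_moment (hB : B.IsAlt) (hBnd : B.Nondegenerate) {w : W} (hw : w ≠ 0) :
    coadjointOrbit B (moment B w) = moment B '' {0}ᶜ := by
  ext ξ
  constructor
  · rintro ⟨g, rfl⟩
    refine ⟨g.1 w, ?_, (coadjoint_moment g w).symm⟩
    simpa using hw
  · rintro ⟨v, hv, rfl⟩
    obtain ⟨g, rfl⟩ := exists_sp_apply_eq hB hBnd hw hv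
    exact ⟨g, coadjoint_moment g w⟩

theorem mem_coadjointOrbit_self (ξ : sp B →L[F] F) : ξ ∈ coadjointOrbit B ξ := by
  refine ⟨1, ?_⟩
  ext x
  have h : adjoint B (1 : Sp B)⁻¹ x = x := by
    ext w
    rw [inv_one]
    have h1 : (adjoint B (1 : Sp B) x).1 w = (1 : Sp B).1 (x.1 ((1 : Sp B)⁻¹.1 w)) := rfl
    rw [h1, inv_one]
    rfl
  change ξ (adjoint B (1 : Sp B)⁻¹ x) = ξ x
  rw [h]

theorem trace_symProd_comp (hB : B.IsAlt) (a b : W) (y : sp B) :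
    LinearMap.trace F W (((symProd hB a b).1.comp y.1 : W →L[F] W) : W →ₗ[F] W) =
      2 * B (y.1 a) b := by
  have h1 : (((symProd hB a b).1.comp y.1 : W →L[F] W) : W →ₗ[F] W) =
      ((B.flip a) ∘ₗ (y.1 : W →ₗ[F] W)).smulRight b +
        ((B.flip b) ∘ₗ (y.1 : W →ₗ[F] W)).smulRight a := by
    ext w
    rfl
  rw [h1, map_add, LinearMap.trace_smulRight, LinearMap.trace_smulRight]
  change B (y.1 b) a + B (y.1 a) b = 2 * B (y.1 a) b
  rw [sp_symm hB y b a]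
  ring

theorem isNilpotentFunctional_moment [CharZero F] (hB : B.IsAlt) (w : W) :
    IsNilpotentFunctional B (moment B w) := by
  have hy : ∀ v, ((2⁻¹ : F) • symProd hB w w).1 v = B v w • w := by
    intro v
    change (2⁻¹ : F) • (B v w • w + B v w • w) = _
    rw [← two_smul F, inv_smul_smul₀ two_ne_zero]
  refine ⟨(2⁻¹ : F) • symProd hB w w, ⟨2, ?_⟩, fun x => ?_⟩
  · ext v
    rw [sq]
    change ((2⁻¹ : F) • symProd hB w w).1 (((2⁻¹ : F) • symProd hB w w).1 v) = 0
    rw [hy, hy, map_smul, LinearMap.smul_apply, hB.self_eq_zero w, smul_zero, zero_smul]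
  · have h1 := trace_symProd_comp hB w w x
    have h2 : ((x.1.comp ((2⁻¹ : F) • symProd hB w w).1 : W →L[F] W) : W →ₗ[F] W) =
        (2⁻¹ : F) • ((x.1 : W →ₗ[F] W) ∘ₗ ((symProd hB w w).1 : W →ₗ[F] W)) := by
      ext v
      exact map_smul x.1 _ _
    rw [h2, map_smul, LinearMap.trace_comp_comm']
    have h3 : ((symProd hB w w).1 : W →ₗ[F] W) ∘ₗ (x.1 : W →ₗ[F] W) =
      (((symProd hB w w).1.comp x.1 : W →L[F] W) : W →ₗ[F] W) := rfl
    rw [h3, h1, moment_apply, smul_eq_mul, inv_mul_cancel_left₀ two_ne_zero]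

theorem spBracket_symProd (hB : B.IsAlt) (x : sp B) (a : W) :
    spBracket B x (symProd hB a a) = (2 : F) • symProd hB a (x.1 a) := by
  ext w
  change x.1 (B w a • a + B w a • a) - (B (x.1 w) a • a + B (x.1 w) a • a) =
    (2 : F) • (B w a • x.1 a + B w (x.1 a) • a)
  rw [sp_apply_left x w a, map_add, map_smul]
  module

/-- If `u` and `y u` are independent, no non-zero element `symProd u v` stabilizes the
functional `x ↦ tr (x y)`. -/
theorem eq_zero_of_symProd_mem_stabilizer [CharZero F] (hB : B.IsAlt) (hBnd : B.Nondegenerate)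
    {η : sp B →L[F] F} {y : sp B}
    (hη : ∀ x : sp B, η x = LinearMap.trace F W ((x.1.comp y.1 : W →L[F] W) : W →ₗ[F] W))
    {u : W} (hu : ∀ r : F, y.1 u ≠ r • u) {v : W}
    (hv : symProd hB u v ∈ stabilizerAlgebra B η) : v = 0 := by
  have hyu : y.1 u ≠ 0 := by simpa using hu 0
  have hu0 : u ≠ 0 := by
    rintro rfl
    exact hyu (map_zero _)
  have hstab : ∀ a, B a u * B a (y.1 v) + B a v * B a (y.1 u) = 0 := by
    intro a
    have h1 : η (spBracket B (symProd hB u v) (symProd hB a a)) = 0 := hv _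
    rw [spBracket_symProd, map_smul, hη, trace_symProd_comp, symProd_apply] at h1
    simp only [map_add, map_smul, smul_eq_mul] at h1
    rw [sp_apply_left y a v, sp_apply_left y a u] at h1
    have h2 : (2 : F) * 2 ≠ 0 := mul_ne_zero two_ne_zero two_ne_zero
    have h3 : (2 : F) * 2 * (B a u * B a (y.1 v) + B a v * B a (y.1 u)) = 0 := by
      linear_combination -h1
    exact (mul_eq_zero.1 h3).resolve_left h2
  -- a functional vanishing on the kernel of `⟨·, u⟩` is a multiple of it
  have hker : ∀ z : W, (∀ a, B a u = 0 → B a z = 0) → ∃ r : F, z = r • u := by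
    intro z hz
    obtain ⟨e, he⟩ := exists_form_ne_zero hBnd hu0
    have he' : B e u ≠ 0 := by
      rw [form_swap hB]
      exact neg_ne_zero.2 he
    refine ⟨B e z / B e u, ?_⟩
    rw [← sub_eq_zero]
    refine eq_zero_of_form_eq_zero hBnd fun a => ?_
    rw [form_swap hB, neg_eq_zero]
    have h1 := hz (a - (B a u / B e u) • e) (by
      rw [map_sub, map_smul, LinearMap.sub_apply, LinearMap.smul_apply, smul_eq_mul,
        div_mul_cancel₀ _ he', sub_self])
    rw [map_sub, map_smul, LinearMap.sub_apply, LinearMap.smul_apply, smul_eq_mul] at h1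
    rw [map_sub, map_smul, smul_eq_mul]
    linear_combination h1
  obtain ⟨a₀, ha₀, ha₀'⟩ : ∃ a, B a u = 0 ∧ B a (y.1 u) ≠ 0 := by
    by_contra h
    push Not at h
    obtain ⟨r, hr⟩ := hker (y.1 u) h
    exact hu r hr
  have hprod : ∀ a, B a u = 0 → B a (y.1 u) ≠ 0 → B a v = 0 := by
    intro a h1 h2
    have h3 := hstab a
    rw [h1, zero_mul, zero_add] at h3
    exact (mul_eq_zero.1 h3).resolve_right h2
  obtain ⟨r, rfl⟩ := hker v fun a ha => by
    by_cases h1 : B a (y.1 u) = 0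
    · have h2 := hprod (a + a₀) (by rw [map_add, LinearMap.add_apply, ha, ha₀, add_zero])
        (by rwa [map_add, LinearMap.add_apply, h1, zero_add])
      rwa [map_add, LinearMap.add_apply, hprod a₀ ha₀ ha₀', add_zero] at h2
    · exact hprod a ha h1
  obtain ⟨a, h1, h2⟩ := exists_form_ne_zero_pair hBnd hu0 hyu
  have h3 := hstab a
  rw [map_smul, map_smul, map_smul, smul_eq_mul, smul_eq_mul] at h3
  rw [form_swap hB] at h1 h2
  have h4 : (2 * (B a u * B a (y.1 u))) * r = 0 := by linear_combination h3
  have h5 : 2 * (B a u * B a (y.1 u)) ≠ 0 :=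
    mul_ne_zero two_ne_zero (mul_ne_zero (neg_ne_zero.1 h1) (neg_ne_zero.1 h2))
  rw [(mul_eq_zero.1 h4).resolve_left h5, zero_smul]

/-- The elements `symProd u v`, for a fixed `u` independent of `y u`, meet the stabilizer trivially.
-/
theorem finrank_le_orbitDim [CharZero F] (hB : B.IsAlt) (hBnd : B.Nondegenerate)
    {η : sp B →L[F] F} (hη0 : η ≠ 0) (hη : IsNilpotentFunctional B η) :
    Module.finrank F W ≤ orbitDim B η := by
  obtain ⟨y, ⟨n, hn⟩, htr⟩ := hη
  obtain ⟨u, hu⟩ : ∃ u, y.1 u ≠ 0 := by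
    by_contra h
    push Not at h
    apply hη0
    ext x
    have h1 : ((x.1.comp y.1 : W →L[F] W) : W →ₗ[F] W) = 0 := by
      ext w
      change x.1 (y.1 w) = 0
      rw [h, map_zero]
    rw [htr, h1, map_zero]
    rfl
  -- `y u = r u` would make `r` nilpotent
  have hind : ∀ r : F, y.1 u ≠ r • u := by
    intro r hr
    have h1 : ∀ k : ℕ, (y.1 ^ k) u = r ^ k • u := by
      intro k
      induction k with
      | zero => simp
      | succ k ih =>
        rw [pow_succ]
        change (y.1 ^ k) (y.1 u) = _
        rw [hr, map_smul, ih, smul_smul, pow_succ']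
    have h2 := h1 n
    rw [hn] at h2
    rcases smul_eq_zero.1 h2.symm with h3 | h3
    · rw [eq_zero_of_pow_eq_zero h3, zero_smul] at hr
      exact hu hr
    · rw [h3, map_zero] at hu
      exact hu rfl
  let S : W →ₗ[F] sp B :=
    { toFun := fun v => symProd hB u v
      map_add' := fun v w => by
        ext a
        change B a u • (v + w) + B a (v + w) • u = (B a u • v + B a v • u) + (B a u • w + B a w • u)
        rw [map_add]
        module
      map_smul' := fun r v => by
        ext a
        change B a u • (r • v) + B a (r • v) • u = r • (B a u • v + B a v • u)
        rw [map_smul, smul_eq_mul]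
        module }
  have hS : ∀ v, S v ∈ stabilizerAlgebra B η → v = 0 := fun v hv =>
    eq_zero_of_symProd_mem_stabilizer hB hBnd htr hind hv
  have hinj : Function.Injective S := by
    rw [← LinearMap.ker_eq_bot, LinearMap.ker_eq_bot']
    intro v hv
    exact hS v (by rw [hv]; exact Submodule.zero_mem _)
  have hdisj : Disjoint (stabilizerAlgebra B η) (LinearMap.range S) := by
    rw [Submodule.disjoint_def]
    rintro _ h1 ⟨v, rfl⟩
    rw [hS v h1, map_zero]
  have h1 := Submodule.finrank_add_finrank_le_of_disjoint hdisj
  rw [LinearMap.finrank_range_of_inj hinj] at h1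
  rw [orbitDim]
  omega

/-- The elements that annihilate `w` stabilize `moment B w`. -/
theorem orbitDim_moment_le (w : W) : orbitDim B (moment B w) ≤ Module.finrank F W := by
  let ev : sp B →ₗ[F] W :=
    ((ContinuousLinearMap.apply F W w : (W →L[F] W) →L[F] W) : (W →L[F] W) →ₗ[F] W) ∘ₗ
      (sp B).subtype
  have h1 := LinearMap.finrank_range_add_finrank_ker ev
  have h2 : Module.finrank F (LinearMap.range ev) ≤ Module.finrank F W := Submodule.finrank_le _
  have h3 : LinearMap.ker ev ≤ stabilizerAlgebra B (moment B w) := by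
    intro x hx z
    have hx' : x.1 w = 0 := hx
    change B (x.1 (z.1 w) - z.1 (x.1 w)) w = 0
    rw [hx', map_zero, sub_zero, sp_apply_left, hx', map_zero, neg_zero]
  have h4 := Submodule.finrank_mono h3
  rw [orbitDim]
  omega

variable [ProperSpace F] [CharZero F]

theorem isClosed_range_moment [IsUltrametricDist F] (hB : B.IsAlt) (hBnd : B.Nondegenerate) :
    IsClosed (Set.range (moment B)) := by
  have : ProperSpace (sp B →L[F] F) := FiniteDimensional.proper F (sp B →L[F] F)
  have h : IsProperMap (moment B) := isProperMap_iff_isCompact_preimage.2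
    ⟨continuous_moment, fun K hK => isCompact_preimage_moment hB hBnd hK⟩
  exact h.isClosedMap.isClosed_range

theorem isMinimalNilpotentOrbit_moment [IsUltrametricDist F] [Nontrivial W] (hB : B.IsAlt)
    (hBnd : B.Nondegenerate) : IsMinimalNilpotentOrbit B (moment B '' {0}ᶜ) := by
  obtain ⟨w, hw⟩ := exists_ne (0 : W)
  refine ⟨moment B w, (moment_ne_zero hB hBnd).2 hw, isNilpotentFunctional_moment hB w,
    (coadjointOrbit_moment hB hBnd hw).symm, fun η hη0 hη => ⟨?_, fun hsub => ?_⟩⟩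
  · exact (orbitDim_moment_le w).trans (finrank_le_orbitDim hB hBnd hη0 hη)
  · have h1 : closure (moment B '' {0}ᶜ) ⊆ Set.range (moment B) :=
      closure_minimal (Set.image_subset_range _ _) (isClosed_range_moment hB hBnd)
    obtain ⟨v, rfl⟩ := h1 (hsub (mem_coadjointOrbit_self η))
    exact coadjointOrbit_moment hB hBnd ((moment_ne_zero hB hBnd).1 hη0)

end Orbits

/-! ### The invariant measure on the orbit -/

section OrbitMeasure

open Measure

variable {F : Type*} [NontriviallyNormedField F] [ProperSpace F]
  {W : Type*} [NormedAddCommGroup W] [NormedSpace F W] [FiniteDimensional F W]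
  [MeasurableSpace W] [BorelSpace W]
  {B : LinearMap.BilinForm F W}

theorem det_sp_sq (hBnd : B.Nondegenerate) (g : Sp B) :
    LinearMap.det ((g : W ≃L[F] W) : W →ₗ[F] W) ^ 2 = 1 := by
  set b := Module.finBasis F W
  set T : W →ₗ[F] W := ((g : W ≃L[F] W) : W →ₗ[F] W) with hT
  have h1 : B.comp T T = B := by
    ext u v
    exact g.2 u v
  have h2 := LinearMap.BilinForm.toMatrix_comp b b B T T
  rw [h1] at h2
  have h3 := congrArg Matrix.det h2
  rw [Matrix.det_mul, Matrix.det_mul, Matrix.det_transpose, LinearMap.det_toMatrix] at h3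
  have h4 : (LinearMap.BilinForm.toMatrix b B).det ≠ 0 :=
    (LinearMap.BilinForm.nondegenerate_iff_det_ne_zero b).1 hBnd
  have h5 : (LinearMap.BilinForm.toMatrix b B).det * (LinearMap.det T ^ 2 - 1) = 0 := by
    linear_combination -h3
  exact sub_eq_zero.1 ((mul_eq_zero.1 h5).resolve_left h4)

/-- Symplectic transformations preserve Haar measures, since their determinants have square one. -/
theorem map_sp_eq (hBnd : B.Nondegenerate) (μ : Measure W) [μ.IsAddHaarMeasure] (g : Sp B) :
    μ.map (g : W ≃L[F] W) = μ := by
  have h1 := det_sp_sq hBnd g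
  have h2 : haarModule (LinearMap.det ((g : W ≃L[F] W) : W →ₗ[F] W)) = 1 := by
    have h3 := congrArg haarModule h1
    rw [haarModule_pow, haarModule_one] at h3
    exact (pow_eq_one_iff_of_nonneg (haarModule_nonneg _) two_ne_zero).1 h3
  have h4 := map_linearMap_addHaar μ (T := ((g : W ≃L[F] W) : W →ₗ[F] W))
    (by intro h; rw [h] at h1; norm_num at h1)
  rw [h2, ENNReal.ofReal_one, one_smul] at h4
  exact h4

variable [IsUltrametricDist F] [CharZero F] [Nontrivial W] (hB : B.IsAlt) (hBnd : B.Nondegenerate)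
  (μ : Measure W) [μ.IsAddHaarMeasure]

include hB hBnd in
theorem isFiniteMeasureOnCompacts_map_moment : IsFiniteMeasureOnCompacts (μ.map (moment B)) := by
  refine ⟨fun K hK => ?_⟩
  have hm : MeasurableSet K := IsCompact.measurableSet hK
  rw [Measure.map_apply continuous_moment.measurable hm]
  exact (isCompact_preimage_moment hB hBnd hK).measure_lt_top

include hB hBnd in
theorem map_moment_compl_orbit : μ.map (moment B) (moment B '' {0}ᶜ)ᶜ = 0 := by
  have h0 : moment B '' {0}ᶜ = Set.range (moment B) \ {0} := by
    ext ξ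
    constructor
    · rintro ⟨w, hw, rfl⟩
      exact ⟨⟨w, rfl⟩, (moment_ne_zero hB hBnd).2 hw⟩
    · rintro ⟨⟨w, rfl⟩, hw⟩
      exact ⟨w, (moment_ne_zero hB hBnd).1 hw, rfl⟩
  have hm : MeasurableSet (moment B '' {0}ᶜ) := by
    rw [h0]
    exact (isClosed_range_moment hB hBnd).measurableSet.diff (measurableSet_singleton 0)
  rw [Measure.map_apply continuous_moment.measurable hm.compl]
  have h1 : moment B ⁻¹' (moment B '' {0}ᶜ)ᶜ ⊆ {0} := by
    intro w hw
    by_contra h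
    exact hw ⟨w, h, rfl⟩
  have : Filter.NeBot (nhdsWithin (0 : W) {0}ᶜ) := Module.punctured_nhds_neBot F W 0
  have : ProperSpace W := FiniteDimensional.proper F W
  exact measure_mono_null h1 (measure_singleton 0)

include hBnd in
theorem map_coadjoint_map_moment (g : Sp B) :
    (μ.map (moment B)).map (coadjoint B g) = μ.map (moment B) := by
  have hg : Continuous (coadjoint B g) := by
    change Continuous fun ξ : sp B →L[F] F => ξ.comp (adjoint B g⁻¹)
    exact continuous_id.clm_comp continuous_const
  have hgm : Measurable (coadjoint B g) := hg.measurable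
  have hmm : Measurable (moment B) := continuous_moment.measurable
  have hgw : Measurable (g : W ≃L[F] W) := (g : W ≃L[F] W).continuous.measurable
  rw [Measure.map_map hgm hmm]
  have h1 : coadjoint B g ∘ moment B = moment B ∘ (g : W ≃L[F] W) := by
    ext1 w
    exact coadjoint_moment g w
  rw [h1, ← Measure.map_map hmm hgw, map_sp_eq hBnd μ g]

end OrbitMeasure


/-! ### Membership in the wave front set -/

section WaveFront

open Topology

variable {F : Type*} [NontriviallyNormedField F] {E : Type*} [NormedAddCommGroup E]
  [NormedSpace F E] {χ : AddChar F Circle} {hχ : ∀ a, χ a = 1 ↔ ‖a‖ ≤ 1} {Λ : Subgroup Fˣ}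
  {u : Distribution E} {x : E} {ξ : E →L[F] F}

theorem isBounded_inter_closure {X : Type*} [PseudoMetricSpace X] {V S : Set X} (hV : IsOpen V)
    (h : Bornology.IsBounded (V ∩ S)) : Bornology.IsBounded (V ∩ closure S) :=
  h.closure.subset hV.inter_closure

theorem notMem_waveFrontSet {φ : SchwartzBruhat E} (hφ : (φ : E → ℂ) x ≠ 0)
    {V : Set (E →L[F] F)} (hV : IsOpen V) (hVc : IsCone Λ V) (hξ : ξ ∈ V) {R : ℝ}
    (h : ∀ η ∈ V, R < ‖η‖ → fourierLocal hχ u φ η = 0) : (x, ξ) ∉ waveFrontSet hχ Λ u := by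
  intro hmem
  refine (hmem φ hφ).2 V hV hVc hξ (isBounded_inter_closure hV ?_)
  refine (Metric.isBounded_closedBall (x := (0 : E →L[F] F)) (r := R)).subset fun η hη => ?_
  rw [mem_closedBall_zero_iff]
  by_contra hR
  exact hη.2 (h η hη.1 (not_le.1 hR))

theorem mem_waveFrontSet (hξ : ξ ≠ 0)
    (h : ∀ φ : SchwartzBruhat E, (φ : E → ℂ) x ≠ 0 → ∀ V : Set (E →L[F] F), IsOpen V →
      IsCone Λ V → ξ ∈ V → ∀ R : ℝ, ∃ η ∈ V, R < ‖η‖ ∧ fourierLocal hχ u φ η ≠ 0) :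
    (x, ξ) ∈ waveFrontSet hχ Λ u := by
  intro φ hφ
  refine ⟨hξ, fun V hV hVc hξV hb => ?_⟩
  obtain ⟨R, hR⟩ := hb.exists_norm_le
  obtain ⟨η, hη, hηR, hne⟩ := h φ hφ V hV hVc hξV R
  exact not_le.2 hηR (hR η ⟨hη, subset_closure hne⟩)

end WaveFront

/-! ### Subgroups of finite index of the multiplicative group -/

section FiniteIndex

open Topology

variable {F : Type*} [NontriviallyNormedField F] [CharZero F] {Λ : Subgroup Fˣ}

/-- A subgroup of finite index is closed in the multiplicative group, because by the inverse
function theorem the powers of a fixed exponent fill a neighbourhood of one. -/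
theorem mem_of_mem_closure_units [CompleteSpace F] (hΛ : Λ.FiniteIndex) {t : Fˣ}
    (ht : (t : F) ∈ closure ((fun u : Fˣ => (u : F)) '' (Λ : Set Fˣ))) : t ∈ Λ := by
  have hN : ((Λ.index : ℕ) : F) ≠ 0 := Nat.cast_ne_zero.2 hΛ.index_ne_zero
  have hd : HasStrictDerivAt (fun v : F => v ^ Λ.index)
      ((Λ.index : F) * 1 ^ (Λ.index - 1)) 1 := hasStrictDerivAt_pow _ _
  have h1 : (fun v : F => v ^ Λ.index) '' {v | v ≠ 0} ∈ 𝓝 (1 : F) := by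
    have h2 := hd.map_nhds_eq (by simpa using hN)
    rw [one_pow] at h2
    rw [← h2]
    exact Filter.image_mem_map (isOpen_ne.mem_nhds one_ne_zero)
  have h3 : (fun s : F => s * ((t⁻¹ : Fˣ) : F)) ⁻¹' ((fun v : F => v ^ Λ.index) '' {v | v ≠ 0}) ∈
      𝓝 (t : F) := by
    apply (continuous_mul_const _).continuousAt.preimage_mem_nhds
    rwa [Units.mul_inv]
  obtain ⟨-, ⟨v, hv, hvt⟩, s, hs, rfl⟩ := mem_closure_iff_nhds.1 ht _ h3
  have h4 : Units.mk0 v hv ^ Λ.index = s * t⁻¹ := Units.ext hvt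
  have h5 : s * t⁻¹ ∈ Λ := by
    rw [← h4]
    exact Subgroup.pow_index_mem Λ _
  exact inv_mem_iff.1 ((Subgroup.mul_mem_cancel_left Λ hs).1 h5)

theorem exists_mem_norm_lt_one (hΛ : Λ.FiniteIndex) : ∃ a ∈ Λ, ‖(a : F)‖ < 1 := by
  obtain ⟨ϖ, h0, h1⟩ := NormedField.exists_norm_lt_one F
  refine ⟨Units.mk0 ϖ (norm_pos_iff.1 h0) ^ Λ.index, Subgroup.pow_index_mem Λ _, ?_⟩
  rw [Units.val_pow_eq_pow_val, norm_pow]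
  exact pow_lt_one₀ (norm_nonneg _) h1 hΛ.index_ne_zero

/-- A subgroup of finite index is compact modulo squares of its elements: they allow to move
absolute values into a bounded range. -/
theorem exists_isCompact_sq_mul [ProperSpace F] (hΛ : Λ.FiniteIndex) :
    ∃ T : Set F, IsCompact T ∧ (∃ r : ℝ, 0 < r ∧ ∀ t ∈ T, r ≤ ‖t‖) ∧
      (∀ t ∈ T, ∃ u ∈ Λ, (u : F) = t) ∧
      ∀ u ∈ Λ, ∃ a : F, ∃ t ∈ T, (u : F) = a ^ 2 * t := by
  obtain ⟨a, ha, ha1⟩ := exists_mem_norm_lt_one hΛ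
  have ha0 : 0 < ‖(a : F)‖ := norm_pos_iff.2 a.ne_zero
  set r := ‖(a : F)‖ ^ 2 with hr
  have hr0 : 0 < r := by positivity
  have hr1 : r < 1 := pow_lt_one₀ ha0.le ha1 two_ne_zero
  set S : Set F := (fun u : Fˣ => (u : F)) '' (Λ : Set Fˣ) with hS
  have hmem : ∀ t : F, r ≤ ‖t‖ → t ∈ closure S → t ∈ S := by
    intro t ht htS
    have ht0 : t ≠ 0 := norm_pos_iff.1 (hr0.trans_le ht)
    exact ⟨Units.mk0 t ht0, mem_of_mem_closure_units hΛ (by simpa using htS), rfl⟩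
  refine ⟨closure S ∩ {t | r ≤ ‖t‖ ∧ ‖t‖ ≤ 1}, ?_, ⟨r, hr0, fun t ht => ht.2.1⟩, ?_, ?_⟩
  · refine (isCompact_closedBall (0 : F) 1).of_isClosed_subset ?_ fun t ht => by simpa using ht.2.2
    exact isClosed_closure.inter ((isClosed_le continuous_const continuous_norm).inter
      (isClosed_le continuous_norm continuous_const))
  · rintro t ⟨htS, ht, -⟩
    exact hmem t ht htS
  · intro u hu
    have hu0 : 0 < ‖(u : F)‖ := norm_pos_iff.2 u.ne_zero
    obtain ⟨n, hn1, hn2⟩ := exists_mem_Ioc_zpow hu0 (one_lt_inv₀ hr0 |>.2 hr1)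
    -- `a ^ (2 (n + 1)) u` has absolute value between `r` and `1`
    have hv : a ^ (2 * (n + 1)) * u ∈ Λ := Λ.mul_mem (Λ.zpow_mem ha _) hu
    have hnorm : ‖((a ^ (2 * (n + 1)) * u : Fˣ) : F)‖ = r ^ (n + 1) * ‖(u : F)‖ := by
      rw [Units.val_mul, norm_mul, Units.val_zpow_eq_zpow_val, norm_zpow, zpow_mul, hr]
      norm_cast
    refine ⟨((a ^ (-(n + 1)) : Fˣ) : F), _, ⟨subset_closure ⟨_, hv, rfl⟩, ?_, ?_⟩, ?_⟩
    · simp only []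
      rw [hnorm]
      rw [inv_zpow'] at hn1
      have hp : 0 < r ^ (n + 1) := zpow_pos hr0 _
      calc r = r ^ (n + 1) * r ^ (-n) := by rw [← zpow_add₀ hr0.ne']; simp
        _ ≤ _ := by gcongr
    · simp only []
      rw [hnorm]
      rw [inv_zpow'] at hn2
      have hp : 0 < r ^ (n + 1) := zpow_pos hr0 _
      calc r ^ (n + 1) * ‖(u : F)‖ ≤ r ^ (n + 1) * r ^ (-(n + 1)) := by gcongr
        _ = 1 := by rw [← zpow_add₀ hr0.ne']; simp
    · simp only []
      rw [← Units.val_pow_eq_pow_val, ← Units.val_mul, ← mul_assoc, ← zpow_natCast, ← zpow_mul,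
        ← zpow_add]
      congr 1
      rw [show -(n + 1) * ((2 : ℕ) : ℤ) + 2 * (n + 1) = 0 by push_cast; ring, zpow_zero, one_mul]

end FiniteIndex

/-! ### Cones spanned by quadratic maps -/

section QuadraticCone

open Topology

variable {F : Type*} [NontriviallyNormedField F]
  {D : Type*} [NormedAddCommGroup D] [NormedSpace F D] {Λ : Subgroup Fˣ}

/-- A point outside a closed set stable under `Λ` has a conical neighbourhood that moves away
from this set at infinity. -/
theorem exists_isCone_of_notMem {C : Set D} (hC : IsClosed C) (h0 : (0 : D) ∈ C)
    (hΛC : ∀ t ∈ Λ, ∀ η ∈ C, (t : F) • η ∈ C) {ξ : D} (hξ : ξ ∉ C) :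
    ∃ V : Set D, IsOpen V ∧ IsCone Λ V ∧ ξ ∈ V ∧
      ∀ K : ℝ, ∃ R : ℝ, ∀ η ∈ V, R < ‖η‖ → ∀ ζ ∈ C, K < ‖ζ - η‖ := by
  have hpos : 0 < Metric.infDist ξ C := (hC.notMem_iff_infDist_pos ⟨0, h0⟩).1 hξ
  have hξ0 : 0 < ‖ξ‖ := norm_pos_iff.2 fun h => hξ (h ▸ h0)
  set δ := Metric.infDist ξ C / (2 * ‖ξ‖) with hδ
  have hδ0 : 0 < δ := by positivity
  refine ⟨{η | δ * ‖η‖ < Metric.infDist η C}, isOpen_lt (by fun_prop)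
    (Metric.continuous_infDist_pt C), ⟨?_, ?_⟩, ?_, fun K => ⟨K / δ, fun η hη hR ζ hζ => ?_⟩⟩
  · simp [Metric.infDist_zero_of_mem h0]
  · intro t ht η hη
    have ht0 : 0 < ‖(t : F)‖ := norm_pos_iff.2 t.ne_zero
    have h1 : ‖(t : F)‖ * Metric.infDist η C ≤ Metric.infDist ((t : F) • η) C := by
      refine (Metric.le_infDist ⟨0, h0⟩).2 fun ζ hζ => ?_
      have h2 := Metric.infDist_le_dist_of_mem (x := η) (hΛC _ (Λ.inv_mem ht) ζ hζ)
      have h3 : ζ = (t : F) • ((t⁻¹ : Fˣ) : F) • ζ := by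
        rw [smul_smul, Units.mul_inv, one_smul]
      rw [h3, dist_smul₀]
      gcongr
    change δ * ‖(t : F) • η‖ < _
    rw [norm_smul]
    have h4 : ‖(t : F)‖ * (δ * ‖η‖) < ‖(t : F)‖ * Metric.infDist η C :=
      mul_lt_mul_of_pos_left hη ht0
    linarith
  · change δ * ‖ξ‖ < _
    have h1 : δ * ‖ξ‖ = Metric.infDist ξ C / 2 := by
      rw [hδ]
      field_simp
    rw [h1]
    exact half_lt_self hpos
  · rw [div_lt_iff₀ hδ0] at hR
    have h1 := Metric.infDist_le_dist_of_mem (x := η) hζ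
    rw [dist_comm, dist_eq_norm] at h1
    have h2 : δ * ‖η‖ < Metric.infDist η C := hη
    linarith

variable {W : Type*} [NormedAddCommGroup W] [NormedSpace F W] {τ : W → D}

/-- The set of multiples, by elements of `Λ`, of the values of a map. -/
def coneOver (Λ : Subgroup Fˣ) (τ : W → D) : Set D :=
  {ξ | ∃ t ∈ Λ, ∃ w : W, ξ = (t : F) • τ w}

theorem mem_coneOver (w : W) : τ w ∈ coneOver Λ τ :=
  ⟨1, Λ.one_mem, w, by rw [Units.val_one, one_smul]⟩

theorem smul_mem_coneOver : ∀ t ∈ Λ, ∀ ξ ∈ coneOver Λ τ, (t : F) • ξ ∈ coneOver Λ τ := by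
  rintro t ht _ ⟨s, hs, w, rfl⟩
  exact ⟨t * s, Λ.mul_mem ht hs, w, by rw [smul_smul, Units.val_mul]⟩

/-- As the map is quadratic, squares of elements of `Λ` are absorbed into its argument, and a compact
set of multiples suffices. -/
theorem isClosed_coneOver [ProperSpace F] [CharZero F] [ProperSpace W] (hΛ : Λ.FiniteIndex)
    (hτ : Continuous τ) (hsmul : ∀ (r : F) w, τ (r • w) = r ^ 2 • τ w) {c : ℝ} (hc : 0 < c)
    (hlow : ∀ w, c * ‖w‖ * ‖w‖ ≤ ‖τ w‖) : IsClosed (coneOver Λ τ) := by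
  obtain ⟨T, hT, ⟨r, hr, hrT⟩, hTΛ, hΛT⟩ := exists_isCompact_sq_mul hΛ
  refine isClosed_of_closure_subset fun ξ hξ => ?_
  set C : ℝ := ‖ξ‖ + 1 with hC
  set K : Set D :=
    (fun p : F × W => p.1 • τ p.2) '' (T ×ˢ Metric.closedBall 0 (Real.sqrt (C / (r * c))))
    with hK
  have hKc : IsCompact K := (hT.prod (isCompact_closedBall _ _)).image
    (continuous_fst.smul (hτ.comp continuous_snd))
  have hsub : Metric.ball ξ 1 ∩ coneOver Λ τ ⊆ K := by
    rintro η ⟨hη, u, hu, w, rfl⟩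
    obtain ⟨a, t, ht, hat⟩ := hΛT u hu
    have h1 : (u : F) • τ w = t • τ (a • w) := by
      rw [hsmul, smul_smul, hat, mul_comm]
    rw [h1] at hη ⊢
    refine ⟨(t, a • w), ⟨ht, ?_⟩, rfl⟩
    rw [mem_closedBall_zero_iff]
    refine Real.le_sqrt_of_sq_le ?_
    have h2 : ‖t • τ (a • w)‖ ≤ C := by
      rw [mem_ball_iff_norm] at hη
      have h3 := norm_add_le (t • τ (a • w) - ξ) ξ
      rw [sub_add_cancel] at h3
      linarith
    rw [norm_smul] at h2
    have h5 := hrT t ht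
    rw [le_div_iff₀ (by positivity)]
    calc ‖a • w‖ ^ 2 * (r * c) = r * (c * ‖a • w‖ * ‖a • w‖) := by ring
      _ ≤ ‖t‖ * ‖τ (a • w)‖ := by
        gcongr
        exact hlow _
      _ ≤ C := h2
  have hξK : ξ ∈ K := closure_minimal hsub hKc.isClosed
    (Metric.isOpen_ball.inter_closure ⟨Metric.mem_ball_self one_pos, hξ⟩)
  obtain ⟨⟨t, w⟩, ⟨ht, -⟩, rfl⟩ := hξK
  obtain ⟨u, hu, rfl⟩ := hTΛ t ht
  exact ⟨u, hu, w, rfl⟩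

/-- A point at which a continuous homogeneous map `P` does not vanish has a conical neighbourhood
on which `P` is bounded below. -/
theorem exists_isCone_of_apply_ne_zero {D' : Type*} [NormedAddCommGroup D'] [NormedSpace F D']
    {P : D → D'} (hP : Continuous P) (hsmul : ∀ (t : F) η, P (t • η) = t • P η) {ξ : D}
    (hξ : P ξ ≠ 0) :
    ∃ V : Set D, IsOpen V ∧ IsCone Λ V ∧ ξ ∈ V ∧ ∃ δ : ℝ, 0 < δ ∧ ∀ η ∈ V, δ * ‖η‖ ≤ ‖P η‖ := by
  have hP0 : P 0 = 0 := by simpa using hsmul 0 0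
  have hpos : 0 < ‖P ξ‖ := norm_pos_iff.2 hξ
  have hξ0 : 0 < ‖ξ‖ := norm_pos_iff.2 fun h => hξ (h ▸ hP0)
  set δ := ‖P ξ‖ / (2 * ‖ξ‖) with hδ
  refine ⟨{η | δ * ‖η‖ < ‖P η‖}, isOpen_lt (by fun_prop) (by fun_prop), ⟨by simp [hP0], ?_⟩, ?_,
    δ, by positivity, fun η hη => le_of_lt hη⟩
  · intro t _ η hη
    have ht0 : 0 < ‖(t : F)‖ := norm_pos_iff.2 t.ne_zero
    have h4 : ‖(t : F)‖ * (δ * ‖η‖) < ‖(t : F)‖ * ‖P η‖ := mul_lt_mul_of_pos_left hη ht0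
    change δ * ‖(t : F) • η‖ < ‖P ((t : F) • η)‖
    rw [hsmul, norm_smul, norm_smul]
    linarith
  · change δ * ‖ξ‖ < _
    have h1 : δ * ‖ξ‖ = ‖P ξ‖ / 2 := by
      rw [hδ]
      field_simp
    rw [h1]
    exact half_lt_self hpos

end QuadraticCone


/-! ### Fourier transforms of indicator functions of cosets -/

section Indicator

variable {F : Type*} [NontriviallyNormedField F] {χ : AddChar F Circle}
  (hχ : ∀ a : F, χ a = 1 ↔ ‖a‖ ≤ 1)
  {E : Type*} [NormedAddCommGroup E] [NormedSpace F E] [MeasurableSpace E] [BorelSpace E]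
  (ν : Measure E) [ν.IsAddHaarMeasure] {M : AddSubgroup E} (hM : IsLattice M)

/-- The indicator function of the coset `x₀ + M`. -/
noncomputable def cosetIndicator (hM : IsLattice M) (x₀ : E) : SchwartzBruhat E :=
  ⟨_, hM.indicator_translate_mem x₀ 1⟩

theorem cosetIndicator_self (x₀ : E) : (cosetIndicator hM x₀ : E → ℂ) x₀ = 1 := by
  change Set.indicator (M : Set E) (fun _ => (1 : ℂ)) (x₀ - x₀) = 1
  rw [sub_self, Set.indicator_of_mem (show (0 : E) ∈ (M : Set E) from M.zero_mem)]

theorem fourier_cosetIndicator (x₀ : E) (η : E →L[F] F) :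
    ∫ x, ((χ (η x) : Circle) : ℂ) * (cosetIndicator hM x₀ : E → ℂ) x ∂ν =
      ((χ (η x₀) : Circle) : ℂ) * ∫ x in (M : Set E), ((χ (η x) : Circle) : ℂ) ∂ν := by
  rw [← integral_indicator hM.measurableSet, ← integral_const_mul,
    ← integral_add_right_eq_self _ x₀]
  congr 1
  ext x
  change _ * Set.indicator (M : Set E) (fun _ => (1 : ℂ)) (x + x₀ - x₀) = _
  rw [add_sub_cancel_right, map_add, coe_addChar_add]
  by_cases hx : x ∈ (M : Set E)
  · rw [Set.indicator_of_mem hx, Set.indicator_of_mem hx]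
    ring
  · rw [Set.indicator_of_notMem hx, Set.indicator_of_notMem hx]
    ring

include hχ in
theorem fourier_cosetIndicator_of_le (x₀ : E) {η : E →L[F] F} (hη : ∀ h ∈ M, ‖η h‖ ≤ 1) :
    ∫ x, ((χ (η x) : Circle) : ℂ) * (cosetIndicator hM x₀ : E → ℂ) x ∂ν =
      ((χ (η x₀) : Circle) : ℂ) * ν.real (M : Set E) := by
  rw [fourier_cosetIndicator, setIntegral_addChar_of_le hχ hM hη]

include hχ in
theorem fourier_cosetIndicator_of_not_le (x₀ : E) {η : E →L[F] F} (hη : ¬ ∀ h ∈ M, ‖η h‖ ≤ 1) :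
    ∫ x, ((χ (η x) : Circle) : ℂ) * (cosetIndicator hM x₀ : E → ℂ) x ∂ν = 0 := by
  rw [fourier_cosetIndicator, setIntegral_addChar_of_not_le hχ hM (fun x y => map_add η x y) hη,
    mul_zero]

variable {W : Type*} [NormedAddCommGroup W] [SecondCountableTopology W] [MeasurableSpace W]
  [BorelSpace W] (μ : Measure W) [μ.IsAddHaarMeasure] [SFinite μ] {H : AddSubgroup W}

/-- A function whose integral over each coset of a lattice vanishes has integral zero. -/
theorem integral_eq_zero_of_setIntegral_coset (hH : IsLattice H) {f : W → ℂ} (hf : Integrable f μ)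
    (h0 : ∀ w, ∫ h in (H : Set W), f (w + h) ∂μ = 0) : ∫ w, f w ∂μ = 0 := by
  have hfin : IsFiniteMeasure (μ.restrict (H : Set W)) :=
    ⟨by rw [Measure.restrict_apply_univ]; exact hH.isCompact.measure_lt_top⟩
  have hint : Integrable (fun z : W × W => f (z.1 + z.2)) ((μ.restrict (H : Set W)).prod μ) := by
    have h1 : Integrable (fun z : W × W => (1 : ℂ) * f z.2) ((μ.restrict (H : Set W)).prod μ) :=
      Integrable.mul_prod (integrable_const _) hf
    have h2 := (measurePreserving_prod_add (μ.restrict (H : Set W)) μ).integrable_comp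
      h1.aestronglyMeasurable
    simpa [Function.comp_def] using h2.2 h1
  have h1 := integral_integral_swap (f := fun h w => f (h + w)) hint
  have h2 : ∀ w, ∫ h in (H : Set W), f (h + w) ∂μ = 0 := by
    intro w
    simp_rw [add_comm _ w]
    exact h0 w
  simp_rw [h2, integral_add_left_eq_self, integral_zero] at h1
  rw [integral_const, smul_eq_zero] at h1
  refine h1.resolve_left ?_
  rw [measureReal_def, Measure.restrict_apply_univ]
  exact (hH.measureReal_pos μ).ne'

end Indicator

/-! ### Covectors outside the wave front set -/

section Sandwich

variable {F : Type*} [NontriviallyNormedField F] [ProperSpace F]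
  {W : Type*} [NormedAddCommGroup W] [NormedSpace F W] [FiniteDimensional F W]
  {B : LinearMap.BilinForm F W}

/-- The map `y ↦ x y x` on the symplectic Lie algebra. -/
noncomputable def sandwich (x : sp B) : sp B →L[F] sp B where
  toFun y := ⟨x.1.comp (y.1.comp x.1), fun u v => by
    change B (x.1 (y.1 (x.1 u))) v + B u (x.1 (y.1 (x.1 v))) = 0
    rw [sp_apply_left, sp_apply_left, sp_apply_left, neg_neg, neg_add_cancel]⟩
  map_add' y z := by
    ext w
    exact map_add x.1 _ _
  map_smul' c y := by
    ext w
    exact map_smul x.1 _ _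
  cont := by
    refine Continuous.subtype_mk ?_ _
    exact continuous_const.clm_comp (continuous_subtype_val.clm_comp continuous_const)

/-- The transpose of `sandwich x`, with the sign for which it maps `moment B w`
to `moment B (x w)`. -/
noncomputable def cosandwich (x : sp B) : (sp B →L[F] F) →L[F] (sp B →L[F] F) :=
  -(ContinuousLinearMap.compL F (sp B) (sp B) F).flip (sandwich x)

theorem cosandwich_moment (x : sp B) (w : W) :
    cosandwich x (moment B w) = moment B (x.1 w) := by
  ext y
  change -B (x.1 (y.1 (x.1 w))) w = B (y.1 (x.1 w)) (x.1 w)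
  rw [sp_apply_left, neg_neg]

theorem exists_norm_cosandwich_le (x : sp B) : ∃ p : ℝ, 0 ≤ p ∧ ∀ ξ ζ : sp B →L[F] F,
    ‖cosandwich x ξ‖ ≤ ‖cosandwich x ζ‖ + p * ‖ζ - ξ‖ := by
  refine ⟨‖sandwich x‖, ContinuousLinearMap.opNorm_nonneg _, fun ξ ζ => ?_⟩
  have h1 : cosandwich x ξ = cosandwich x ζ + (ζ - ξ).comp (sandwich x) := by
    ext y
    change -(ξ _) = -(ζ _) + (ζ _ - ξ _)
    ring
  rw [h1, mul_comm]
  refine (ContinuousLinearMap.opNorm_add_le _ _).trans ?_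
  gcongr
  exact ContinuousLinearMap.opNorm_comp_le _ _

end Sandwich

section NotMem

open Topology

variable {F : Type*} [NontriviallyNormedField F] [IsUltrametricDist F] [ProperSpace F] [CharZero F]
  {W : Type*} [NormedAddCommGroup W] [NormedSpace F W] [FiniteDimensional F W]
  {χ : AddChar F Circle} {B : LinearMap.BilinForm F W} [MeasurableSpace W] [BorelSpace W]
  {μ : Measure W} [μ.IsAddHaarMeasure] {ν : Measure (sp B)} [ν.IsAddHaarMeasure]
  (hχ : ∀ a : F, χ a = 1 ↔ ‖a‖ ≤ 1)
  (hB : B.IsAlt) (hBnd : B.Nondegenerate) {Λ : Subgroup Fˣ} {u : Distribution (sp B)}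
  (hu : ∀ ψ : SchwartzBruhat (sp B), u ψ =
    ∫ w : W, (∫ x : sp B, ((χ (B (x.1 w) w) : Circle) : ℂ) * (ψ : sp B → ℂ) x ∂ν) ∂μ)

/-- The modulation `χ(-ξ)` translates the Fourier transform by `ξ`. -/
theorem inner_modulate (φ : SchwartzBruhat (sp B)) (ξ : sp B →L[F] F) (w : W) :
    ∫ x : sp B, ((χ (B (x.1 w) w) : Circle) : ℂ) * (modulate hχ φ ξ : sp B → ℂ) x ∂ν =
      ∫ x : sp B, ((χ ((moment B w - ξ) x) : Circle) : ℂ) * (φ : sp B → ℂ) x ∂ν := by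
  congr 1
  ext x
  change ((χ (moment B w x) : Circle) : ℂ) * ((φ : sp B → ℂ) x * ((χ (-(ξ x)) : Circle) : ℂ)) = _
  have h : (moment B w - ξ) x = moment B w x + -(ξ x) := sub_eq_add_neg _ _
  rw [h, coe_addChar_add]
  ring

include hu in
theorem fourierLocal_eq (φ : SchwartzBruhat (sp B)) (ξ : sp B →L[F] F) :
    fourierLocal hχ u φ ξ = ∫ w : W, (∫ x : sp B,
      ((χ ((moment B w - ξ) x) : Circle) : ℂ) * (φ : sp B → ℂ) x ∂ν) ∂μ := by
  rw [fourierLocal, hu]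
  congr 1
  ext w
  exact inner_modulate hχ φ ξ w

include hB hBnd hu in
/-- Away from the cone over the image of the moment map the Fourier transforms vanish, since they
are integrals of compactly supported functions translated by the values of the moment map. -/
theorem notMem_waveFrontSet_of_notMem_coneOver (hΛ : Λ.FiniteIndex) {x : sp B}
    {ξ : sp B →L[F] F} (hξ : ξ ∉ coneOver Λ (moment B)) : (x, ξ) ∉ waveFrontSet hχ Λ u := by
  have : ProperSpace W := FiniteDimensional.proper F W
  obtain ⟨c, hc, hlow⟩ := exists_lower_bound_polarMoment hB hBnd
  have hcl : IsClosed (coneOver Λ (moment B)) :=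
    isClosed_coneOver (D := sp B →L[F] F) hΛ continuous_moment moment_smul hc fun w => hlow w w
  obtain ⟨V, hV, hVc, hξV, hfar⟩ := exists_isCone_of_notMem (D := sp B →L[F] F) hcl
    (moment_zero (B := B) ▸ mem_coneOver 0) smul_mem_coneOver hξ
  obtain ⟨M, hM, -⟩ := exists_isLattice_subset F (Filter.univ_mem (f := 𝓝 (0 : sp B)))
  obtain ⟨C, hC, hCM⟩ := hM.exists_bound (F := F)
  obtain ⟨R, hR⟩ := hfar C
  refine notMem_waveFrontSet (φ := cosetIndicator hM x) (R := R)
    (by rw [cosetIndicator_self]; exact one_ne_zero) hV hVc hξV fun η hη hηR => ?_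
  rw [fourierLocal_eq hχ hu]
  rw [← integral_zero W ℂ (μ := μ)]
  congr 1
  ext w
  refine fourier_cosetIndicator_of_not_le hχ ν hM x fun h => ?_
  exact not_lt.2 (hCM _ h) (hR η hη hηR _ (mem_coneOver w))

end NotMem


section NotMem

open Topology

variable {F : Type*} [NontriviallyNormedField F] [IsUltrametricDist F] [ProperSpace F] [CharZero F]
  {W : Type*} [NormedAddCommGroup W] [NormedSpace F W] [FiniteDimensional F W]
  {χ : AddChar F Circle} {B : LinearMap.BilinForm F W}
  {L : Submodule (integerRing F) W} (hL : IsLattice L.toAddSubgroup)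
  (hLdual : ∀ w : W, (∀ w' ∈ L, ‖B w w'‖ ≤ 1) ↔ w ∈ L)
  (hB : B.IsAlt) (hBnd : B.Nondegenerate)

theorem moment_add_sub_moment (hB : B.IsAlt) (w h : W) :
    moment B (w + h) - moment B w = polarMoment B h (w + h + w) := by
  rw [moment_sub_moment hB, add_sub_cancel_left]

include hL hLdual hB hBnd in
/-- If `w` has size `ρ` and `x w` has size at least a fixed multiple of `ρ`, translations by a
lattice of size a suitable multiple of `1 / ρ` move `moment B w` by a bounded amount, while the
value at `w` of the quadratic form of `x` changes by a non-trivial character. -/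
theorem exists_translation_lattice (x : sp B) {δ : ℝ} (hδ : 0 < δ) :
    ∃ A : ℝ, 0 ≤ A ∧ ∀ C : ℝ, 0 < C → ∃ R : ℝ, ∀ η : sp B →L[F] F,
      δ * ‖η‖ ≤ ‖cosandwich x η‖ → R < ‖η‖ → ∃ H : AddSubgroup W, IsLattice H ∧
        (∀ h ∈ H, ‖B (x.1 h) h‖ ≤ 1) ∧ ∀ w, ‖moment B w - η‖ ≤ C →
          (¬ ∀ h ∈ H, ‖B ((2 : F) • x.1 w) h‖ ≤ 1) ∧
          ∀ h ∈ H, ‖moment B (w + h) - moment B w‖ ≤ A := by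
  obtain ⟨c, hc, hlow⟩ := exists_lower_bound_polarMoment hB hBnd
  obtain ⟨l, hl, hlL⟩ : ∃ l : ℝ, 0 < l ∧ ∀ w ∈ L, ‖w‖ ≤ l := by
    obtain ⟨l, hl, h⟩ := hL.isBounded.exists_pos_norm_le
    exact ⟨l, hl, fun w hw => h w hw⟩
  obtain ⟨r, hr⟩ := NormedField.exists_one_lt_norm F
  have hr0 : 0 < ‖r‖ := one_pos.trans hr
  have h2 : 0 < ‖(2 : F)‖ := norm_pos_iff.2 two_ne_zero
  set b := ‖contForm B‖ + 1 with hb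
  have hb0 : 0 < b := by positivity
  have hup : ∀ v w : W, ‖polarMoment B v w‖ ≤ b * ‖v‖ * ‖w‖ := fun v w =>
    (norm_polarMoment_le v w).trans (by gcongr; exact le_add_of_nonneg_right zero_le_one)
  -- `κ` and `κ'` bound `x w` from below and `w` from above, relative to the square root of `η`
  set κ := Real.sqrt (δ / (2 * b)) with hκ
  have hκ0 : 0 < κ := Real.sqrt_pos.2 (by positivity)
  have hκsq : κ ^ 2 = δ / (2 * b) := Real.sq_sqrt (by positivity)
  set κ' := Real.sqrt (2 / c) with hκ'
  have hκ'0 : 0 < κ' := Real.sqrt_pos.2 (by positivity)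
  have hκ'sq : κ' ^ 2 = 2 / c := Real.sq_sqrt (by positivity)
  set A₀ := l / (‖(2 : F)‖ * κ) with hA₀
  have hA₀0 : 0 < A₀ := by positivity
  set A₁ := 2 * A₀ * ‖r‖ * l with hA₁
  have hA₁0 : 0 < A₁ := by positivity
  refine ⟨b * A₁ * (2 * κ' + A₁), by positivity, fun C hC => ?_⟩
  obtain ⟨p, hp0, hp⟩ := exists_norm_cosandwich_le x
  refine ⟨1 + 2 * p * C / δ + C + b * ‖x.1‖ * A₁ ^ 2, fun η hη hR => ?_⟩
  set ρ := ‖η‖ with hρ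
  have t1 : 0 ≤ 2 * p * C / δ := by positivity
  have t2 : 0 ≤ b * ‖x.1‖ * A₁ ^ 2 := by positivity
  have hρ1 : 1 ≤ ρ := by linarith
  have hρ2 : p * C ≤ δ / 2 * ρ := by
    have : 2 * p * C / δ ≤ ρ := by linarith
    rw [div_le_iff₀ hδ] at this
    linarith
  have hρ3 : C ≤ ρ := by linarith
  have hρ4 : b * ‖x.1‖ * A₁ ^ 2 ≤ ρ := by linarith
  set σ := Real.sqrt ρ with hσ
  have hσ1 : 1 ≤ σ := Real.one_le_sqrt.2 hρ1
  have hσ0 : 0 < σ := one_pos.trans_le hσ1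
  have hσsq : σ ^ 2 = ρ := Real.sq_sqrt (zero_le_one.trans hρ1)
  obtain ⟨s, hs0, hs1, hs2⟩ : ∃ s : F, s ≠ 0 ∧ 2 * A₀ / σ ≤ ‖s‖ ∧ ‖s‖ ≤ 2 * A₀ * ‖r‖ / σ := by
    obtain ⟨s, hs, hs1, hs2, -⟩ := rescale_to_shell (x := (1 : F)) hr
      (ε := 2 * A₀ * ‖r‖ / σ) (by positivity) one_ne_zero
    rw [smul_eq_mul, mul_one] at hs1 hs2
    refine ⟨s, hs, ?_, hs1.le⟩
    calc _ = 2 * A₀ * ‖r‖ / σ / ‖r‖ := by field_simp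
      _ ≤ _ := hs2
  have hsnorm : 0 < ‖s‖ := norm_pos_iff.2 hs0
  have hH : ∀ h ∈ scaledLattice L s⁻¹, ‖h‖ ≤ A₁ / σ := by
    intro h hh
    have h3 := hlL _ (mem_scaledLattice.1 hh)
    rw [norm_smul, norm_inv, inv_mul_le_iff₀ hsnorm] at h3
    calc ‖h‖ ≤ ‖s‖ * l := h3
      _ ≤ 2 * A₀ * ‖r‖ / σ * l := by gcongr
      _ = A₁ / σ := by rw [hA₁]; ring
  refine ⟨scaledLattice L s⁻¹, isLattice_scaledLattice hL (inv_ne_zero hs0), fun h hh => ?_,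
    fun w hw => ⟨fun hint => ?_, fun h hh => ?_⟩⟩
  · have h3 := hH h hh
    calc ‖B (x.1 h) h‖ ≤ ‖contForm B‖ * ‖x.1 h‖ * ‖h‖ := norm_form_le _ _
      _ ≤ b * (‖x.1‖ * ‖h‖) * ‖h‖ := by
        gcongr
        · exact le_add_of_nonneg_right zero_le_one
        · exact x.1.le_opNorm h
      _ = b * ‖x.1‖ * ‖h‖ ^ 2 := by ring
      _ ≤ b * ‖x.1‖ * (A₁ / σ) ^ 2 := by gcongr
      _ = b * ‖x.1‖ * A₁ ^ 2 / ρ := by rw [div_pow, hσsq, mul_div_assoc]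
      _ ≤ 1 := (div_le_one (one_pos.trans_le hρ1)).2 hρ4
  · have h3 := hlL _ ((mem_dual_scaledLattice hLdual (inv_ne_zero hs0) _).1 hint)
    rw [inv_inv, norm_smul, norm_smul] at h3
    have h4 : δ / 2 * ρ ≤ b * ‖x.1 w‖ * ‖x.1 w‖ := by
      have h5 := hup (x.1 w) (x.1 w)
      rw [polarMoment_self, ← cosandwich_moment] at h5
      have h6 : ‖cosandwich x η‖ ≤ ‖cosandwich x (moment B w)‖ + p * C := by
        refine (hp η (moment B w)).trans ?_
        gcongr
      linarith
    have h5 : κ * σ ≤ ‖x.1 w‖ := by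
      refine (pow_le_pow_iff_left₀ (by positivity) (norm_nonneg _) two_ne_zero).1 ?_
      rw [mul_pow, hκsq, hσsq]
      calc δ / (2 * b) * ρ = δ / 2 * ρ / b := by field_simp
        _ ≤ ‖x.1 w‖ ^ 2 := by
          rw [div_le_iff₀ hb0]
          linarith
    have h6 : 2 * l ≤ ‖s‖ * (‖(2 : F)‖ * ‖x.1 w‖) := by
      calc 2 * l = 2 * A₀ / σ * (‖(2 : F)‖ * (κ * σ)) := by
            rw [hA₀]
            field_simp
        _ ≤ _ := by gcongr
    linarith
  · have h3 := hH h hh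
    have h4 : ‖w‖ ≤ κ' * σ := by
      refine (pow_le_pow_iff_left₀ (norm_nonneg _) (by positivity) two_ne_zero).1 ?_
      rw [mul_pow, hκ'sq, hσsq]
      have h5 := hlow w w
      rw [polarMoment_self] at h5
      have h6 : ‖moment B w‖ ≤ C + ρ := by
        have h7 : ‖moment B w‖ ≤ ‖η‖ + ‖moment B w - η‖ :=
          norm_le_norm_add_norm_sub' (E := sp B →L[F] F) _ _
        linarith
      calc ‖w‖ ^ 2 = (c * ‖w‖ * ‖w‖) / c := by field_simp
        _ ≤ (2 * ρ) / c := div_le_div_of_nonneg_right (by linarith) hc.le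
        _ = 2 / c * ρ := by ring
    have h5 : A₁ / σ ≤ A₁ := div_le_self hA₁0.le hσ1
    have h6 : ‖w + h + w‖ ≤ (2 * κ' + A₁) * σ := by
      calc ‖w + h + w‖ ≤ ‖w‖ + ‖h‖ + ‖w‖ := norm_add₃_le
        _ ≤ κ' * σ + A₁ + κ' * σ := by gcongr; exact h3.trans h5
        _ ≤ κ' * σ + A₁ * σ + κ' * σ := by
          gcongr
          exact le_mul_of_one_le_right hA₁0.le hσ1
        _ = _ := by ring
    rw [moment_add_sub_moment hB]
    calc ‖polarMoment B h (w + h + w)‖ ≤ b * ‖h‖ * ‖w + h + w‖ := hup _ _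
      _ ≤ b * (A₁ / σ) * ((2 * κ' + A₁) * σ) := by gcongr
      _ = _ := by field_simp

variable [MeasurableSpace W] [BorelSpace W]
  {μ : Measure W} [μ.IsAddHaarMeasure] {ν : Measure (sp B)} [ν.IsAddHaarMeasure]
  (hχcont : Continuous χ) (hχ : ∀ a : F, χ a = 1 ↔ ‖a‖ ≤ 1)
  {Λ : Subgroup Fˣ} {u : Distribution (sp B)}
  (hu : ∀ ψ : SchwartzBruhat (sp B), u ψ =
    ∫ w : W, (∫ x : sp B, ((χ (B (x.1 w) w) : Circle) : ℂ) * (ψ : sp B → ℂ) x ∂ν) ∂μ)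

include hL hLdual hB hBnd hχcont hu in
/-- The phase `w ↦ ⟨x w, w⟩` has no stationary points with `x w ≠ 0`: over each coset of a suitable
lattice the integrand is a multiple of a non-trivial character. -/
theorem notMem_waveFrontSet_of_cosandwich_ne_zero {x : sp B} {ξ : sp B →L[F] F}
    (hξ : cosandwich x ξ ≠ 0) : (x, ξ) ∉ waveFrontSet hχ Λ u := by
  have : ProperSpace W := FiniteDimensional.proper F W
  obtain ⟨V, hV, hVc, hξV, δ, hδ, hVδ⟩ := exists_isCone_of_apply_ne_zero (Λ := Λ)
    (D := sp B →L[F] F) (D' := sp B →L[F] F) (cosandwich x).continuous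
    (fun t η => map_smul (cosandwich x) t η) hξ
  obtain ⟨A, hA, hAR⟩ := exists_translation_lattice hL hLdual hB hBnd x hδ
  obtain ⟨M, hM, hMA⟩ := exists_isLattice_subset F
    (Metric.closedBall_mem_nhds (0 : sp B) (show 0 < 1 / (A + 1) by positivity))
  obtain ⟨C, hC, hCM⟩ := hM.exists_bound (F := F)
  obtain ⟨R, hR⟩ := hAR C hC
  set φ := cosetIndicator hM x with hφ
  refine notMem_waveFrontSet (φ := φ) (R := R)
    (by rw [hφ, cosetIndicator_self]; exact one_ne_zero) hV hVc hξV fun η hη hηR => ?_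
  obtain ⟨H, hH, hHx, hHw⟩ := hR η (hVδ η hη) hηR
  set f : W → ℂ := fun w => ∫ y : sp B,
    ((χ ((moment B w - η) y) : Circle) : ℂ) * (φ : sp B → ℂ) y ∂ν with hf
  have hf0 : ∀ w, (¬ ∀ y ∈ M, ‖(moment B w - η) y‖ ≤ 1) → f w = 0 := fun w hw =>
    fourier_cosetIndicator_of_not_le hχ ν hM x hw
  have hf1 : ∀ w, (∀ y ∈ M, ‖(moment B w - η) y‖ ≤ 1) →
      f w = ((χ ((moment B w - η) x) : Circle) : ℂ) * ν.real (M : Set (sp B)) := fun w hw =>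
    fourier_cosetIndicator_of_le hχ ν hM x hw
  have hmain : ∀ w, (∀ y ∈ M, ‖(moment B w - η) y‖ ≤ 1) →
      ∫ h in (H : Set W), f (w + h) ∂μ = 0 := by
    intro w hw
    obtain ⟨hnt, hbd⟩ := hHw w (hCM _ hw)
    have h1 : ∀ h ∈ H, f (w + h) = f w * ((χ (B ((2 : F) • x.1 w) h) : Circle) : ℂ) := by
      intro h hh
      have h2 : ∀ y ∈ M, ‖(moment B (w + h) - η) y‖ ≤ 1 := by
        intro y hy
        have h3 : (moment B (w + h) - η) y =
            (moment B (w + h) - moment B w) y + (moment B w - η) y := by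
          change moment B (w + h) y - η y =
            moment B (w + h) y - moment B w y + (moment B w y - η y)
          ring
        rw [h3]
        refine (IsUltrametricDist.norm_add_le_max _ _).trans (max_le ?_ (hw y hy))
        have h4 : ‖y‖ ≤ 1 / (A + 1) := by simpa using hMA hy
        calc _ ≤ ‖moment B (w + h) - moment B w‖ * ‖y‖ := ContinuousLinearMap.le_opNorm _ _
          _ ≤ A * (1 / (A + 1)) := by
            gcongr
            exact hbd h hh
          _ ≤ 1 := by
            rw [mul_one_div, div_le_one (by positivity)]
            linarith
      rw [hf1 _ h2, hf1 _ hw]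
      have h3 : (moment B (w + h) - η) x =
          (moment B w - η) x + B ((2 : F) • x.1 w) h + B (x.1 h) h := by
        change B (x.1 (w + h)) (w + h) - η x = B (x.1 w) w - η x + _ + _
        simp only [map_add, map_smul, LinearMap.add_apply, LinearMap.smul_apply, smul_eq_mul]
        rw [sp_symm hB x h w]
        ring
      rw [h3, coe_addChar_add, coe_addChar_add, (coe_addChar_eq_one_iff hχ _).2 (hHx h hh)]
      ring
    rw [setIntegral_congr_fun hH.measurableSet (g := fun h =>
      f w * ((χ (B ((2 : F) • x.1 w) h) : Circle) : ℂ)) (fun h hh => h1 h hh), integral_const_mul,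
      setIntegral_addChar_of_not_le hχ hH (fun y z => map_add _ y z) hnt, mul_zero]
  have hint : Integrable f μ := by
    have h1 := (integrable_outer μ ν hχcont hχ hB hBnd (modulate hχ φ η).2)
    refine h1.congr (Filter.Eventually.of_forall fun w => ?_)
    exact inner_modulate hχ φ η w
  rw [fourierLocal_eq hχ hu]
  refine integral_eq_zero_of_setIntegral_coset μ hH hint fun w => ?_
  by_cases hex : ∃ h₀ ∈ H, ∀ y ∈ M, ‖(moment B (w + h₀) - η) y‖ ≤ 1
  · obtain ⟨h₀, hh₀, h1⟩ := hex
    rw [← hH.setIntegral_add_right μ (fun h => f (w + h)) hh₀, ← hmain _ h1]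
    congr 1
    ext h
    congr 1
    abel
  · push Not at hex
    rw [setIntegral_congr_fun hH.measurableSet (g := fun _ => (0 : ℂ)), integral_zero]
    intro h hh
    refine hf0 _ fun h1 => ?_
    obtain ⟨y, hy, hlt⟩ := hex h hh
    exact not_lt.2 (h1 y hy) hlt

end NotMem


/-! ### Covectors in the wave front set -/

section Polar

open Topology

variable {F : Type*} [NontriviallyNormedField F]
  {E : Type*} [NormedAddCommGroup E] [NormedSpace F E] {P : AddSubgroup E}

theorem isClosed_setOf_integral (P : AddSubgroup E) :
    IsClosed {ξ : E →L[F] F | ∀ h ∈ P, ‖ξ h‖ ≤ 1} := by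
  simp only [Set.ofPred_forall]
  exact isClosed_iInter fun h => isClosed_iInter fun _ =>
    isClosed_le (by fun_prop) continuous_const

theorem IsLattice.setOf_integral_mem_nhds (hP : IsLattice P) :
    {ξ : E →L[F] F | ∀ h ∈ P, ‖ξ h‖ ≤ 1} ∈ 𝓝 (0 : E →L[F] F) := by
  obtain ⟨r, hr, hrP⟩ := hP.isBounded.exists_pos_norm_le
  refine Filter.mem_of_superset (Metric.closedBall_mem_nhds 0 (inv_pos.2 hr)) fun ξ hξ h hh => ?_
  rw [mem_closedBall_zero_iff] at hξ
  calc ‖ξ h‖ ≤ ‖ξ‖ * ‖h‖ := ξ.le_opNorm h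
    _ ≤ r⁻¹ * r := by
      gcongr
      exact hrP h hh
    _ = 1 := inv_mul_cancel₀ hr.ne'

/-- Every lattice contains the polar of a lattice of the dual space, and this polar is a
lattice. -/
theorem IsLattice.exists_polar_le [IsUltrametricDist F] [ProperSpace F] [FiniteDimensional F E]
    {M : AddSubgroup E} (hM : IsLattice M) :
    ∃ (N : AddSubgroup (E →L[F] F)) (P : AddSubgroup E), IsLattice N ∧ IsLattice P ∧ P ≤ M ∧
      ∀ x, x ∈ P ↔ ∀ η ∈ N, ‖η x‖ ≤ 1 := by
  obtain ⟨N₁, hN₁, -⟩ := exists_isLattice_subset F (Filter.univ_mem (f := 𝓝 (0 : E →L[F] F)))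
  let β : E →ₗ[F] ((E →L[F] F) →L[F] F) := (ContinuousLinearMap.apply F F : E →L[F] _)
  have hβ : Function.Injective β := by
    refine (injective_iff_map_eq_zero β).2 fun x hx => ?_
    refine (Module.forall_dual_apply_eq_zero_iff F x).1 fun f => ?_
    exact congrArg (fun e : (E →L[F] F) →L[F] F => e (LinearMap.toContinuousLinearMap f)) hx
  obtain ⟨C, hC, hb⟩ := hN₁.exists_bound_of_injective hβ
  obtain ⟨ε, hε, hεM⟩ := Metric.mem_nhds_iff.1 hM.mem_nhds
  obtain ⟨c, hc0, hc⟩ := NormedField.exists_norm_lt F (show 0 < ε / C by positivity)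
  have hc0' : c ≠ 0 := norm_pos_iff.1 hc0
  obtain ⟨N, hN, hsub⟩ := exists_isLattice_superset F
    (hN₁.isCompact.image (continuous_const_smul c⁻¹)).isBounded
  let P : AddSubgroup E :=
    { carrier := {x | ∀ η ∈ N, ‖η x‖ ≤ 1}
      zero_mem' := by simp
      add_mem' := by
        intro x y hx hy η hη
        rw [map_add]
        exact (IsUltrametricDist.norm_add_le_max _ _).trans (max_le (hx η hη) (hy η hη))
      neg_mem' := by
        intro x hx η hη
        rw [map_neg, norm_neg]
        exact hx η hη }
  have hPM : P ≤ M := by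
    intro x hx
    refine hεM ?_
    have h1 : ‖c⁻¹ • x‖ ≤ C := hb _ fun η hη => by
      have h2 := hx (c⁻¹ • η) (hsub ⟨η, hη, rfl⟩)
      change ‖η (c⁻¹ • x)‖ ≤ 1
      rwa [map_smul]
    rw [norm_smul, norm_inv, inv_mul_le_iff₀ hc0] at h1
    rw [mem_ball_zero_iff]
    exact h1.trans_lt ((lt_div_iff₀ hC).1 hc)
  refine ⟨N, P, hN, ⟨?_, ?_⟩, hPM, fun x => Iff.rfl⟩
  · obtain ⟨r, hr, hrN⟩ := hN.isBounded.exists_pos_norm_le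
    refine AddSubgroup.isOpen_of_mem_nhds P (g := 0) (Filter.mem_of_superset
      (Metric.closedBall_mem_nhds 0 (inv_pos.2 hr)) fun x hx η hη => ?_)
    rw [mem_closedBall_zero_iff] at hx
    calc ‖η x‖ ≤ ‖η‖ * ‖x‖ := η.le_opNorm x
      _ ≤ r * r⁻¹ := by
        gcongr
        exact hrN η hη
      _ = 1 := mul_inv_cancel₀ hr.ne'
  · refine hM.isCompact.of_isClosed_subset ?_ hPM
    change IsClosed {x : E | ∀ η ∈ N, ‖η x‖ ≤ 1}
    simp only [Set.ofPred_forall]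
    exact isClosed_iInter fun η => isClosed_iInter fun _ =>
      isClosed_le (by fun_prop) continuous_const

variable [ProperSpace F] [FiniteDimensional F E] [MeasurableSpace E] [BorelSpace E]
  {ν : Measure E} [ν.IsAddHaarMeasure] {χ : AddChar F Circle} (hχcont : Continuous χ)
  (hχ : ∀ a : F, χ a = 1 ↔ ‖a‖ ≤ 1)

include hχcont hχ in
/-- If the Fourier transform of `G` vanishes on a lattice, the integral of `G` over the cosets of
the polar lattice vanishes. -/
theorem integral_mul_cosetIndicator_eq_zero {N : AddSubgroup (E →L[F] F)} (hN : IsLattice N)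
    (hP : IsLattice P) (hPN : ∀ x, x ∈ P ↔ ∀ η ∈ N, ‖η x‖ ≤ 1) {G : E → ℂ} (hG : Integrable G ν)
    (h0 : ∀ η ∈ N, ∫ x, ((χ (η x) : Circle) : ℂ) * G x ∂ν = 0) (x₀ : E) :
    ∫ x, G x * (cosetIndicator hP x₀ : E → ℂ) x ∂ν = 0 := by
  have : ProperSpace E := FiniteDimensional.proper F E
  have : ProperSpace (E →L[F] F) := FiniteDimensional.proper F _
  set lam : Measure (E →L[F] F) := Measure.addHaar with hlam
  have hfin : IsFiniteMeasure (lam.restrict (N : Set (E →L[F] F))) :=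
    ⟨by rw [Measure.restrict_apply_univ]; exact hN.isCompact.measure_lt_top⟩
  have hint : Integrable (fun z : (E →L[F] F) × E => ((χ (z.1 (z.2 - x₀)) : Circle) : ℂ) * G z.2)
      ((lam.restrict (N : Set (E →L[F] F))).prod ν) := by
    have h3 : Integrable (fun z : (E →L[F] F) × E => (1 : ℂ) * G z.2)
        ((lam.restrict (N : Set (E →L[F] F))).prod ν) :=
      Integrable.mul_prod (integrable_const _) hG
    simp only [one_mul] at h3
    refine h3.bdd_mul (c := 1) (Continuous.aestronglyMeasurable ?_)
      (Filter.Eventually.of_forall fun z => by rw [Circle.norm_coe])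
    exact (continuous_coe_addChar hχcont).comp
      (continuous_fst.clm_apply (continuous_snd.sub continuous_const))
  have hswap := integral_integral_swap
    (f := fun (η : E →L[F] F) (x : E) => ((χ (η (x - x₀)) : Circle) : ℂ) * G x) hint
  have hleft : ∫ η in (N : Set (E →L[F] F)), (∫ x, ((χ (η (x - x₀)) : Circle) : ℂ) * G x ∂ν) ∂lam =
      0 := by
    rw [setIntegral_congr_fun hN.measurableSet (g := fun _ => (0 : ℂ)), integral_zero]
    intro η hη
    have h1 : ∀ x, ((χ (η (x - x₀)) : Circle) : ℂ) * G x =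
        ((χ (-η x₀) : Circle) : ℂ) * (((χ (η x) : Circle) : ℂ) * G x) := by
      intro x
      rw [map_sub, sub_eq_neg_add, coe_addChar_add, mul_assoc]
    simp only [h1]
    rw [integral_const_mul, h0 η hη, mul_zero]
  have hright : ∀ x, ∫ η in (N : Set (E →L[F] F)), ((χ (η (x - x₀)) : Circle) : ℂ) * G x ∂lam =
      lam.real (N : Set (E →L[F] F)) * (G x * (cosetIndicator hP x₀ : E → ℂ) x) := by
    intro x
    rw [integral_mul_const]
    change _ = _ * (G x * Set.indicator (P : Set E) (fun _ => (1 : ℂ)) (x - x₀))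
    by_cases hx : x - x₀ ∈ P
    · rw [Set.indicator_of_mem (show x - x₀ ∈ (P : Set E) from hx),
        setIntegral_addChar_of_le hχ hN ((hPN _).1 hx), mul_one]
    · rw [Set.indicator_of_notMem (show x - x₀ ∉ (P : Set E) from hx),
        setIntegral_addChar_of_not_le hχ hN (f := fun η : E →L[F] F => η (x - x₀))
          (fun _ _ => rfl) (fun h => hx ((hPN _).2 h)), mul_zero, mul_zero, zero_mul]
  rw [hleft] at hswap
  simp only [hright] at hswap
  rw [integral_const_mul] at hswap
  refine (mul_eq_zero.1 hswap.symm).resolve_left ?_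
  exact Complex.ofReal_ne_zero.2 (hN.measureReal_pos lam).ne'

include hχcont in
/-- For a locally integrable function, localizing further to a small coset averages the Fourier
transform over a lattice of the dual space. -/
theorem fourierLocal_cosetIndicator_eq_zero {u : Distribution E} {g : E → ℂ}
    (hg : ∀ ψ : SchwartzBruhat E, Integrable (fun x => g x * (ψ : E → ℂ) x) ν ∧
      u ψ = ∫ x, g x * (ψ : E → ℂ) x ∂ν)
    {φ : SchwartzBruhat E} {x₀ : E} (hφ : (φ : E → ℂ) x₀ ≠ 0)
    {N : AddSubgroup (E →L[F] F)} (hN : IsLattice N) (hP : IsLattice P)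
    (hPN : ∀ x, x ∈ P ↔ ∀ η ∈ N, ‖η x‖ ≤ 1)
    (hφP : ∀ h ∈ P, (φ : E → ℂ) (x₀ + h) = (φ : E → ℂ) x₀) {ξ : E →L[F] F}
    (h0 : ∀ η ∈ N, fourierLocal hχ u φ (ξ - η) = 0) :
    fourierLocal hχ u (cosetIndicator hP x₀) ξ = 0 := by
  have h1 := integral_mul_cosetIndicator_eq_zero hχcont hχ hN hP hPN (hg (modulate hχ φ ξ)).1
    (fun η hη => by
      rw [← h0 η hη, fourierLocal, (hg _).2]
      congr 1
      ext x
      change _ * (g x * ((φ : E → ℂ) x * ((χ (-(ξ x)) : Circle) : ℂ))) =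
        g x * ((φ : E → ℂ) x * ((χ (-(ξ x - η x)) : Circle) : ℂ))
      rw [neg_sub, sub_eq_add_neg, coe_addChar_add]
      ring) x₀
  have h2 : ∀ x, g x * (modulate hχ φ ξ : E → ℂ) x * (cosetIndicator hP x₀ : E → ℂ) x =
      (φ : E → ℂ) x₀ * (g x * (modulate hχ (cosetIndicator hP x₀) ξ : E → ℂ) x) := by
    intro x
    change g x * ((φ : E → ℂ) x * ((χ (-(ξ x)) : Circle) : ℂ)) *
      Set.indicator (P : Set E) (fun _ => (1 : ℂ)) (x - x₀) = (φ : E → ℂ) x₀ * (g x *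
        (Set.indicator (P : Set E) (fun _ => (1 : ℂ)) (x - x₀) * ((χ (-(ξ x)) : Circle) : ℂ)))
    by_cases hx : x - x₀ ∈ P
    · have h3 := hφP _ hx
      rw [add_sub_cancel] at h3
      rw [h3]
      ring
    · rw [Set.indicator_of_notMem (show x - x₀ ∉ (P : Set E) from hx)]
      ring
  simp only [h2] at h1
  rw [integral_const_mul] at h1
  rw [fourierLocal, (hg _).2]
  exact (mul_eq_zero.1 h1).resolve_left hφ

end Polar

section Mem

open Topology

/-- Translates by a bounded amount of points far out along a ray stay in an open cone. -/
theorem exists_sq_smul_sub_mem {F : Type*} [NontriviallyNormedField F] [CharZero F] {D : Type*}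
    [NormedAddCommGroup D] [NormedSpace F D] {Λ : Subgroup Fˣ} (hΛ : Λ.FiniteIndex) {V : Set D}
    (hV : IsOpen V) (hVc : IsCone Λ V) {m : D} (hm : m ∈ V) (r R R₁ : ℝ) {b : ℝ} (hb : 0 < b) :
    ∃ s : Fˣ, ‖(s : F)‖ * R₁ < b ∧
      ∀ η : D, ‖η‖ ≤ r → (s : F)⁻¹ ^ 2 • m - η ∈ V ∧ R < ‖(s : F)⁻¹ ^ 2 • m - η‖ := by
  obtain ⟨ε, hε, hεV⟩ := Metric.isOpen_iff.1 hV _ hm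
  obtain ⟨a, ha, ha1⟩ := exists_mem_norm_lt_one hΛ
  have ha0 : 0 < ‖(a : F)‖ := norm_pos_iff.2 a.ne_zero
  have hm0 : 0 < ‖m‖ := norm_pos_iff.2 fun h => hVc.1 (h ▸ hm)
  have hlim := tendsto_pow_atTop_nhds_zero_of_lt_one ha0.le ha1
  have hlim2 : Filter.Tendsto (fun k : ℕ => (‖(a : F)‖ ^ k) ^ 2) Filter.atTop (𝓝 0) := by
    simpa using hlim.pow 2
  obtain ⟨k, hk1, hk2, hk3⟩ : ∃ k : ℕ, ‖(a : F)‖ ^ k * R₁ < b ∧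
      (‖(a : F)‖ ^ k) ^ 2 * r < ε ∧ (‖(a : F)‖ ^ k) ^ 2 * (R + r) < ‖m‖ := by
    have e1 := (hlim.mul_const R₁).eventually_lt_const (u := b) (by rwa [zero_mul])
    have e2 := (hlim2.mul_const r).eventually_lt_const (u := ε) (by rwa [zero_mul])
    have e3 := (hlim2.mul_const (R + r)).eventually_lt_const (u := ‖m‖) (by rwa [zero_mul])
    exact (e1.and (e2.and e3)).exists
  set s : Fˣ := a ^ k with hs
  have hsΛ : s ∈ Λ := Λ.pow_mem ha k
  have hsn : ‖(a : F)‖ ^ k = ‖(s : F)‖ := by rw [hs, Units.val_pow_eq_pow_val, norm_pow]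
  rw [hsn] at hk1 hk2 hk3
  have hs0 : 0 < ‖(s : F)‖ := norm_pos_iff.2 s.ne_zero
  refine ⟨s, hk1, fun η hη => ⟨?_, ?_⟩⟩
  · have h2 : (((s ^ 2)⁻¹ : Fˣ) : F) = ((s : F) ^ 2)⁻¹ := by push_cast; rfl
    have h1 : (s : F)⁻¹ ^ 2 • m - η = (((s ^ 2)⁻¹ : Fˣ) : F) • (m - ((s : F) ^ 2) • η) := by
      rw [h2, smul_sub, smul_smul, inv_mul_cancel₀ (pow_ne_zero 2 s.ne_zero), one_smul, inv_pow]
    rw [h1]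
    refine hVc.2 _ (Λ.inv_mem (Λ.pow_mem hsΛ 2)) _ (hεV ?_)
    rw [mem_ball_iff_norm, sub_sub_cancel_left, norm_neg, norm_smul, norm_pow]
    refine lt_of_le_of_lt ?_ hk2
    gcongr
  · have h2 := norm_le_norm_add_norm_sub' ((s : F)⁻¹ ^ 2 • m) η
    have h4 : R + r < ‖(s : F)⁻¹ ^ 2 • m‖ := by
      rw [norm_smul, norm_pow, norm_inv, inv_pow, lt_inv_mul_iff₀ (by positivity)]
      exact hk3
    linarith

open Topology

variable {F : Type*} [NontriviallyNormedField F] [IsUltrametricDist F] [ProperSpace F] [CharZero F]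
  {W : Type*} [NormedAddCommGroup W] [NormedSpace F W] [FiniteDimensional F W]
  {χ : AddChar F Circle} {B : LinearMap.BilinForm F W} (hB : B.IsAlt) (hBnd : B.Nondegenerate)

/-- The quadratic form of `x` is invariant under translation by the kernel of `x`. -/
theorem form_apply_eq_of_apply_eq_zero (x : sp B) {v : W} (hv : x.1 v = 0) (w : W) :
    B (x.1 w) w = B (x.1 (w - v)) (w - v) := by
  have h : B (x.1 w) v = 0 := by rw [sp_apply_left, hv, map_zero, neg_zero]
  rw [map_sub x.1, hv, sub_zero, map_sub, h, sub_zero]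

include hB hBnd in
/-- Near the zeros of `x` the quadratic form of `x` is small, at the scale at which the moment map
is separated. -/
theorem exists_form_le_of_apply_eq_zero (x : sp B) (C : ℝ) :
    ∃ R : ℝ, ∀ v, x.1 v = 0 → R < ‖v‖ → ∀ w, ‖moment B w - moment B v‖ ≤ C →
      ‖B (x.1 w) w‖ ≤ 1 := by
  obtain ⟨c, hc, hlow⟩ := exists_lower_bound_polarMoment hB hBnd
  have h2 : 0 < ‖(2 : F)‖ := norm_pos_iff.2 two_ne_zero
  set b := ‖contForm B‖ * ‖x.1‖ with hb
  have hb0 : 0 ≤ b := by positivity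
  have hsmall : ∀ h : W, ‖h‖ ≤ 1 / (b + 1) → ‖B (x.1 h) h‖ ≤ 1 := by
    intro h hh
    have h1 : ‖h‖ ≤ 1 := hh.trans (div_le_one_of_le₀ (by linarith) (by positivity))
    calc ‖B (x.1 h) h‖ ≤ ‖contForm B‖ * ‖x.1 h‖ * ‖h‖ := norm_form_le _ _
      _ ≤ ‖contForm B‖ * (‖x.1‖ * ‖h‖) * 1 := by
        gcongr
        exact x.1.le_opNorm h
      _ = b * ‖h‖ := by ring
      _ ≤ b * (1 / (b + 1)) := by gcongr
      _ ≤ 1 := by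
        rw [mul_one_div, div_le_one (by positivity)]
        linarith
  -- one factor of `moment B w - moment B v` is large, hence the other one is small
  have hfactor : ∀ v p q : W, 2 * C * (b + 1) / (c * ‖(2 : F)‖) < ‖v‖ →
      ‖(2 : F)‖ * ‖v‖ ≤ ‖p‖ + ‖q‖ → ‖p‖ ≤ ‖q‖ → c * ‖p‖ * ‖q‖ ≤ C → ‖p‖ ≤ 1 / (b + 1) := by
    intro v p q hv hpq hle h
    rw [div_lt_iff₀ (by positivity)] at hv
    rw [le_div_iff₀ (by positivity)]
    by_contra hlt
    have hq : ‖(2 : F)‖ * ‖v‖ ≤ 2 * ‖q‖ := by linarith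
    have hlt' : 1 < ‖p‖ * (b + 1) := not_le.1 hlt
    have h3 : c * (‖(2 : F)‖ * ‖v‖) ≤ c * (2 * ‖q‖) := by gcongr
    have h4 : c * ‖p‖ * ‖q‖ * (b + 1) ≤ C * (b + 1) := by gcongr
    have h5 : c * ‖q‖ * 1 ≤ c * ‖q‖ * (‖p‖ * (b + 1)) := by gcongr
    nlinarith
  refine ⟨2 * C * (b + 1) / (c * ‖(2 : F)‖), fun v hv hR w hw => ?_⟩
  have h1 : c * ‖w - v‖ * ‖w + v‖ ≤ C := by
    refine (hlow _ _).trans ?_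
    rwa [← moment_sub_moment hB]
  have h3 : ‖(2 : F)‖ * ‖v‖ ≤ ‖w - v‖ + ‖w + v‖ := by
    rw [← norm_smul]
    have h4 : (2 : F) • v = (w + v) - (w - v) := by
      rw [two_smul]
      abel
    rw [h4]
    exact (norm_sub_le _ _).trans_eq (add_comm _ _)
  rcases le_total ‖w - v‖ ‖w + v‖ with hle | hle
  · rw [form_apply_eq_of_apply_eq_zero x hv]
    exact hsmall _ (hfactor v _ _ hR h3 hle h1)
  · rw [form_apply_eq_of_apply_eq_zero x (v := -v) (by rw [map_neg, hv, neg_zero]), sub_neg_eq_add]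
    refine hsmall _ (hfactor v _ _ hR (by linarith) hle ?_)
    linarith

variable [MeasurableSpace W] [BorelSpace W]
  {μ : Measure W} [μ.IsAddHaarMeasure] {ν : Measure (sp B)} [ν.IsAddHaarMeasure]
  (hχcont : Continuous χ) (hχ : ∀ a : F, χ a = 1 ↔ ‖a‖ ≤ 1)
  {Λ : Subgroup Fˣ} {u : Distribution (sp B)}
  (hu : ∀ ψ : SchwartzBruhat (sp B), u ψ =
    ∫ w : W, (∫ x : sp B, ((χ (B (x.1 w) w) : Circle) : ℂ) * (ψ : sp B → ℂ) x ∂ν) ∂μ)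

include hB hBnd hu in
/-- The contribution of the stationary points does not cancel: on the set of the `w` that
contribute, the phase is equal to one. -/
theorem fourierLocal_cosetIndicator_moment_ne_zero (x : sp B) {P : AddSubgroup (sp B)}
    (hP : IsLattice P) : ∃ R : ℝ, ∀ v, x.1 v = 0 → R < ‖v‖ →
      fourierLocal hχ u (cosetIndicator hP x) (moment B v) ≠ 0 := by
  have : ProperSpace W := FiniteDimensional.proper F W
  obtain ⟨C, hC, hCP⟩ := hP.exists_bound (F := F)
  obtain ⟨R, hR⟩ := exists_form_le_of_apply_eq_zero hB hBnd x C
  refine ⟨R, fun v hv hRv => ?_⟩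
  set D : Set W := {w | ∀ h ∈ P, ‖(moment B w - moment B v) h‖ ≤ 1} with hD
  have hcont : Continuous fun w => moment B w - moment B v := by
    simp_rw [moment_sub_moment hB]
    exact continuous_polarMoment.comp
      ((continuous_id.sub continuous_const).prodMk (continuous_id.add continuous_const))
  have hDm : MeasurableSet D :=
    ((isClosed_setOf_integral (F := F) P).preimage hcont).measurableSet
  have hDn : D ∈ 𝓝 v := by
    refine hcont.continuousAt.preimage_mem_nhds
      (t := {ξ : sp B →L[F] F | ∀ h ∈ P, ‖ξ h‖ ≤ 1}) ?_
    have h0 : moment B v - moment B v = 0 := by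
      ext y
      exact sub_self _
    rw [h0]
    exact hP.setOf_integral_mem_nhds
  have hDb : Bornology.IsBounded D := by
    obtain ⟨r, hr⟩ := exists_norm_le_of_norm_moment_le hB hBnd (C + ‖moment B v‖)
    refine (Metric.isBounded_closedBall (x := (0 : W)) (r := r)).subset fun w hw => ?_
    rw [mem_closedBall_zero_iff]
    refine hr w ?_
    have h1 : ‖moment B w‖ ≤ ‖moment B v‖ + ‖moment B w - moment B v‖ :=
      norm_le_norm_add_norm_sub' (E := sp B →L[F] F) _ _
    have h2 := hCP _ hw
    linarith
  have hpos : 0 < μ.real D := ENNReal.toReal_pos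
    (Measure.measure_pos_of_mem_nhds μ hDn).ne' hDb.measure_lt_top.ne
  have hval : ∀ w, ∫ y : sp B, ((χ ((moment B w - moment B v) y) : Circle) : ℂ) *
      (cosetIndicator hP x : sp B → ℂ) y ∂ν =
        D.indicator (fun _ => (ν.real (P : Set (sp B)) : ℂ)) w := by
    intro w
    by_cases hw : w ∈ D
    · rw [fourier_cosetIndicator_of_le hχ ν hP x hw, Set.indicator_of_mem hw]
      have h1 : (moment B w - moment B v) x = B (x.1 w) w := by
        change B (x.1 w) w - B (x.1 v) v = _
        rw [hv, map_zero, LinearMap.zero_apply, sub_zero]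
      rw [h1, (coe_addChar_eq_one_iff hχ _).2 (hR v hv hRv w (hCP _ hw)), one_mul]
    · rw [fourier_cosetIndicator_of_not_le hχ ν hP x hw, Set.indicator_of_notMem hw]
  rw [fourierLocal_eq hχ hu]
  simp only [hval]
  rw [integral_indicator_const _ hDm]
  exact smul_ne_zero hpos.ne' (Complex.ofReal_ne_zero.2 (hP.measureReal_pos ν).ne')

include hB hBnd hχcont hu in
/-- If the Fourier transform of `φ` vanished far out in a cone around the covector, so would its
averages over a lattice, which are Fourier transforms of the indicator function of a small coset. -/
theorem mem_waveFrontSet_of_apply_eq_zero {g : sp B → ℂ}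
    (hg : ∀ ψ : SchwartzBruhat (sp B), Integrable (fun x => g x * (ψ : sp B → ℂ) x) ν ∧
      u ψ = ∫ x, g x * (ψ : sp B → ℂ) x ∂ν) (hΛ : Λ.FiniteIndex)
    {x : sp B} {w : W} {t : Fˣ} (ht : t ∈ Λ) (hw : moment B w ≠ 0) (hx : x.1 w = 0) :
    (x, (t : F) • moment B w) ∈ waveFrontSet hχ Λ u := by
  refine mem_waveFrontSet (smul_ne_zero t.ne_zero hw) fun φ hφ V hV hVc hξV R => ?_
  by_contra! hcon
  obtain ⟨M, hM, hMφ⟩ := exists_isLattice_invariant F φ.2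
  obtain ⟨N, P, hN, hP, hPM, hPN⟩ := hM.exists_polar_le (F := F)
  obtain ⟨R₁, hR₁⟩ := fourierLocal_cosetIndicator_moment_ne_zero (χ := χ) hB hBnd hχ hu x hP
  have hwV : moment B w ∈ V := by
    have h1 := hVc.2 _ (Λ.inv_mem ht) _ hξV
    rwa [smul_smul, Units.inv_mul, one_smul] at h1
  obtain ⟨r, hr, hrN⟩ := hN.isBounded.exists_pos_norm_le
  have hw0 : 0 < ‖w‖ := norm_pos_iff.2 ((moment_ne_zero hB hBnd).1 hw)
  obtain ⟨s, hs, hsV⟩ := exists_sq_smul_sub_mem (D := sp B →L[F] F) hΛ hV hVc hwV r R R₁ hw0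
  refine hR₁ ((s : F)⁻¹ • w) (by rw [map_smul, hx, smul_zero]) ?_
    (fourierLocal_cosetIndicator_eq_zero hχcont hχ hg hφ hN hP hPN
      (fun h hh => hMφ x h (hPM hh)) fun η hη => ?_)
  · rw [norm_smul, norm_inv, lt_inv_mul_iff₀ (norm_pos_iff.2 s.ne_zero)]
    exact hs
  · rw [moment_smul]
    obtain ⟨h1, h2⟩ := hsV η (hrN η hη)
    exact hcon _ h1 h2

variable {L : Submodule (integerRing F) W} (hL : IsLattice L.toAddSubgroup)
  (hLdual : ∀ w : W, (∀ w' ∈ L, ‖B w w'‖ ≤ 1) ↔ w ∈ L)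

include hL hLdual hB hBnd hχcont hu in
theorem waveFrontSet_eq {g : sp B → ℂ}
    (hg : ∀ ψ : SchwartzBruhat (sp B), Integrable (fun x => g x * (ψ : sp B → ℂ) x) ν ∧
      u ψ = ∫ x, g x * (ψ : sp B → ℂ) x ∂ν) (hΛ : Λ.FiniteIndex) :
    waveFrontSet hχ Λ u = {p | ∃ t ∈ Λ, ∃ w : W, moment B w ≠ 0 ∧ p.1.1 w = 0 ∧
      p.2 = (t : F) • moment B w} := by
  ext ⟨x, ξ⟩
  constructor
  · intro hmem
    have hξ : ξ ∈ coneOver Λ (moment B) := by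
      by_contra h
      exact notMem_waveFrontSet_of_notMem_coneOver hχ hB hBnd hu hΛ h hmem
    obtain ⟨t, ht, w, rfl⟩ := hξ
    obtain ⟨M, hM, -⟩ := exists_isLattice_subset F (Filter.univ_mem (f := 𝓝 (0 : sp B)))
    have h0 : (t : F) • moment B w ≠ 0 := (hmem (cosetIndicator hM x)
      (by rw [cosetIndicator_self]; exact one_ne_zero)).1
    have hw : moment B w ≠ 0 := fun h => h0 (by
      rw [h]
      ext y
      exact mul_zero (t : F))
    refine ⟨t, ht, w, hw, ?_, rfl⟩
    by_contra hxw
    refine notMem_waveFrontSet_of_cosandwich_ne_zero hL hLdual hB hBnd hχcont hχ hu ?_ hmem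
    have h1 : cosandwich x ((t : F) • moment B w) = (t : F) • moment B (x.1 w) :=
      (map_smul (cosandwich x) (t : F) (moment B w)).trans
        (congrArg _ (cosandwich_moment x w))
    rw [h1]
    exact smul_ne_zero t.ne_zero ((moment_ne_zero hB hBnd).2 hxw)
  · rintro ⟨t, ht, w, hw, hxw, h⟩
    change ξ = _ at h
    rw [h]
    exact mem_waveFrontSet_of_apply_eq_zero hB hBnd hχcont hχ hu hg hΛ ht hw hxw

end Mem


end ChcDist


theorem mainTheorem3
    {F : Type*} [NontriviallyNormedField F] [IsUltrametricDist F] [ProperSpace F] [CharZero F]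
    {W : Type*} [NormedAddCommGroup W] [NormedSpace F W] [FiniteDimensional F W] [Nontrivial W]
    [MeasurableSpace W] [BorelSpace W]
    (B : LinearMap.BilinForm F W) (hBalt : B.IsAlt) (hBnd : B.Nondegenerate)
    (L : Submodule (integerRing F) W) (hLopen : IsOpen (L : Set W))
    (hLcompact : IsCompact (L : Set W))
    (hLdual : ∀ w : W, (∀ w' ∈ L, ‖B w w'‖ ≤ 1) ↔ w ∈ L)
    (χ : AddChar F Circle) (hχcont : Continuous χ) (hχ : ∀ a : F, χ a = 1 ↔ ‖a‖ ≤ 1)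
    (μ : Measure W) [μ.IsAddHaarMeasure] (hμ : μ (L : Set W) = 1)
    (ν : Measure (sp B)) [ν.IsAddHaarMeasure]
    (hν : ν {x : sp B | ∀ w ∈ L, x.1 w ∈ L} = 1) :
    -- absolute convergence of the consecutive integrals
    (∀ ψ ∈ SchwartzBruhat (sp B),
      (∀ w : W, Integrable (fun x : sp B => ((χ (B (x.1 w) w) : Circle) : ℂ) * ψ x) ν) ∧
      Integrable (fun w : W => ∫ x : sp B, ((χ (B (x.1 w) w) : Circle) : ℂ) * ψ x ∂ν) μ) ∧
    -- the distribution `chc`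
    ∃ chc : Distribution (sp B),
      (∀ ψ : SchwartzBruhat (sp B), chc ψ =
        ∫ w : W, (∫ x : sp B, ((χ (B (x.1 w) w) : Circle) : ℂ) * (ψ : sp B → ℂ) x ∂ν) ∂μ) ∧
      -- `chc` as a function
      (∀ ψ : SchwartzBruhat (sp B),
        Integrable (fun x : sp B => weilFactor χ μ (spQuadraticForm B x) *
          ((haarModule (2 : F) ^ (-(Module.finrank F W : ℝ) / 2) *
            haarModule (LinearMap.det (x.1 : W →ₗ[F] W)) ^ (-(1 / 2) : ℝ) : ℝ) : ℂ) *
          (ψ : sp B → ℂ) x) ν ∧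
        chc ψ = ∫ x : sp B, weilFactor χ μ (spQuadraticForm B x) *
          ((haarModule (2 : F) ^ (-(Module.finrank F W : ℝ) / 2) *
            haarModule (LinearMap.det (x.1 : W →ₗ[F] W)) ^ (-(1 / 2) : ℝ) : ℝ) : ℂ) *
          (ψ : sp B → ℂ) x ∂ν) ∧
      (∀ x : sp B, LinearMap.det (x.1 : W →ₗ[F] W) ≠ 0 →
        IsWeilFactor χ μ (spQuadraticForm B x) (weilFactor χ μ (spQuadraticForm B x)) ∧
        weilFactor χ μ (spQuadraticForm B x) ^ 8 = 1) ∧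
      -- the minimal nilpotent orbit and its invariant measure
      IsMinimalNilpotentOrbit B (moment B '' {0}ᶜ) ∧
      (∃ m : Measure (sp B →L[F] F), IsFiniteMeasureOnCompacts m ∧ m ≠ 0 ∧
        m (moment B '' {0}ᶜ)ᶜ = 0 ∧
        (∀ g : Sp B, m.map (coadjoint B g) = m) ∧
        ∀ ψ : SchwartzBruhat (sp B),
          Integrable (fun ξ : sp B →L[F] F =>
            ∫ x : sp B, ((χ (ξ x) : Circle) : ℂ) * (ψ : sp B → ℂ) x ∂ν) m ∧
          chc ψ = ∫ ξ : sp B →L[F] F,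
            (∫ x : sp B, ((χ (ξ x) : Circle) : ℂ) * (ψ : sp B → ℂ) x ∂ν) ∂m) ∧
      -- the wave front set
      (∀ Λ : Subgroup Fˣ, Λ.FiniteIndex →
        waveFrontSet hχ Λ chc = {p | ∃ t ∈ Λ, ∃ w : W, moment B w ≠ 0 ∧ p.1.1 w = 0 ∧
          p.2 = (t : F) • moment B w}) ∧
      (∀ Λ : Subgroup Fˣ, Λ.FiniteIndex → (∀ t ∈ Λ, IsSquare t) →
        waveFrontSet hχ Λ chc = {p | ∃ w : W, moment B w ≠ 0 ∧ p.1.1 w = 0 ∧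
          p.2 = moment B w}) := by
  have hL : IsLattice L.toAddSubgroup := ⟨hLopen, hLcompact⟩
  have hchc : ∀ ψ : SchwartzBruhat (sp B), chcDistribution μ ν hχcont hχ hBalt hBnd ψ =
      ∫ w : W, (∫ x : sp B, ((χ (B (x.1 w) w) : Circle) : ℂ) * (ψ : sp B → ℂ) x ∂ν) ∂μ :=
    fun _ => rfl
  have hfun : ∀ ψ : SchwartzBruhat (sp B),
      Integrable (fun x : sp B => weilFactor χ μ (spQuadraticForm B x) * (detWeight x : ℂ) *
        (ψ : sp B → ℂ) x) ν ∧
      chcDistribution μ ν hχcont hχ hBalt hBnd ψ =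
        ∫ x : sp B, weilFactor χ μ (spQuadraticForm B x) * (detWeight x : ℂ) *
          (ψ : sp B → ℂ) x ∂ν :=
    fun ψ => chc_eq_integral μ ν hχcont hχ hBalt hBnd hL hμ hLdual ψ.2
  have hWF := fun (Λ : Subgroup Fˣ) (hΛ : Λ.FiniteIndex) =>
    waveFrontSet_eq (Λ := Λ) hBalt hBnd hχcont hχ hchc hL hLdual hfun hΛ
  refine ⟨fun ψ hψ => ⟨fun w => integrable_inner ν hχ hψ (moment B w),
    integrable_outer μ ν hχcont hχ hBalt hBnd hψ⟩,
    chcDistribution μ ν hχcont hχ hBalt hBnd, hchc, hfun, fun x hx => ?_,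
    isMinimalNilpotentOrbit_moment hBalt hBnd, ?_, hWF, fun Λ hΛ hsq => ?_⟩
  · obtain ⟨h1, h2, -⟩ := weilFactor_spec μ hχcont hχ hBalt hBnd hL hμ hLdual hx
    exact ⟨h1, h2⟩
  · refine ⟨μ.map (moment B), isFiniteMeasureOnCompacts_map_moment hBalt hBnd μ, ?_,
      map_moment_compl_orbit hBalt hBnd μ, map_coadjoint_map_moment hBnd μ, fun ψ => ?_⟩
    · exact (Measure.map_ne_zero_iff continuous_moment.measurable.aemeasurable).2 (NeZero.ne μ)
    · have hm : AEMeasurable (moment B) μ := continuous_moment.measurable.aemeasurable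
      have hc := (continuous_fourier hχcont (μ := ν) ψ.2).aestronglyMeasurable
        (μ := μ.map (moment B))
      exact ⟨(integrable_map_measure hc hm).2 (integrable_outer μ ν hχcont hχ hBalt hBnd ψ.2),
        (integral_map hm hc).symm⟩
  · rw [hWF Λ hΛ]
    ext p
    constructor
    · rintro ⟨t, ht, w, hw, hpw, hp⟩
      obtain ⟨c, hc⟩ := hsq t ht
      -- a square factor is absorbed by the quadratic moment map
      have hmom : moment B ((c : F) • w) = (t : F) • moment B w := by
        rw [moment_smul, hc, Units.val_mul, sq]
      refine ⟨(c : F) • w, ?_, by rw [map_smul, hpw, smul_zero], hp.trans hmom.symm⟩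
      rw [hmom]
      exact smul_ne_zero t.ne_zero hw
    · rintro ⟨w, hw, hpw, hp⟩
      exact ⟨1, Λ.one_mem, w, hw, hpw, by rw [hp, Units.val_one, one_smul]⟩
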